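/- Let $M$ be a smooth ($C^\infty$) Hausdorff manifold of dimension $n\ge 1$ with smooth boundary $\partial M$, not necessarily compact. Let $F\colon TM\to\mathbb R$ be a Finsler metric, not necessarily reversible: $F$ is continuous, positive and smooth outside the zero section, $F(x,cv)=cF(x,v)$ for $c>0$, and $g_v=\tfrac12\partial_v^2(F^2)(x,v)$ is positive definite for every $v\in T_xM\setminus 0$. Geodesics are the solutions, with nonvanishing velocity, of the Euler–Lagrange equation of $\tfrac12F^2$. Assume that $\partial M$ is strictly convex: there is a smooth function $f$ on an open neighborhood of $\partial M$ in $M$ with $f=0$ and $\mathrm df\ne0$ on $\partial M$ and $f>0$ off $\partial M$, such that $\partial_t^2 f(\gamma(t))|_{t=0}<0$ for every geodesic $\gamma$ tangent to $\partial M$ at $t=0$. (Since such a geodesic need not stay in $M$, the second derivative means the value that the chain rule and the geodesic equation give in local coordinates at $\gamma(0)$.) For $x\in M$ let $G_x\subset T_xM\setminus0$ be the set of those $v$ for which the maximal geodesic in $M$ starting at $v$ (forward in time) ends at a point of $\partial M$ after a finite time $T\ge 0$ and is a shortest curve in $M$ from its initial point to its final point with respect to $F$-length; here $T=0$ is allowed,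 and occurs when $x\in\partial M$ and the geodesic leaves $M$ immediately. Let $\sigma(G_x)=G_x\cup(-G_x)$. Then $$U=\{x\in M:\ \sigma(G_x)=T_xM\setminus 0\}$$ is a neighborhood of $\partial M$ in $M$. -/

import Mathlib

open Set
open scoped Manifold ContDiff Topology

noncomputable section

namespace Finsler

variable {E : Type*} [NormedAddCommGroup E] [NormedSpace ℝ E]
  {H : Type*} [TopologicalSpace H] {I : ModelWithCorners ℝ E H}
  {M : Type*} [TopologicalSpace M] [ChartedSpace H M]

/-- The fundamental tensor `g_v(a, u) = ½ ∂²(F²)/∂v² (a, u)` of `F` at `ξ = (x, v)`: the second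
derivative at `v` of `½ F²` along the fibre `T_x M` (which Mathlib models on `E`). -/
def fundamentalTensor (F : TangentBundle I M → ℝ) (ξ : TangentBundle I M) (a u : E) : ℝ :=
  fderiv ℝ (fun w : E => fderiv ℝ (fun w' : E => F ⟨ξ.1, w'⟩ ^ 2 / 2) w u) ξ.2 a

variable [IsManifold I ∞ M]

/-- `F` is a (not necessarily reversible) Finsler metric on `M`. -/
structure IsFinslerMetric (F : TangentBundle I M → ℝ) : Prop where
  continuous : Continuous F
  pos : ∀ ξ : TangentBundle I M, ξ.2 ≠ 0 → 0 < F ξ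
  /-- smooth outside the zero section (up to the boundary) -/
  smooth : ContMDiffOn I.tangent 𝓘(ℝ, ℝ) ∞ F {ξ | ξ.2 ≠ 0}
  /-- positively homogeneous of degree one -/
  homogeneous : ∀ (x : M) (v : TangentSpace I x) (c : ℝ), 0 < c → F ⟨x, c • v⟩ = c * F ⟨x, v⟩
  /-- the fundamental tensor is positive definite at every nonzero vector -/
  strongly_convex : ∀ (ξ : TangentBundle I M) (u : E), ξ.2 ≠ 0 → u ≠ 0 →
    0 < fundamentalTensor F ξ u u

/-- The energy Lagrangian `L(y, w) = ½ F(y, w)²` read in the chart of `TM` around the fibre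
over `x`. -/
def chartEnergy (F : TangentBundle I M → ℝ) (x : M) (y w : E) : ℝ :=
  F ((extChartAt I.tangent (⟨x, 0⟩ : TangentBundle I M)).symm (y, w)) ^ 2 / 2

/-- `a` is the coordinate acceleration, in the chart at `x`, which the geodesic equation prescribes
at `ξ = (x, v)`: the Euler-Lagrange equation `d/dt (∂L/∂w) = ∂L/∂y` of `L = ½ F²`, that is
`∂²L/∂w∂w (a, u) + ∂²L/∂y∂w (v, u) = ∂L/∂y (u)` for all `u`. Derivatives in the base variable are
taken within the range of the model, so that this makes sense at boundary points too. -/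
def IsGeodesicAcceleration (F : TangentBundle I M → ℝ) (ξ : TangentBundle I M) (a : E) : Prop :=
  ∀ u : E,
    fundamentalTensor F ξ a u
      + fderivWithin ℝ (fun y : E => fderiv ℝ (fun w : E => chartEnergy F ξ.1 y w) ξ.2 u)
          (range I) (extChartAt I ξ.1 ξ.1) ξ.2
      = fderivWithin ℝ (fun y : E => chartEnergy F ξ.1 y ξ.2)
          (range I) (extChartAt I ξ.1 ξ.1) u

/-- `η : s → TM` is an orbit of the geodesic flow, i.e. `η = (γ, γ')` for a geodesic `γ`. In the
chart at `η t` its derivative is `(γ'(t), a)`, with the acceleration `a` that the geodesic equation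
prescribes. -/
def IsGeodesicOn (F : TangentBundle I M → ℝ) (η : ℝ → TangentBundle I M) (s : Set ℝ) : Prop :=
  ∀ t ∈ s, (η t).2 ≠ 0 ∧ ∃ a : E, IsGeodesicAcceleration F (η t) a ∧
    HasMFDerivWithinAt 𝓘(ℝ, ℝ) I.tangent η s t
      ((1 : ℝ →L[ℝ] ℝ).smulRight (((η t).2, a) : E × E))

/-- The `F`-length of the curve `c : [r, s] → M`. -/
def curveLength (F : TangentBundle I M → ℝ) (c : ℝ → M) (r s : ℝ) : ℝ :=
  ∫ t in r..s, F ⟨c t, mfderivWithin 𝓘(ℝ, ℝ) I c (Icc r s) t (1 : ℝ)⟩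

/-- `c : [0, T] → M` is a shortest curve from `c 0` to `c T` in `M`. It is enough to compare with
`C¹` curves, whose velocity may vanish: every piecewise `C¹` curve has such a reparametrization. -/
def IsShortest (F : TangentBundle I M → ℝ) (c : ℝ → M) (T : ℝ) : Prop :=
  ∀ c' : ℝ → M, ContMDiffOn 𝓘(ℝ, ℝ) I 1 c' (Icc 0 1) → c' 0 = c 0 → c' 1 = c T →
    curveLength F c 0 T ≤ curveLength F c' 0 1

/-- `η : [0, T] → TM` is the (forward) maximal geodesic in `M` starting at `ξ`, and it has the
finite length of time `T`. The case `T = 0` occurs: a geodesic starting at a boundary point may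
leave `M` at once. -/
def IsMaximalGeodesic (F : TangentBundle I M → ℝ) (ξ : TangentBundle I M)
    (η : ℝ → TangentBundle I M) (T : ℝ) : Prop :=
  0 ≤ T ∧ IsGeodesicOn F η (Icc 0 T) ∧ η 0 = ξ ∧
    ∀ (T' : ℝ) (η' : ℝ → TangentBundle I M), 0 ≤ T' → IsGeodesicOn F η' (Icc 0 T') → η' 0 = ξ →
      T' ≤ T

/-- The fibre `G_x` of the good set: nonzero `v ∈ T_x M` such that the maximal geodesic starting at
`v` reaches `∂M` in finite time and is a shortest curve joining its endpoints. -/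
def goodDirections (F : TangentBundle I M → ℝ) (x : M) : Set (TangentSpace I x) :=
  {v | v ≠ 0 ∧ ∃ (T : ℝ) (η : ℝ → TangentBundle I M),
    IsMaximalGeodesic F ⟨x, v⟩ η T ∧ (η T).1 ∈ I.boundary M ∧ IsShortest F (fun t => (η t).1) T}

/-- The symmetrization `σ(A) = A ∪ -A`. -/
def symmetrization {V : Type*} [AddCommGroup V] (A : Set V) : Set V :=
  A ∪ {v | -v ∈ A}

/-- For a curve with position `p`, velocity `v` and (coordinate) acceleration `a` at `t = 0`, the
value of `∂²f(γ(t))/∂t²` at `t = 0`, by the chain rule in the chart at `p`: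
`D²f(v, v) + Df(a)`. It needs no curve staying in `M`. -/
def secondDerivAlong (I : ModelWithCorners ℝ E H) {M : Type*} [TopologicalSpace M]
    [ChartedSpace H M] (f : M → ℝ) (p : M) (v a : E) : ℝ :=
  iteratedFDerivWithin ℝ 2 (f ∘ (extChartAt I p).symm) (range I) (extChartAt I p p) ![v, v]
    + fderivWithin ℝ (f ∘ (extChartAt I p).symm) (range I) (extChartAt I p p) a

/-- `∂M` is strictly convex: there is a smooth function `f` in a neighbourhood of `∂M`, vanishing
on `∂M`, positive off `∂M`, with `df ≠ 0` on `∂M`, such that every geodesic `γ` tangent to `∂M` at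
`t = 0` has `∂²f(γ(t))/∂t² < 0` at `t = 0`. The tangent space of `∂M` is the kernel of `df`. -/
def HasStrictlyConvexBoundary (F : TangentBundle I M → ℝ) : Prop :=
  ∃ (N : Set M) (f : M → ℝ), IsOpen N ∧ I.boundary M ⊆ N ∧
    ContMDiffOn I 𝓘(ℝ, ℝ) ∞ f N ∧
    (∀ p ∈ I.boundary M, f p = 0 ∧ mfderiv I 𝓘(ℝ, ℝ) f p ≠ 0) ∧
    (∀ x ∈ N \ I.boundary M, 0 < f x) ∧
    ∀ p ∈ I.boundary M, ∀ v : TangentSpace I p, v ≠ 0 → mfderiv I 𝓘(ℝ, ℝ) f p v = 0 →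
      ∀ a : E, IsGeodesicAcceleration F ⟨p, v⟩ a → secondDerivAlong I f p v a < 0

end Finsler

end

/-! Near a boundary point p every direction that does not point inwards is good. Since at least one
of v, -v does not point inwards, this suffices. "Inwards" is measured in one fixed chart at p, where
M looks like a half-space {ℓ ≥ 0}, so all points x near p are treated at once.

Exit. In this chart f vanishes where ℓ does. Hence its second derivative vanishes on vectors tangent
to the boundary, and df at p is a nonnegative multiple of ℓ. Strict convexity therefore says that
geodesics tangent to ∂M at p have acceleration with ℓ < 0
(`IsHalfSpace.apply_neg_of_secondDeriv_neg`, `apply_chartSpray_neg`). By compactness this persists,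
with a bound -c, for nearly tangent vectors near p. A geodesic with ℓ ≤ 0 on its initial velocity
then has ℓ ≤ -ct on its velocity at time t, and leaves within any prescribed time if it starts close
enough to p (`exists_exit`). To follow it past the boundary, the geodesic field is precomposed with
a nonexpansive retraction onto the half-space, which keeps it Lipschitz. Uniqueness for this field
shows that no geodesic in M outlives the exit time (`mul_le_of_isGeodesicOn`).

Minimality. Fibrewise convexity of L = F²/2 gives L(y,w) ≥ L(x,v) + dL(x,v)(y-x, w-v) + κ|w-v|² -
C|y-x|² (`exists_energy_ge`). This is integrated along a competitor, reparametrized to almost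
constant speed and compared with the geodesic at equal times. The Euler-Lagrange equation turns the
first-order term into a total derivative with zero boundary values, and for CT² ≤ κ a Poincaré
inequality makes the quadratic part nonnegative (`mul_sqrt_le_integral`). Competitors that leave the
chart ball are handled more crudely: reaching its sphere costs a fixed length, while the geodesic
arc is as short as desired (`exists_minimizing_exit`, `le_curveLength`). -/

noncomputable section

namespace Finsler

/-! ### The Euler-Lagrange equation in coordinates and its invariance. -/

section CoordCalculus

open ContinuousLinearMap

variable {E : Type*} [NormedAddCommGroup E] [NormedSpace ℝ E]
  {X : Type*} [NormedAddCommGroup X] [NormedSpace ℝ X]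

/-- A smooth, positively two-homogeneous Lagrangian over a relatively open subset `D` of the
set `R`. -/
structure IsCoordEnergy (R D : Set E) (L : E → E → ℝ) : Prop where
  uniqueDiffOn : UniqueDiffOn ℝ R
  subset : D ⊆ R
  mem_nhdsWithin : ∀ y ∈ D, D ∈ 𝓝[R] y
  smooth : ContDiffOn ℝ ∞ (Function.uncurry L) (D ×ˢ {0}ᶜ)
  homogeneous : ∀ y ∈ D, ∀ (c : ℝ) (w : E), 0 < c → L y (c • w) = c ^ 2 * L y w
  nonneg : ∀ y ∈ D, ∀ w, 0 ≤ L y w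

/-- The Euler-Lagrange equation at position `y`, velocity `w` for the acceleration `a`. -/
def EulerLagrange (R : Set E) (L : E → E → ℝ) (y w a : E) : Prop :=
  ∀ u : E, fderiv ℝ (fun w' => fderiv ℝ (fun w'' => L y w'') w' u) w a
      + fderivWithin ℝ (fun y' => fderiv ℝ (fun w' => L y' w') w u) R y w
    = fderivWithin ℝ (fun y' => L y' w) R y u

/-- The momentum (Legendre transform) of a Lagrangian. -/
def momentum (L : E → E → ℝ) (q : E × E) : E →L[ℝ] ℝ := fderiv ℝ (L q.1) q.2

namespace IsCoordEnergy

variable {R D : Set E} {L : E → E → ℝ} (h : IsCoordEnergy R D L)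
include h

theorem uniqueDiffOn_domain : UniqueDiffOn ℝ D := fun y hy =>
  (h.uniqueDiffOn y (h.subset hy)).mono_nhds (nhdsWithin_le_of_mem (h.mem_nhdsWithin y hy))

theorem uniqueDiffOn_prod : UniqueDiffOn ℝ (D ×ˢ ({0}ᶜ : Set E)) :=
  h.uniqueDiffOn_domain.prod isOpen_compl_singleton.uniqueDiffOn

omit h in
theorem hasFDerivAt_right {G : E × E → X} {G' : E × E →L[ℝ] X} {q : E × E}
    (hG : HasFDerivWithinAt G G' (D ×ˢ {0}ᶜ) q) (hq : q ∈ D ×ˢ ({0}ᶜ : Set E)) :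
    HasFDerivAt (fun w => G (q.1, w)) (G'.comp (inr ℝ E E)) q.2 := by
  have h1 : HasFDerivWithinAt (fun w : E => (q.1, w)) (inr ℝ E E) {0}ᶜ q.2 :=
    (hasFDerivAt_prodMk_right q.1 q.2).hasFDerivWithinAt
  have h2 : HasFDerivWithinAt (fun w => G (q.1, w)) (G'.comp (inr ℝ E E)) {0}ᶜ q.2 :=
    HasFDerivWithinAt.comp (g := G) (t := D ×ˢ {0}ᶜ) q.2 hG h1 (fun w hw => ⟨hq.1, hw⟩)
  exact h2.hasFDerivAt (isOpen_compl_singleton.mem_nhds hq.2)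

theorem hasFDerivWithinAt_left {G : E × E → X} {G' : E × E →L[ℝ] X} {q : E × E}
    (hG : HasFDerivWithinAt G G' (D ×ˢ {0}ᶜ) q) (hq : q ∈ D ×ˢ ({0}ᶜ : Set E)) :
    HasFDerivWithinAt (fun y => G (y, q.2)) (G'.comp (inl ℝ E E)) R q.1 := by
  have h1 : HasFDerivWithinAt (fun y : E => (y, q.2)) (inl ℝ E E) D q.1 :=
    (hasFDerivAt_prodMk_left q.1 q.2).hasFDerivWithinAt
  have h2 : HasFDerivWithinAt (fun y => G (y, q.2)) (G'.comp (inl ℝ E E)) D q.1 :=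
    HasFDerivWithinAt.comp (g := G) (t := D ×ˢ {0}ᶜ) q.1 hG h1 (fun w hw => ⟨hw, hq.2⟩)
  exact h2.mono_of_mem_nhdsWithin (h.mem_nhdsWithin _ hq.1)

theorem hasFDerivWithinAt_uncurry {q : E × E} (hq : q ∈ D ×ˢ ({0}ᶜ : Set E)) :
    HasFDerivWithinAt (Function.uncurry L)
      (fderivWithin ℝ (Function.uncurry L) (D ×ˢ {0}ᶜ) q) (D ×ˢ {0}ᶜ) q :=
  ((h.smooth q hq).differentiableWithinAt (by simp)).hasFDerivWithinAt

theorem momentum_eq {q : E × E} (hq : q ∈ D ×ˢ ({0}ᶜ : Set E)) :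
    momentum L q
      = (fderivWithin ℝ (Function.uncurry L) (D ×ˢ {0}ᶜ) q).comp (inr ℝ E E) :=
  (hasFDerivAt_right (h.hasFDerivWithinAt_uncurry hq) hq).fderiv

theorem hasFDerivAt_momentum {q : E × E} (hq : q ∈ D ×ˢ ({0}ᶜ : Set E)) :
    HasFDerivAt (L q.1) (momentum L q) q.2 :=
  (hasFDerivAt_right (h.hasFDerivWithinAt_uncurry hq) hq).differentiableAt.hasFDerivAt

theorem contDiffOn_fderivWithin :
    ContDiffOn ℝ ∞ (fderivWithin ℝ (Function.uncurry L) (D ×ˢ {0}ᶜ)) (D ×ˢ {0}ᶜ) :=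
  h.smooth.fderivWithin h.uniqueDiffOn_prod (by simp)

theorem contDiffOn_momentum : ContDiffOn ℝ ∞ (momentum L) (D ×ˢ {0}ᶜ) :=
  (h.contDiffOn_fderivWithin.clm_comp contDiffOn_const).congr fun _ hq => h.momentum_eq hq

theorem hasFDerivWithinAt_momentum {q : E × E} (hq : q ∈ D ×ˢ ({0}ᶜ : Set E)) :
    HasFDerivWithinAt (momentum L)
      (fderivWithin ℝ (momentum L) (D ×ˢ {0}ᶜ) q) (D ×ˢ {0}ᶜ) q :=
  ((h.contDiffOn_momentum q hq).differentiableWithinAt (by simp)).hasFDerivWithinAt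

/-- This is the form d/dt (momentum) = ∂L/∂y: the two terms on the left of the equation are the
derivatives of the momentum along (0, a) and (w, 0). As an identity of covectors it is accessible to
the chain rule. -/
theorem eulerLagrange_iff {y w a : E} (hy : y ∈ D) (hw : w ≠ 0) :
    EulerLagrange R L y w a ↔
      fderivWithin ℝ (momentum L) (D ×ˢ {0}ᶜ) (y, w) (w, a)
        = (fderivWithin ℝ (Function.uncurry L) (D ×ˢ {0}ᶜ) (y, w)).comp (inl ℝ E E) := by
  have hq : (y, w) ∈ D ×ˢ ({0}ᶜ : Set E) := ⟨hy, hw⟩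
  have hR := h.uniqueDiffOn y (h.subset hy)
  rw [ContinuousLinearMap.ext_iff]
  refine forall_congr' fun u => ?_
  have hP := h.hasFDerivWithinAt_momentum hq
  have hPu : HasFDerivWithinAt (fun q => momentum L q u) _ (D ×ˢ {0}ᶜ) (y, w) :=
    hP.clm_apply (hasFDerivWithinAt_const u _ _)
  have e1 := (hasFDerivAt_right hPu hq).fderiv
  have e2 := (h.hasFDerivWithinAt_left hPu hq).fderivWithin hR
  have e3 := (h.hasFDerivWithinAt_left (h.hasFDerivWithinAt_uncurry hq) hq).fderivWithin hR
  simp only [momentum] at e1 e2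
  simp only [Function.uncurry] at e3
  rw [e1, e2, e3]
  have : ((w, a) : E × E) = (0, a) + (w, 0) := by simp
  rw [this, map_add]
  simp

end IsCoordEnergy

/-- Invariance of the Euler-Lagrange equation under a change of coordinates `φ`. -/
theorem EulerLagrange.of_coordChange {R D₁ D₂ O : Set E} {L₁ L₂ : E → E → ℝ} {φ : E → E}
    (h₁ : IsCoordEnergy R D₁ L₁) (h₂ : IsCoordEnergy R D₂ L₂)
    (hRi : R ⊆ closure (interior R)) (hO : O ⊆ D₁)
    (hO' : ∀ y ∈ O, O ∈ 𝓝[R] y) (hφ : ContDiffOn ℝ ∞ φ O) (hmaps : MapsTo φ O D₂)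
    (hinj : ∀ y ∈ O, ∀ w : E, w ≠ 0 → fderivWithin ℝ φ R y w ≠ 0)
    (hL : ∀ y ∈ O, ∀ w : E, L₁ y w = L₂ (φ y) (fderivWithin ℝ φ R y w))
    {y w a : E} (hy : y ∈ O) (hw : w ≠ 0)
    (hEL : EulerLagrange R L₂ (φ y) (fderivWithin ℝ φ R y w)
      (fderivWithin ℝ (fderivWithin ℝ φ R) R y w w + fderivWithin ℝ φ R y a)) :
    EulerLagrange R L₁ y w a := by
  have hR : UniqueDiffOn ℝ R := h₁.uniqueDiffOn
  rw [h₁.eulerLagrange_iff (hO hy) hw]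
  rw [h₂.eulerLagrange_iff (hmaps hy) (hinj y hy w hw)] at hEL
  have hφR : ∀ y ∈ O, ContDiffWithinAt ℝ ∞ φ R y := fun y hy =>
    (hφ y hy).mono_of_mem_nhdsWithin (hO' y hy)
  have hφ' : ∀ y ∈ O, ContDiffWithinAt ℝ ∞ (fderivWithin ℝ φ R) R y := fun y hy =>
    (hφR y hy).fderivWithin_right hR (by simp) (h₁.subset (hO hy))
  -- The tangent map of `φ`; by `hL` it pulls `L₂` back to `L₁`.
  set Φ : E × E → E × E := fun q => (φ q.1, fderivWithin ℝ φ R q.1 q.2) with hΦ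
  have hmapsΦ : MapsTo Φ (O ×ˢ {0}ᶜ) (D₂ ×ˢ {0}ᶜ) := fun q hq =>
    ⟨hmaps hq.1, hinj _ hq.1 _ hq.2⟩
  have hOu : UniqueDiffOn ℝ (O ×ˢ ({0}ᶜ : Set E)) := by
    refine UniqueDiffOn.prod (fun y hy => ?_) isOpen_compl_singleton.uniqueDiffOn
    exact (hR y (h₁.subset (hO hy))).mono_nhds (nhdsWithin_le_of_mem (hO' y hy))
  have hsub : O ×ˢ ({0}ᶜ : Set E) ⊆ D₁ ×ˢ {0}ᶜ := prod_mono hO le_rfl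
  have hOR : O ⊆ R := hO.trans h₁.subset
  -- derivative of `Φ`
  have hΦ' : ∀ q ∈ O ×ˢ ({0}ᶜ : Set E), ∃ Φ' : E × E →L[ℝ] E × E,
      HasFDerivWithinAt Φ Φ' (O ×ˢ {0}ᶜ) q ∧
      ∀ u b, Φ' (u, b) = (fderivWithin ℝ φ R q.1 u,
        fderivWithin ℝ (fderivWithin ℝ φ R) R q.1 u q.2 + fderivWithin ℝ φ R q.1 b) := by
    intro q hq
    have d1 : HasFDerivWithinAt φ (fderivWithin ℝ φ R q.1) O q.1 :=
      ((hφR _ hq.1).differentiableWithinAt (by simp)).hasFDerivWithinAt.mono hOR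
    have d2 : HasFDerivWithinAt (fderivWithin ℝ φ R)
        (fderivWithin ℝ (fderivWithin ℝ φ R) R q.1) O q.1 :=
      ((hφ' _ hq.1).differentiableWithinAt (by simp)).hasFDerivWithinAt.mono hOR
    have e1 : HasFDerivWithinAt (fun q : E × E => φ q.1) _ (O ×ˢ {0}ᶜ) q :=
      d1.comp q hasFDerivWithinAt_fst (fun _ hz => hz.1)
    have e2 : HasFDerivWithinAt (fun q : E × E => fderivWithin ℝ φ R q.1) _ (O ×ˢ {0}ᶜ) q :=
      d2.comp q hasFDerivWithinAt_fst (fun _ hz => hz.1)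
    refine ⟨_, e1.prodMk (e2.clm_apply hasFDerivWithinAt_snd), fun u b => ?_⟩
    simp [add_comm]
  -- the chain rule for the differential of the Lagrangian
  have hDL : ∀ q ∈ O ×ˢ ({0}ᶜ : Set E), ∀ u b,
      fderivWithin ℝ (Function.uncurry L₁) (D₁ ×ˢ {0}ᶜ) q (u, b)
        = fderivWithin ℝ (Function.uncurry L₂) (D₂ ×ˢ {0}ᶜ) (Φ q)
          (fderivWithin ℝ φ R q.1 u,
            fderivWithin ℝ (fderivWithin ℝ φ R) R q.1 u q.2 + fderivWithin ℝ φ R q.1 b) := by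
    intro q hq u b
    obtain ⟨Φ', hΦd, hΦe⟩ := hΦ' q hq
    have e1 := (h₁.hasFDerivWithinAt_uncurry (hsub hq)).mono hsub
    have e2 : HasFDerivWithinAt (Function.uncurry L₁) _ (O ×ˢ {0}ᶜ) q :=
      HasFDerivWithinAt.congr ((h₂.hasFDerivWithinAt_uncurry (hmapsΦ hq)).comp q hΦd hmapsΦ)
        (fun z hz => hL z.1 hz.1 z.2) (hL _ hq.1 _)
    rw [(hOu q hq).eq e1 e2, comp_apply, hΦe]
  have hmom : ∀ q ∈ O ×ˢ ({0}ᶜ : Set E), momentum L₁ q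
      = (momentum L₂ (Φ q)).comp (fderivWithin ℝ φ R q.1) := by
    intro q hq
    ext u
    rw [h₁.momentum_eq (hsub hq), h₂.momentum_eq (hmapsΦ hq)]
    simp [hDL q hq]
  have hq : (y, w) ∈ O ×ˢ ({0}ᶜ : Set E) := ⟨hy, hw⟩
  obtain ⟨Φ', hΦd, hΦe⟩ := hΦ' _ hq
  have d2 : HasFDerivWithinAt (fderivWithin ℝ φ R)
      (fderivWithin ℝ (fderivWithin ℝ φ R) R y) O y :=
    ((hφ' _ hy).differentiableWithinAt (by simp)).hasFDerivWithinAt.mono hOR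
  have e1 := (h₁.hasFDerivWithinAt_momentum (hsub hq)).mono hsub
  have e2 : HasFDerivWithinAt (fun q => (momentum L₂ (Φ q)).comp (fderivWithin ℝ φ R q.1))
      _ (O ×ˢ {0}ᶜ) (y, w) :=
    ((h₂.hasFDerivWithinAt_momentum (hmapsΦ hq)).comp _ hΦd hmapsΦ).clm_comp
      (d2.comp (y, w) hasFDerivWithinAt_fst (fun _ hz => hz.1))
  rw [(hOu _ hq).eq e1 (HasFDerivWithinAt.congr e2 hmom (hmom _ hq))]
  ext u
  -- The derivative of the momentum produces D²φ(w, u) and the derivative of the Lagrangian D²φ(u,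
  -- w); the equation is invariant because they agree. At boundary points of `R` the symmetry comes
  -- from `hRi`.
  have hsymm : IsSymmSndFDerivWithinAt ℝ φ R y :=
    (hφR y hy).isSymmSndFDerivWithinAt (by simpa using ENat.LEInfty.out) hR (hRi (hOR hy)) (hOR hy)
  have hEL' := DFunLike.congr_fun hEL (fderivWithin ℝ φ R y u)
  simp only [comp_apply, inl_apply] at hEL'
  simp only [add_apply, comp_apply, hΦe, compL_apply, flip_apply, coe_fst', inl_apply,
    hDL _ hq, map_zero, add_zero, Function.comp_apply]
  have hsplit : ∀ b c : E, ((b, c) : E × E) = (b, 0) + (0, c) := by simp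
  rw [hsplit (fderivWithin ℝ φ R y u), map_add, ← hEL', hsymm u w]
  rw [h₂.momentum_eq (hmapsΦ hq)]
  simp [hΦ, add_comm]

end CoordCalculus

/-! ### Homogeneity, and the Euler-Lagrange equation solved for the acceleration. -/

section SprayCalculus

open ContinuousLinearMap

variable {E : Type*} [NormedAddCommGroup E] [NormedSpace ℝ E]
  {X : Type*} [NormedAddCommGroup X] [NormedSpace ℝ X]

theorem fderiv_fun_const_smul_field (c : ℝ) (f : E → X) (x : E) :
    fderiv ℝ (fun y => c • f y) x = c • fderiv ℝ f x :=
  congrFun (fderiv_const_smul_field (f := f) c) x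

theorem fderivWithin_fun_const_smul_field (c : ℝ) {s : Set E} {x : E}
    (hs : UniqueDiffWithinAt ℝ s x) (f : E → X) :
    fderivWithin ℝ (fun y => c • f y) s x = c • fderivWithin ℝ f s x :=
  fderivWithin_const_smul_field (f := f) c hs

/-- A coordinate energy whose vertical Hessian is positive definite. -/
structure IsCoordFinsler (R D : Set E) (L : E → E → ℝ) : Prop extends IsCoordEnergy R D L where
  posDef : ∀ y ∈ D, ∀ w u : E, w ≠ 0 → u ≠ 0 →
    0 < fderiv ℝ (fun w' => fderiv ℝ (fun w'' => L y w'') w' u) w u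

/-- The vertical Hessian of a Lagrangian over `D`. -/
def verticalHessian (D : Set E) (L : E → E → ℝ) (q : E × E) : E →L[ℝ] E →L[ℝ] ℝ :=
  (fderivWithin ℝ (momentum L) (D ×ˢ {0}ᶜ) q).comp (inr ℝ E E)

/-- The acceleration prescribed by the Euler-Lagrange equation. -/
def spray (D : Set E) (L : E → E → ℝ) (q : E × E) : E :=
  (verticalHessian D L q).inverse
    ((fderivWithin ℝ (Function.uncurry L) (D ×ˢ {0}ᶜ) q).comp (inl ℝ E E)
      - fderivWithin ℝ (momentum L) (D ×ˢ {0}ᶜ) q (q.2, 0))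

namespace IsCoordEnergy

variable {R D : Set E} {L : E → E → ℝ} (h : IsCoordEnergy R D L)
include h

theorem hasFDerivAt_momentum_right {q : E × E} (hq : q ∈ D ×ˢ ({0}ᶜ : Set E)) :
    HasFDerivAt (fun w => momentum L (q.1, w)) (verticalHessian D L q) q.2 :=
  hasFDerivAt_right (h.hasFDerivWithinAt_momentum hq) hq

theorem contDiffOn_verticalHessian : ContDiffOn ℝ ∞ (verticalHessian D L) (D ×ˢ {0}ᶜ) :=
  (h.contDiffOn_momentum.fderivWithin h.uniqueDiffOn_prod (by simp)).clm_comp contDiffOn_const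

theorem verticalHessian_apply {y w : E} (hy : y ∈ D) (hw : w ≠ 0) (a u : E) :
    verticalHessian D L (y, w) a u
      = fderiv ℝ (fun w' => fderiv ℝ (fun w'' => L y w'') w' u) w a := by
  have h1 := h.hasFDerivAt_momentum_right (q := (y, w)) ⟨hy, hw⟩
  have h2 := (h1.clm_apply (hasFDerivAt_const u w)).fderiv
  simp only [momentum] at h2
  rw [h2]
  simp

theorem momentum_smul {y : E} (hy : y ∈ D) {c : ℝ} (hc : 0 < c) (w : E) :
    momentum L (y, c • w) = c • momentum L (y, w) := by
  have h1 : (fun w => L y (c • w)) = fun w => c ^ 2 • L y w := by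
    ext w
    exact h.homogeneous y hy c w hc
  have h2 := fderiv_comp_smul (f := L y) (x := w) c
  rw [h1, fderiv_fun_const_smul_field] at h2
  have h3 : c • (c • fderiv ℝ (L y) w) = c • fderiv ℝ (L y) (c • w) := by
    rw [← h2, smul_smul, pow_two]
  exact (smul_right_injective _ hc.ne' h3).symm

theorem energy_zero {y : E} (hy : y ∈ D) : L y 0 = 0 := by
  have := h.homogeneous y hy 2 0 (by norm_num)
  rw [smul_zero] at this
  linarith

/-- Euler's identity for a two-homogeneous function, by differentiating along c ↦ cw at c = 1. -/
theorem momentum_apply_self {y w : E} (hy : y ∈ D) (hw : w ≠ 0) :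
    momentum L (y, w) w = 2 * L y w := by
  have h1 : HasDerivAt (fun c : ℝ => c • w) w 1 := by
    simpa using (hasDerivAt_id (1 : ℝ)).smul_const w
  have h2 : HasFDerivAt (L y) (momentum L (y, w)) ((1 : ℝ) • w) := by
    simpa using h.hasFDerivAt_momentum (q := (y, w)) ⟨hy, hw⟩
  have h3 := h2.comp_hasDerivAt (1 : ℝ) h1
  have h4 : HasDerivAt (fun c : ℝ => c ^ 2 * L y w) (2 * L y w) 1 := by
    simpa using (hasDerivAt_pow 2 (1 : ℝ)).mul_const (L y w)
  refine h3.unique (h4.congr_of_eventuallyEq ?_)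
  filter_upwards [lt_mem_nhds (zero_lt_one : (0 : ℝ) < 1)] with c hc
  exact h.homogeneous y hy c w hc

theorem verticalHessian_smul {y w : E} (hy : y ∈ D) (hw : w ≠ 0) {c : ℝ} (hc : 0 < c) :
    verticalHessian D L (y, c • w) = verticalHessian D L (y, w) := by
  have h1 := h.hasFDerivAt_momentum_right (q := (y, w)) ⟨hy, hw⟩
  have h2 := h.hasFDerivAt_momentum_right (q := (y, c • w)) ⟨hy, smul_ne_zero hc.ne' hw⟩
  have h3 := fderiv_comp_smul (f := fun w => momentum L (y, w)) (x := w) c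
  simp_rw [h.momentum_smul hy hc] at h3
  have h4 := smul_right_injective _ hc.ne'
    ((fderiv_fun_const_smul_field c (fun w => momentum L (y, w)) w).symm.trans h3)
  rw [h1.fderiv, h2.fderiv] at h4
  exact h4.symm

/-- Euler's identity again, now for the one-homogeneous momentum. -/
theorem verticalHessian_self {y w : E} (hy : y ∈ D) (hw : w ≠ 0) :
    verticalHessian D L (y, w) w w = 2 * L y w := by
  rw [← h.momentum_apply_self hy hw]
  have h1 : HasDerivAt (fun c : ℝ => c • w) w 1 := by
    simpa using (hasDerivAt_id (1 : ℝ)).smul_const w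
  have h2 : HasFDerivAt (fun w => momentum L (y, w)) (verticalHessian D L (y, w))
      ((1 : ℝ) • w) := by
    simpa using h.hasFDerivAt_momentum_right (q := (y, w)) ⟨hy, hw⟩
  have h3 := h2.comp_hasDerivAt (1 : ℝ) h1
  have h4 : HasDerivAt (fun c : ℝ => c • momentum L (y, w)) (momentum L (y, w)) 1 := by
    simpa using (hasDerivAt_id (1 : ℝ)).smul_const (momentum L (y, w))
  have h5 := h3.unique (h4.congr_of_eventuallyEq ?_)
  · rw [h5]
  filter_upwards [lt_mem_nhds (zero_lt_one : (0 : ℝ) < 1)] with c hc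
  exact h.momentum_smul hy hc w

/-- Each of the three terms of the equation scales by c². This makes it possible to study geodesics
of unit initial coordinate speed only. -/
theorem eulerLagrange_smul {y w a : E} (hy : y ∈ D) {c : ℝ} (hc : 0 < c)
    (hEL : EulerLagrange R L y w a) : EulerLagrange R L y (c • w) (c ^ 2 • a) := by
  intro u
  have hR := h.uniqueDiffOn y (h.subset hy)
  have hm : ∀ y ∈ D, ∀ w, fderiv ℝ (fun w'' => L y w'') (c • w) u
      = c * fderiv ℝ (fun w'' => L y w'') w u := fun y hy w => by
    simpa [momentum] using DFunLike.congr_fun (h.momentum_smul hy hc w) u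
  have e1 : fderiv ℝ (fun w' => fderiv ℝ (fun w'' => L y w'') w' u) (c • w)
      = fderiv ℝ (fun w' => fderiv ℝ (fun w'' => L y w'') w' u) w := by
    have h3 := fderiv_comp_smul (f := fun w' => fderiv ℝ (fun w'' => L y w'') w' u) (x := w) c
    simp_rw [hm y hy, ← smul_eq_mul] at h3
    rw [fderiv_fun_const_smul_field] at h3
    exact (smul_right_injective _ hc.ne' h3).symm
  have e2 : fderivWithin ℝ (fun y' => fderiv ℝ (fun w' => L y' w') (c • w) u) R y
      = c • fderivWithin ℝ (fun y' => fderiv ℝ (fun w' => L y' w') w u) R y := by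
    rw [← fderivWithin_fun_const_smul_field _ hR]
    refine Filter.EventuallyEq.fderivWithin_eq ?_ (hm y hy w)
    filter_upwards [h.mem_nhdsWithin y hy] with z hz using hm z hz w
  have e3 : fderivWithin ℝ (fun y' => L y' (c • w)) R y
      = c ^ 2 • fderivWithin ℝ (fun y' => L y' w) R y := by
    rw [← fderivWithin_fun_const_smul_field _ hR]
    refine Filter.EventuallyEq.fderivWithin_eq ?_ (h.homogeneous y hy c w hc)
    filter_upwards [h.mem_nhdsWithin y hy] with z hz using h.homogeneous z hz c w hc
  rw [e1, e2, e3]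
  have := hEL u
  simp only [map_smul, smul_apply, smul_eq_mul] at *
  linear_combination c ^ 2 * this

/-- Infinitesimal conservation of energy. Differentiate p(w) = 2L along (w, a): the left side gives
ṗ(w) + p(a) = ∂L/∂y(w) + ∂L/∂w(a) = dL(w, a), the right side 2 dL(w, a). -/
theorem fderivWithin_eq_zero_of_eulerLagrange {y w a : E} (hy : y ∈ D) (hw : w ≠ 0)
    (hEL : EulerLagrange R L y w a) :
    fderivWithin ℝ (Function.uncurry L) (D ×ˢ {0}ᶜ) (y, w) (w, a) = 0 := by
  have hq : (y, w) ∈ D ×ˢ ({0}ᶜ : Set E) := ⟨hy, hw⟩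
  rw [h.eulerLagrange_iff hy hw] at hEL
  have e1 := (h.hasFDerivWithinAt_momentum hq).clm_apply
    (hasFDerivWithinAt_snd (E := E) (s := D ×ˢ {0}ᶜ) (p := (y, w)))
  have e2 := (h.hasFDerivWithinAt_uncurry hq).const_smul (2 : ℝ)
  have e3 := (h.uniqueDiffOn_prod _ hq).eq (HasFDerivWithinAt.congr e2
    (fun q hq => h.momentum_apply_self hq.1 hq.2) (h.momentum_apply_self hy hw)) e1
  have e4 := DFunLike.congr_fun e3 (w, a)
  have e5 := DFunLike.congr_fun hEL w
  have e6 := DFunLike.congr_fun (h.momentum_eq hq) a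
  simp only [add_apply, comp_apply, flip_apply, coe_snd', smul_apply, smul_eq_mul,
    inl_apply, inr_apply] at e4 e5 e6
  have e7 : fderivWithin ℝ (Function.uncurry L) (D ×ˢ {0}ᶜ) (y, w) (0, a)
    + fderivWithin ℝ (Function.uncurry L) (D ×ˢ {0}ᶜ) (y, w) (w, 0)
    = fderivWithin ℝ (Function.uncurry L) (D ×ˢ {0}ᶜ) (y, w) (w, a) := by
    rw [← map_add]; simp
  simp only [e5, e6] at e4
  linarith

end IsCoordEnergy

namespace IsCoordFinsler

variable {R D : Set E} {L : E → E → ℝ} (h : IsCoordFinsler R D L)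
include h

theorem verticalHessian_pos {q : E × E} (hq : q ∈ D ×ˢ ({0}ᶜ : Set E)) {u : E} (hu : u ≠ 0) :
    0 < verticalHessian D L q u u := by
  obtain ⟨y, w⟩ := q
  rw [h.verticalHessian_apply hq.1 hq.2]
  exact h.posDef y hq.1 w u hq.2 hu

/-- A positive definite form has trivial kernel, and `E` and its dual have the same dimension. -/
theorem isInvertible_verticalHessian [FiniteDimensional ℝ E] {q : E × E}
    (hq : q ∈ D ×ˢ ({0}ᶜ : Set E)) : (verticalHessian D L q).IsInvertible := by
  set A := verticalHessian D L q with hA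
  have hinj : Function.Injective (A : E →ₗ[ℝ] E →L[ℝ] ℝ) := by
    rw [← LinearMap.ker_eq_bot, LinearMap.ker_eq_bot']
    intro u hu
    by_contra hne
    have h1 := h.verticalHessian_pos hq hne
    have h2 : A u = 0 := hu
    rw [← hA, h2] at h1
    simp at h1
  have hdim : Module.finrank ℝ E = Module.finrank ℝ (E →L[ℝ] ℝ) := by
    rw [← (LinearMap.toContinuousLinearMap (𝕜 := ℝ) (E := E) (F' := ℝ)).finrank_eq]
    exact (Subspace.dual_finrank_eq (K := ℝ) (V := E)).symm
  let e := (LinearMap.linearEquivOfInjective (A : E →ₗ[ℝ] E →L[ℝ] ℝ) hinj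
    hdim).toContinuousLinearEquiv
  exact ⟨e, by ext u; rfl⟩

variable [FiniteDimensional ℝ E]

theorem eulerLagrange_iff_eq_spray {y w a : E} (hy : y ∈ D) (hw : w ≠ 0) :
    EulerLagrange R L y w a ↔ a = spray D L (y, w) := by
  have hq : (y, w) ∈ D ×ˢ ({0}ᶜ : Set E) := ⟨hy, hw⟩
  obtain ⟨e, he⟩ := h.isInvertible_verticalHessian hq
  rw [h.eulerLagrange_iff hy hw, spray, ← he, inverse_equiv]
  have h1 : fderivWithin ℝ (momentum L) (D ×ˢ {0}ᶜ) (y, w) (w, a)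
      = fderivWithin ℝ (momentum L) (D ×ˢ {0}ᶜ) (y, w) (w, 0) + e a := by
    have h2 : (e : E →L[ℝ] E →L[ℝ] ℝ) a
      = fderivWithin ℝ (momentum L) (D ×ˢ {0}ᶜ) (y, w) (0, a) := by rw [he]; rfl
    have h3 : e a = (e : E →L[ℝ] E →L[ℝ] ℝ) a := rfl
    rw [h3, h2, ← map_add]
    simp
  rw [h1, ← eq_sub_iff_add_eq']
  exact (ContinuousLinearEquiv.eq_symm_apply e).symm

theorem eulerLagrange_spray {y w : E} (hy : y ∈ D) (hw : w ≠ 0) :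
    EulerLagrange R L y w (spray D L (y, w)) :=
  (h.eulerLagrange_iff_eq_spray hy hw).2 rfl

theorem spray_smul {y w : E} (hy : y ∈ D) (hw : w ≠ 0) {c : ℝ} (hc : 0 < c) :
    spray D L (y, c • w) = c ^ 2 • spray D L (y, w) :=
  ((h.eulerLagrange_iff_eq_spray hy (smul_ne_zero hc.ne' hw)).1
    (h.eulerLagrange_smul hy hc (h.eulerLagrange_spray hy hw))).symm

theorem contDiffOn_spray : ContDiffOn ℝ ∞ (spray D L) (D ×ˢ {0}ᶜ) := by
  have h1 : ContDiffOn ℝ ∞ (fun q => (verticalHessian D L q).inverse) (D ×ˢ {0}ᶜ) := by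
    intro q hq
    obtain ⟨e, he⟩ := h.isInvertible_verticalHessian hq
    have h2 : ContDiffAt ℝ ∞ ContinuousLinearMap.inverse (verticalHessian D L q) := by
      rw [← he]; exact contDiffAt_map_inverse e
    exact h2.comp_contDiffWithinAt q (h.contDiffOn_verticalHessian q hq)
  refine h1.clm_apply (ContDiffOn.sub ?_ ?_)
  · exact h.contDiffOn_fderivWithin.clm_comp contDiffOn_const
  · exact (h.contDiffOn_momentum.fderivWithin h.uniqueDiffOn_prod (by simp)).clm_apply
      (contDiffOn_snd.prodMk contDiffOn_const)

end IsCoordFinsler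

end SprayCalculus

/-! ### A second-order lower bound for the energy. -/

section Weierstrass

open ContinuousLinearMap

variable {E : Type*} [NormedAddCommGroup E] [NormedSpace ℝ E]
  {X : Type*} [NormedAddCommGroup X] [NormedSpace ℝ X]

theorem add_deriv_add_half_le {g g' g'' : ℝ → ℝ} {m : ℝ}
    (hg : ∀ s ∈ Icc (0 : ℝ) 1, HasDerivAt g (g' s) s)
    (hg' : ∀ s ∈ Icc (0 : ℝ) 1, HasDerivAt g' (g'' s) s)
    (hm : ∀ s ∈ Icc (0 : ℝ) 1, m ≤ g'' s) : g 0 + g' 0 + m / 2 ≤ g 1 := by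
  have key : ∀ {f f' : ℝ → ℝ}, (∀ s ∈ Icc (0 : ℝ) 1, HasDerivAt f (f' s) s) →
      (∀ s ∈ Icc (0 : ℝ) 1, 0 ≤ f' s) → ∀ s ∈ Icc (0 : ℝ) 1, f 0 ≤ f s := by
    intro f f' hf hf' s hs
    refine monotoneOn_of_deriv_nonneg (convex_Icc 0 1)
      (fun t ht => (hf t ht).continuousAt.continuousWithinAt)
      (fun t ht => (hf t (interior_subset ht)).differentiableAt.differentiableWithinAt)
      (fun t ht => ?_) (left_mem_Icc.2 zero_le_one) hs hs.1
    rw [(hf t (interior_subset ht)).deriv]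
    exact hf' t (interior_subset ht)
  have h1 : ∀ s ∈ Icc (0 : ℝ) 1, g' 0 + m * s ≤ g' s := by
    intro s hs
    have := key (f := fun s => g' s - m * s) (f' := fun s => g'' s - m * 1)
      (fun s hs => (hg' s hs).sub ((hasDerivAt_id s).const_mul m))
      (fun s hs => by linarith [hm s hs]) s hs
    linarith
  have h2 := key (f := fun s => g s - (g' 0 * s + m / 2 * s ^ 2))
      (f' := fun s => g' s - (g' 0 * 1 + m / 2 * (((2 : ℕ) : ℝ) * s ^ (2 - 1) * 1)))
      (fun s hs => (hg s hs).sub (((hasDerivAt_id s).const_mul _).add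
        (((hasDerivAt_id s).pow 2).const_mul _)))
      (fun s hs => by have := h1 s hs; simp; linarith) 1 (by simp)
  linarith

/-- A `C¹` map is Lipschitz, with a uniform constant, on the convex subsets of a compact set. -/
theorem exists_bound_of_isCompact {S T : Set X} {Y : Type*} [NormedAddCommGroup Y]
    [NormedSpace ℝ Y] {G : X → Y} (hG : ContDiffOn ℝ ∞ G S) (hS : UniqueDiffOn ℝ S)
    (hT : IsCompact T) (hTS : T ⊆ S) :
    ∃ C : ℝ, 0 ≤ C ∧ ∀ Q ⊆ T, Convex ℝ Q → ∀ p ∈ Q, ∀ q ∈ Q, ‖G q - G p‖ ≤ C * ‖q - p‖ := by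
  have hc : ContinuousOn (fderivWithin ℝ G S) T :=
    (hG.continuousOn_fderivWithin hS (by simp)).mono hTS
  obtain ⟨C, hC⟩ := hT.exists_bound_of_continuousOn hc
  refine ⟨max C 0, le_max_right _ _, fun Q hQ hconv p hp q hq => ?_⟩
  refine hconv.norm_image_sub_le_of_norm_hasFDerivWithin_le (f' := fderivWithin ℝ G S)
    (fun z hz => ?_) (fun z hz => (hC z (hQ hz)).trans (le_max_left _ _)) hp hq
  exact ((hG z (hTS (hQ hz))).differentiableWithinAt (by simp)).hasFDerivWithinAt.mono
    (hQ.trans hTS)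

namespace IsCoordFinsler

variable {R D : Set E} {L : E → E → ℝ} (h : IsCoordFinsler R D L) [FiniteDimensional ℝ E]
include h

/-- The minimum is taken over unit `w` and unit `u`, a compact set; the Hessian is homogeneous of
degree zero in `w` and quadratic in `u`, which gives one constant for all nonzero `w`. -/
theorem exists_verticalHessian_ge {K : Set E} (hK : IsCompact K) (hKD : K ⊆ D) :
    ∃ m : ℝ, 0 < m ∧ ∀ y ∈ K, ∀ w, w ≠ 0 → ∀ u, m * ‖u‖ ^ 2 ≤ verticalHessian D L (y, w) u u := by
  have hcomp : IsCompact ((K ×ˢ Metric.sphere (0 : E) 1) ×ˢ Metric.sphere (0 : E) 1) :=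
    (hK.prod (isCompact_sphere 0 1)).prod (isCompact_sphere 0 1)
  have hsub : K ×ˢ Metric.sphere (0 : E) 1 ⊆ D ×ˢ {0}ᶜ :=
    prod_mono hKD fun w hw h0 => by simp_all
  have hcont : ContinuousOn (fun p : (E × E) × E => verticalHessian D L p.1 p.2 p.2)
      ((K ×ˢ Metric.sphere (0 : E) 1) ×ˢ Metric.sphere (0 : E) 1) := by
    have h1 : ContinuousOn (fun p : (E × E) × E => verticalHessian D L p.1)
        ((K ×ˢ Metric.sphere (0 : E) 1) ×ˢ Metric.sphere (0 : E) 1) :=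
      h.contDiffOn_verticalHessian.continuousOn.comp continuousOn_fst (fun p hp => hsub hp.1)
    exact (h1.clm_apply continuousOn_snd).clm_apply continuousOn_snd
  obtain ⟨m, hm, hmle⟩ : ∃ m : ℝ, 0 < m ∧ ∀ p ∈ (K ×ˢ Metric.sphere (0 : E) 1) ×ˢ
      Metric.sphere (0 : E) 1, m ≤ verticalHessian D L p.1 p.2 p.2 := by
    rcases eq_empty_or_nonempty ((K ×ˢ Metric.sphere (0 : E) 1) ×ˢ Metric.sphere (0 : E) 1)
      with he | hne
    · exact ⟨1, one_pos, by simp [he]⟩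
    · obtain ⟨p, hp, hpm⟩ := hcomp.exists_isMinOn hne hcont
      refine ⟨_, h.verticalHessian_pos (hsub hp.1) (u := p.2) ?_, fun q hq => hpm hq⟩
      intro h0
      have := hp.2
      simp [h0] at this
  refine ⟨m, hm, fun y hy w hw u => ?_⟩
  rcases eq_or_ne u 0 with rfl | hu
  · simp
  have hw' : 0 < ‖w‖ := norm_pos_iff.2 hw
  have hu' : 0 < ‖u‖ := norm_pos_iff.2 hu
  have h1 := hmle ((y, ‖w‖⁻¹ • w), ‖u‖⁻¹ • u) ⟨⟨hy, by simp [norm_smul, hw'.ne']⟩,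
    by simp [norm_smul, hu'.ne']⟩
  simp only [h.verticalHessian_smul (hKD hy) hw (inv_pos.2 hw'), map_smul, smul_apply,
    smul_eq_mul] at h1
  calc m * ‖u‖ ^ 2 ≤ (‖u‖⁻¹ * (‖u‖⁻¹ * verticalHessian D L (y, w) u u)) * ‖u‖ ^ 2 := by gcongr
    _ = _ := by field_simp

omit [FiniteDimensional ℝ E] in
/-- Strong convexity of the energy along the fibres. -/
theorem energy_ge_tangent {y : E} (hy : y ∈ D) {m : ℝ}
    (hm : ∀ w, w ≠ 0 → ∀ u, m * ‖u‖ ^ 2 ≤ verticalHessian D L (y, w) u u)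
    {v : E} (hv : v ≠ 0) (w : E) :
    L y v + momentum L (y, v) (w - v) + m / 2 * ‖w - v‖ ^ 2 ≤ L y w := by
  by_cases hs : ∀ s ∈ Icc (0 : ℝ) 1, v + s • (w - v) ≠ 0
  · have hline : ∀ s : ℝ, HasDerivAt (fun s : ℝ => v + s • (w - v)) (w - v) s := fun s => by
      simpa using ((hasDerivAt_id s).smul_const (w - v)).const_add v
    have hg : ∀ s ∈ Icc (0 : ℝ) 1, HasDerivAt (fun s : ℝ => L y (v + s • (w - v)))
        (momentum L (y, v + s • (w - v)) (w - v)) s := fun s hs' =>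
      HasFDerivAt.comp_hasDerivAt (l := L y) (f := fun s : ℝ => v + s • (w - v)) s
        (h.hasFDerivAt_momentum (q := (y, v + s • (w - v))) ⟨hy, hs s hs'⟩) (hline s)
    have hg' : ∀ s ∈ Icc (0 : ℝ) 1,
        HasDerivAt (fun s : ℝ => momentum L (y, v + s • (w - v)) (w - v))
          (verticalHessian D L (y, v + s • (w - v)) (w - v) (w - v)) s := fun s hs' => by
      have h1 : HasDerivAt (fun s : ℝ => momentum L (y, v + s • (w - v)))
          (verticalHessian D L (y, v + s • (w - v)) (w - v)) s :=
        HasFDerivAt.comp_hasDerivAt (l := fun w => momentum L (y, w))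
          (f := fun s : ℝ => v + s • (w - v)) s
          (h.hasFDerivAt_momentum_right (q := (y, v + s • (w - v))) ⟨hy, hs s hs'⟩) (hline s)
      simpa using h1.clm_apply (hasDerivAt_const s (w - v))
    have key := add_deriv_add_half_le (m := m * ‖w - v‖ ^ 2) hg hg'
      (fun s hs' => hm _ (hs s hs') _)
    simp only [zero_smul, add_zero, one_smul, add_sub_cancel] at key
    linarith
  -- The segment from v to w meets 0, where L need not be twice differentiable. Then w = -l v with l
  -- ≥ 0, and the claim follows from Euler's identity and L ≥ (m/2)‖·‖².
  · push Not at hs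
    obtain ⟨s, ⟨hs0, hs1⟩, hs⟩ := hs
    have hs0' : 0 < s := by
      refine lt_of_le_of_ne hs0 fun h0 => hv ?_
      simpa [← h0] using hs
    have hLge : ∀ w : E, m / 2 * ‖w‖ ^ 2 ≤ L y w := by
      intro w
      rcases eq_or_ne w 0 with rfl | hw
      · simpa using h.nonneg y hy 0
      · have := hm w hw w
        rw [h.verticalHessian_self hy hw] at this
        linarith
    set l : ℝ := (1 - s) / s with hl
    have hl0 : 0 ≤ l := div_nonneg (by linarith) hs0'.le
    have hw : w = -(l • v) := by
      have h1 : s • w = -((1 - s) • v) := by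
        rw [eq_neg_iff_add_eq_zero, ← hs]
        module
      have h2 : w = s⁻¹ • (s • w) := by rw [smul_smul, inv_mul_cancel₀ hs0'.ne', one_smul]
      rw [h2, h1, smul_neg, smul_smul, hl]
      congr 2
      field_simp
    have hwv : w - v = -((1 + l) • v) := by rw [hw]; module
    have e1 : ‖w‖ = l * ‖v‖ := by rw [hw, norm_neg, norm_smul, Real.norm_of_nonneg hl0]
    have e2 : ‖w - v‖ = (1 + l) * ‖v‖ := by
      rw [hwv, norm_neg, norm_smul, Real.norm_of_nonneg (by linarith)]
    have e3 := hLge w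
    have e4 := hLge v
    rw [e1] at e3
    rw [e2, hwv, map_neg, map_smul, smul_eq_mul, h.momentum_apply_self hy hv]
    nlinarith [mul_le_mul_of_nonneg_left e4 hl0]

/-- The second-order lower bound of Weierstrass type for the energy. -/
theorem exists_energy_ge {K : Set E} (hK : IsCompact K) (hKc : Convex ℝ K) (hKD : K ⊆ D) :
    ∃ κ C : ℝ, 0 < κ ∧ 0 ≤ C ∧ ∀ x ∈ K, ∀ y ∈ K, ∀ v, 1 / 2 ≤ ‖v‖ → ‖v‖ ≤ 2 → ∀ w,
      L x v + fderivWithin ℝ (Function.uncurry L) (D ×ˢ {0}ᶜ) (x, v) (y - x, 0)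
        + momentum L (x, v) (w - v) + κ * ‖w - v‖ ^ 2 - C * ‖y - x‖ ^ 2 ≤ L y w := by
  obtain ⟨m, hm, hmH⟩ := h.exists_verticalHessian_ge hK hKD
  set A : Set E := {v | 1 / 2 ≤ ‖v‖ ∧ ‖v‖ ≤ 2} with hA
  have hAc : IsCompact A := by
    refine (isCompact_closedBall (0 : E) 2).of_isClosed_subset ?_ fun v hv => by simpa using hv.2
    exact (isClosed_le continuous_const continuous_norm).inter
      (isClosed_le continuous_norm continuous_const)
  have hsub : K ×ˢ A ⊆ D ×ˢ {0}ᶜ := prod_mono hKD fun v hv h0 => by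
    have := hv.1
    rw [h0, norm_zero] at this
    norm_num at this
  obtain ⟨C₁, hC₁, hL₁⟩ := exists_bound_of_isCompact h.contDiffOn_fderivWithin
    h.uniqueDiffOn_prod (hK.prod hAc) hsub
  obtain ⟨C₂, hC₂, hL₂⟩ := exists_bound_of_isCompact h.contDiffOn_momentum
    h.uniqueDiffOn_prod (hK.prod hAc) hsub
  -- Convexity yields m/2. Half of it absorbs, by Young's inequality (`i5`), the change of the
  -- momentum from x to y, at the price C₂²/m; C₁ is the error of linearizing in the position.
  refine ⟨m / 4, C₁ + C₂ ^ 2 / m, by positivity, by positivity, fun x hx y hy v hv1 hv2 w => ?_⟩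
  have hvA : v ∈ A := ⟨hv1, hv2⟩
  -- The Lipschitz bounds need convex sets. The annulus `A` need not be convex, but only the
  -- position varies, so the slice over the fixed v is enough.
  have hQ : K ×ˢ {v} ⊆ K ×ˢ A := prod_mono le_rfl (by simpa using hvA)
  have hQc : Convex ℝ (K ×ˢ {v}) := hKc.prod (convex_singleton v)
  have hv0 : v ≠ 0 := (hsub (show (x, v) ∈ K ×ˢ A from ⟨hx, hvA⟩)).2
  have i1 := h.energy_ge_tangent (hKD hy) (hmH y hy) hv0 w
  have i2 : ‖momentum L (y, v) - momentum L (x, v)‖ ≤ C₂ * ‖y - x‖ := by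
    have := hL₂ _ hQ hQc (x, v) ⟨hx, rfl⟩ (y, v) ⟨hy, rfl⟩
    simpa [Prod.norm_def] using this
  have i3 : momentum L (x, v) (w - v) - C₂ * ‖y - x‖ * ‖w - v‖ ≤ momentum L (y, v) (w - v) := by
    have h1 := (momentum L (y, v) - momentum L (x, v)).le_of_opNorm_le i2 (w - v)
    rw [Real.norm_eq_abs, abs_le, sub_apply] at h1
    linarith [h1.1]
  have i4 : L x v + fderivWithin ℝ (Function.uncurry L) (D ×ˢ {0}ᶜ) (x, v) (y - x, 0)
      - C₁ * ‖y - x‖ ^ 2 ≤ L y v := by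
    have hseg : segment ℝ x y ⊆ K := hKc.segment_subset hx hy
    have hder : ∀ z ∈ segment ℝ x y, HasFDerivWithinAt (fun z => L z v)
        ((fderivWithin ℝ (Function.uncurry L) (D ×ˢ {0}ᶜ) (z, v)).comp (inl ℝ E E))
        (segment ℝ x y) z := fun z hz =>
      (h.hasFDerivWithinAt_left (h.hasFDerivWithinAt_uncurry (q := (z, v))
        ⟨hKD (hseg hz), hv0⟩) ⟨hKD (hseg hz), hv0⟩).mono (hseg.trans (hKD.trans h.subset))
    have h1 := (convex_segment x y).norm_image_sub_le_of_norm_hasFDerivWithin_le'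
      (φ := (fderivWithin ℝ (Function.uncurry L) (D ×ˢ {0}ᶜ) (x, v)).comp (inl ℝ E E))
      (C := C₁ * ‖y - x‖) hder (fun z hz => ?_) (left_mem_segment ℝ x y)
      (right_mem_segment ℝ x y)
    · rw [Real.norm_eq_abs, abs_le] at h1
      simp only [comp_apply, inl_apply] at h1
      nlinarith [h1.1]
    · rw [← sub_comp]
      have h2 := hL₁ _ hQ hQc (x, v) ⟨hx, rfl⟩ (z, v) ⟨hseg hz, rfl⟩
      have h3 : ‖z - x‖ ≤ ‖y - x‖ := by
        obtain ⟨t, ht, rfl⟩ := (segment_eq_image' ℝ x y ▸ hz :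
          z ∈ (fun t : ℝ => x + t • (y - x)) '' Icc 0 1)
        simp only [add_sub_cancel_left, norm_smul, Real.norm_of_nonneg ht.1]
        exact mul_le_of_le_one_left (norm_nonneg _) ht.2
      refine (opNorm_comp_le _ _).trans ?_
      have h4 : ‖((z, v) : E × E) - (x, v)‖ = ‖z - x‖ := by simp [Prod.norm_def]
      rw [h4] at h2
      calc _ ≤ (C₁ * ‖z - x‖) * 1 := by gcongr; exact norm_inl_le_one ℝ E E
        _ ≤ _ := by rw [mul_one]; gcongr
  have i5 : C₂ * ‖y - x‖ * ‖w - v‖ ≤ C₂ ^ 2 / m * ‖y - x‖ ^ 2 + m / 4 * ‖w - v‖ ^ 2 := by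
    have h1 : C₂ ^ 2 / m * ‖y - x‖ ^ 2 + m / 4 * ‖w - v‖ ^ 2 - C₂ * ‖y - x‖ * ‖w - v‖
        = m * (C₂ * ‖y - x‖ / m - ‖w - v‖ / 2) ^ 2 := by field_simp; ring
    have h2 : 0 ≤ m * (C₂ * ‖y - x‖ / m - ‖w - v‖ / 2) ^ 2 := by positivity
    linarith
  linarith

end IsCoordFinsler

end Weierstrass

/-! ### Short geodesic arcs minimize length. -/

section Minimization

open ContinuousLinearMap MeasureTheory

variable {E : Type*} [NormedAddCommGroup E] [NormedSpace ℝ E]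

theorem norm_sub_le_integral_norm_deriv [CompleteSpace E] {h h' : ℝ → E}
    (hd : ∀ t ∈ Icc (0 : ℝ) 1, HasDerivWithinAt h (h' t) (Icc 0 1) t)
    (hc : ContinuousOn h' (Icc 0 1)) {t : ℝ} (ht : t ∈ Icc (0 : ℝ) 1) :
    ‖h t - h 0‖ ≤ ∫ s in (0 : ℝ)..1, ‖h' s‖ := by
  have hsub : Icc 0 t ⊆ Icc (0 : ℝ) 1 := Icc_subset_Icc_right ht.2
  have hint : IntervalIntegrable h' volume 0 t :=
    (hc.mono hsub).intervalIntegrable_of_Icc ht.1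
  rw [← intervalIntegral.integral_eq_sub_of_hasDerivAt_of_le ht.1
    (fun s hs => (hd s (hsub hs)).continuousWithinAt.mono hsub)
    (fun s hs => (hd s (hsub (Ioo_subset_Icc_self hs))).hasDerivAt
      (Icc_mem_nhds hs.1 (hs.2.trans_le ht.2))) hint]
  refine (intervalIntegral.norm_integral_le_integral_norm ht.1).trans ?_
  exact intervalIntegral.integral_mono_interval le_rfl ht.1 ht.2
    (Filter.Eventually.of_forall fun _ => norm_nonneg _)
    (hc.norm.intervalIntegrable_of_Icc zero_le_one)

/-- A geodesic arc over a short time interval is no longer than any other curve in `K` with the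
same endpoints, as soon as the energy satisfies a Weierstrass-type lower bound over `K`. -/
theorem IsCoordFinsler.mul_sqrt_le_integral [CompleteSpace E] {R D K : Set E} {L : E → E → ℝ}
    (hF : IsCoordFinsler R D L) (hKD : K ⊆ D) {κ C : ℝ} (hκ : 0 < κ)
    (hC : 0 ≤ C)
    (hW : ∀ x ∈ K, ∀ y ∈ K, ∀ v, 1 / 2 ≤ ‖v‖ → ‖v‖ ≤ 2 → ∀ w,
      L x v + fderivWithin ℝ (Function.uncurry L) (D ×ˢ {0}ᶜ) (x, v) (y - x, 0)
        + momentum L (x, v) (w - v) + κ * ‖w - v‖ ^ 2 - C * ‖y - x‖ ^ 2 ≤ L y w)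
    {T : ℝ} (hT : 0 ≤ T) (hCT : C * T ^ 2 ≤ κ) {γ v : ℝ → E} {e : ℝ}
    (hγ : ∀ t ∈ Icc 0 T, HasDerivWithinAt γ (v t) (Icc 0 T) t) (hγK : ∀ t ∈ Icc 0 T, γ t ∈ K)
    (hv : ContinuousOn v (Icc 0 T)) (hv1 : ∀ t ∈ Icc 0 T, 1 / 2 ≤ ‖v t‖)
    (hv2 : ∀ t ∈ Icc 0 T, ‖v t‖ ≤ 2)
    (hp : ∀ t ∈ Icc 0 T, HasDerivWithinAt (fun t => momentum L (γ t, v t))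
      ((fderivWithin ℝ (Function.uncurry L) (D ×ˢ {0}ᶜ) (γ t, v t)).comp (inl ℝ E E))
      (Icc 0 T) t)
    (he : ∀ t ∈ Icc 0 T, L (γ t) (v t) = e)
    {c c' : ℝ → E} {σ : ℝ → ℝ}
    (hc : ∀ t ∈ Icc (0 : ℝ) 1, HasDerivWithinAt c (c' t) (Icc 0 1) t)
    (hc' : ContinuousOn c' (Icc 0 1)) (hcK : ∀ t ∈ Icc (0 : ℝ) 1, c t ∈ K)
    (hc0 : c 0 = γ 0) (hc1 : c 1 = γ T)
    (hσ : ContinuousOn σ (Icc 0 1)) (hσ0 : ∀ t ∈ Icc (0 : ℝ) 1, 0 ≤ σ t)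
    (hσL : ∀ t ∈ Icc (0 : ℝ) 1, σ t ^ 2 = 2 * L (c t) (c' t)) :
    T * √(2 * e) ≤ ∫ t in (0 : ℝ)..1, σ t := by
  set ℓ : ℝ := ∫ t in (0 : ℝ)..1, σ t with hℓ
  have hℓ0 : 0 ≤ ℓ := intervalIntegral.integral_nonneg zero_le_one hσ0
  rcases hT.eq_or_lt with rfl | hTpos
  · simpa using hℓ0
  -- The competitor's velocity may vanish, so it can only be brought to almost constant speed; ε is
  -- the amount added to its speed.
  suffices key : ∀ ε > 0, 2 * T ^ 2 * e ≤ ℓ * (ℓ + ε) by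
    have he0 : 0 ≤ e := by
      rw [← he 0 ⟨le_rfl, hT⟩]
      exact hF.nonneg _ (hKD (hγK 0 ⟨le_rfl, hT⟩)) _
    have h1 : 2 * T ^ 2 * e ≤ ℓ ^ 2 := by
      by_contra hlt
      push Not at hlt
      have hε : 0 < (2 * T ^ 2 * e - ℓ ^ 2) / (2 * (ℓ + 1)) :=
        div_pos (by linarith) (by linarith)
      have h2 := key _ hε
      have h3 : ℓ * ((2 * T ^ 2 * e - ℓ ^ 2) / (2 * (ℓ + 1)))
          ≤ (2 * T ^ 2 * e - ℓ ^ 2) / 2 := by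
        rw [mul_div_assoc', div_le_div_iff₀ (by linarith) two_pos]
        nlinarith
      nlinarith
    refine abs_le_of_sq_le_sq' ?_ hℓ0 |>.2
    rw [mul_pow, Real.sq_sqrt (by linarith)]
    linarith
  intro ε hε
  -- Normalizes the new time `τ`, whose density is β(σ + ε), so that it runs from 0 to T.
  set β : ℝ := T / (ℓ + ε) with hβ
  have hβ0 : 0 < β := div_pos hTpos (by linarith)
  -- The speed is continued by constants beyond [0, 1], so that `τ` is differentiable on all of ℝ.
  set σ' : ℝ → ℝ := IccExtend (zero_le_one' ℝ) ((Icc 0 1).domRestrict σ) with hσ'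
  have hσ'c : Continuous σ' := (continuousOn_iff_continuous_domRestrict.1 hσ).Icc_extend'
  have hσ'e : ∀ t ∈ Icc (0 : ℝ) 1, σ' t = σ t := fun t ht => by
    rw [hσ', IccExtend_of_mem _ _ ht]; rfl
  have hσ'0 : ∀ t, 0 ≤ σ' t := fun t => hσ0 _ (projIcc 0 1 _ t).2
  set θ : ℝ → ℝ := fun t => β * (σ' t + ε) with hθ
  have hθc : Continuous θ := by fun_prop
  have hθ0 : ∀ t, 0 < θ t := fun t => mul_pos hβ0 (by linarith [hσ'0 t])
  set τ : ℝ → ℝ := fun t => ∫ s in (0 : ℝ)..t, θ s with hτ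
  have hτd : ∀ t, HasDerivAt τ (θ t) t := fun t => (hθc.integral_hasStrictDerivAt 0 t).hasDerivAt
  have hτ0 : τ 0 = 0 := by simp [hτ]
  have hℓ' : ∫ t in (0 : ℝ)..1, σ' t = ℓ := by
    rw [hℓ]
    refine intervalIntegral.integral_congr fun t ht => hσ'e t ?_
    rwa [uIcc_of_le zero_le_one] at ht
  have hτ1 : τ 1 = T := by
    simp only [hτ, hθ]
    rw [intervalIntegral.integral_const_mul, intervalIntegral.integral_add
      (hσ'c.intervalIntegrable _ _) (continuous_const.intervalIntegrable _ _), hℓ']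
    simp only [intervalIntegral.integral_const, sub_zero, one_smul, hβ]
    field_simp
  have hτmono : Monotone τ := monotone_of_deriv_nonneg (fun t => (hτd t).differentiableAt)
    fun t => by rw [(hτd t).deriv]; exact (hθ0 t).le
  have hτmaps : MapsTo τ (Icc 0 1) (Icc 0 T) := fun t ht =>
    ⟨hτ0 ▸ hτmono ht.1, hτ1 ▸ hτmono ht.2⟩
  have hτc : ContinuousOn τ (Icc 0 1) := fun t _ => (hτd t).continuousAt.continuousWithinAt
  set h : ℝ → E := fun t => c t - γ (τ t) with hh
  set h' : ℝ → E := fun t => c' t - θ t • v (τ t) with hh'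
  have hd : ∀ t ∈ Icc (0 : ℝ) 1, HasDerivWithinAt h (h' t) (Icc 0 1) t := fun t ht =>
    (hc t ht).sub ((hγ _ (hτmaps ht)).scomp t (hτd t).hasDerivWithinAt hτmaps)
  have hhc : ContinuousOn h' (Icc 0 1) :=
    hc'.sub (hθc.continuousOn.smul (hv.comp hτc hτmaps))
  have hh0 : h 0 = 0 := by simp [hh, hτ0, hc0]
  have hh1 : h 1 = 0 := by simp [hh, hτ1, hc1]
  set m : ℝ := ∫ t in (0 : ℝ)..1, ‖h' t‖ with hm
  have hle : ∀ t ∈ Icc (0 : ℝ) 1, ‖h t‖ ≤ m := fun t ht => by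
    simpa [hh0] using norm_sub_le_integral_norm_deriv hd hhc ht
  -- By the Euler-Lagrange equation `hp` the derivative of B is exactly the first-order term of the
  -- lower bound `hW`, times θ. B vanishes at both ends because h does.
  set B : ℝ → ℝ := fun t => momentum L (γ (τ t), v (τ t)) (h t) with hB
  set dL : ℝ → E →L[ℝ] ℝ := fun t =>
    (fderivWithin ℝ (Function.uncurry L) (D ×ˢ {0}ᶜ) (γ (τ t), v (τ t))).comp (inl ℝ E E) with hdL
  have hBd : ∀ t ∈ Icc (0 : ℝ) 1, HasDerivWithinAt B
      (θ t * dL t (h t) + momentum L (γ (τ t), v (τ t)) (h' t)) (Icc 0 1) t := fun t ht => by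
    have h1 := ((hp _ (hτmaps ht)).scomp t (hτd t).hasDerivWithinAt hτmaps).clm_apply (hd t ht)
    simpa [hdL] using h1
  -- With S = ‖h'‖/θ, the inequality S² ≥ 2bS - b² replaces Cauchy-Schwarz. As ∫θ = T and ∫‖h'‖ = m,
  -- this b is optimal: the κ-term contributes κm²/T, which dominates the loss Cm²T when CT² ≤ κ.
  set b : ℝ := m / T with hb
  have hpt : ∀ t ∈ Icc (0 : ℝ) 1,
      θ t * dL t (h t) + momentum L (γ (τ t), v (τ t)) (h' t)
        ≤ (2 * β)⁻¹ * σ' t + (κ * b ^ 2 + C * m ^ 2 - e) * θ t - 2 * κ * b * ‖h' t‖ := by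
    intro t ht
    have hw := hW _ (hγK _ (hτmaps ht)) _ (hcK t ht) _ (hv1 _ (hτmaps ht)) (hv2 _ (hτmaps ht))
      ((θ t)⁻¹ • c' t)
    rw [he _ (hτmaps ht), hF.homogeneous _ (hKD (hcK t ht)) _ _ (inv_pos.2 (hθ0 t))] at hw
    have hθt := hθ0 t
    have e1 : (θ t)⁻¹ • c' t - v (τ t) = (θ t)⁻¹ • h' t := by
      simp only [hh']
      rw [smul_sub, smul_smul, inv_mul_cancel₀ hθt.ne', one_smul]
    have e2 : 2 * L (c t) (c' t) = σ' t ^ 2 := by rw [hσ'e t ht, hσL t ht]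
    rw [e1, map_smul, norm_smul, Real.norm_of_nonneg (inv_pos.2 hθt).le, smul_eq_mul] at hw
    have hw' : e + dL t (h t) + (θ t)⁻¹ * momentum L (γ (τ t), v (τ t)) (h' t)
        + κ * ((θ t)⁻¹ * ‖h' t‖) ^ 2 - C * ‖h t‖ ^ 2 ≤ (θ t)⁻¹ ^ 2 * L (c t) (c' t) := hw
    have i1 : C * ‖h t‖ ^ 2 ≤ C * m ^ 2 := by
      have := hle t ht
      gcongr
    have i2 : 2 * b * ((θ t)⁻¹ * ‖h' t‖) - b ^ 2 ≤ ((θ t)⁻¹ * ‖h' t‖) ^ 2 := by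
      nlinarith [sq_nonneg ((θ t)⁻¹ * ‖h' t‖ - b)]
    -- The energy of the reparametrized competitor is σ²/(2θ), and βσ ≤ θ. Its integral is thus at
    -- most ℓ/(2β) = ℓ(ℓ + ε)/(2T), whence the form of `key`.
    have i3 : (θ t)⁻¹ ^ 2 * L (c t) (c' t) * θ t ≤ (2 * β)⁻¹ * σ' t := by
      have h1 : L (c t) (c' t) = σ' t ^ 2 / 2 := by linarith
      have h2 : β * σ' t ≤ θ t := by
        simp only [hθ]
        nlinarith
      rw [h1]
      have h3 : (θ t)⁻¹ ^ 2 * (σ' t ^ 2 / 2) * θ t = (β * σ' t / θ t) * ((2 * β)⁻¹ * σ' t) := by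
        field_simp
      rw [h3]
      refine mul_le_of_le_one_left ?_ ((div_le_one hθt).2 h2)
      exact mul_nonneg (by positivity) (hσ'0 t)
    have i4 := mul_le_mul_of_nonneg_right hw' hθt.le
    have i5 : θ t * ((θ t)⁻¹ * ‖h' t‖) = ‖h' t‖ := by field_simp
    have i6 : θ t * ((θ t)⁻¹ * momentum L (γ (τ t), v (τ t)) (h' t))
      = momentum L (γ (τ t), v (τ t)) (h' t) := by field_simp
    have i7 := mul_le_mul_of_nonneg_left i2 (mul_pos hκ hθt).le
    have i8 := mul_le_mul_of_nonneg_left i1 hθt.le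
    have i9 : κ * θ t * (2 * b * ((θ t)⁻¹ * ‖h' t‖) - b ^ 2)
      = 2 * κ * b * ‖h' t‖ - κ * b ^ 2 * θ t := by
      linear_combination 2 * κ * b * i5
    generalize (θ t)⁻¹ ^ 2 * L (c t) (c' t) = Z at i3 i4
    generalize (θ t)⁻¹ * momentum L (γ (τ t), v (τ t)) (h' t) = A at i4 i6
    generalize (θ t)⁻¹ * ‖h' t‖ = S at i4 i7 i9
    rw [i9] at i7
    linarith
  have hcont : ContinuousOn (fun t => (2 * β)⁻¹ * σ' t + (κ * b ^ 2 + C * m ^ 2 - e) * θ t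
      - 2 * κ * b * ‖h' t‖) (Icc 0 1) :=
    ((hσ'c.const_mul _).add (hθc.const_mul _)).continuousOn.sub (hhc.norm.const_mul _)
  have hmain := intervalIntegral.sub_le_integral_of_hasDeriv_right_of_le zero_le_one
    (fun t ht => (hBd t ht).continuousWithinAt)
    (fun t ht => ((hBd t (Ioo_subset_Icc_self ht)).hasDerivAt
      (Icc_mem_nhds ht.1 ht.2)).hasDerivWithinAt)
    hcont.integrableOn_Icc (fun t ht => hpt t (Ioo_subset_Icc_self ht))
  have hB0 : B 0 = 0 := by simp [hB, hh0]
  have hB1 : B 1 = 0 := by simp [hB, hh1]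
  have hI : ∫ t in (0 : ℝ)..1, ((2 * β)⁻¹ * σ' t + (κ * b ^ 2 + C * m ^ 2 - e) * θ t
      - 2 * κ * b * ‖h' t‖)
      = (2 * β)⁻¹ * ℓ + (κ * b ^ 2 + C * m ^ 2 - e) * T - 2 * κ * b * m := by
    have a1 : IntervalIntegrable (fun t => (2 * β)⁻¹ * σ' t) volume 0 1 :=
      (hσ'c.const_mul _).intervalIntegrable _ _
    have a2 : IntervalIntegrable (fun t => (κ * b ^ 2 + C * m ^ 2 - e) * θ t) volume 0 1 :=
      (hθc.const_mul _).intervalIntegrable _ _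
    have a3 : IntervalIntegrable (fun t => 2 * κ * b * ‖h' t‖) volume 0 1 :=
      (hhc.norm.const_mul _).intervalIntegrable_of_Icc zero_le_one
    rw [intervalIntegral.integral_sub (a1.add a2) a3, intervalIntegral.integral_add a1 a2,
      intervalIntegral.integral_const_mul _ σ', intervalIntegral.integral_const_mul _ θ,
      intervalIntegral.integral_const_mul _ fun t => ‖h' t‖, hℓ', ← hm, show ∫ t in (0 : ℝ)..1, θ t = T from hτ1]
  rw [hB0, hB1, hI, sub_zero] at hmain
  have f1 : b * T = m := by rw [hb]; field_simp
  have f2 : (2 * β)⁻¹ * ℓ * (2 * T) = ℓ * (ℓ + ε) := by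
    rw [hβ]; field_simp
  have f3 : (κ * b ^ 2 + C * m ^ 2 - e) * T - 2 * κ * b * m ≤ - e * T := by
    rw [← f1]
    have := mul_le_mul_of_nonneg_right hCT (by positivity : 0 ≤ b ^ 2 * T)
    linarith
  have f4 := mul_le_mul_of_nonneg_right (hmain.trans (by linarith :
    _ ≤ (2 * β)⁻¹ * ℓ + - e * T)) (by positivity : 0 ≤ 2 * T)
  linarith

end Minimization

/-! ### Geodesics near a strictly convex boundary point leave the half-space. -/

section Flow

open ContinuousLinearMap

/-- Picard-Lindelöf for a bounded Lipschitz field on a closed ball, with control of the range of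
the solution. -/
theorem exists_solution_mem_closedBall {Z : Type*} [NormedAddCommGroup Z] [NormedSpace ℝ Z]
    [CompleteSpace Z] {X : Z → Z} {z : Z} {a M T : ℝ} {C : NNReal} (ha : 0 ≤ a) (hM : 0 ≤ M)
    (hT : 0 ≤ T) (hMT : M * T ≤ a)
    (hX : LipschitzOnWith C X (Metric.closedBall z a))
    (hXM : ∀ p ∈ Metric.closedBall z a, ‖X p‖ ≤ M) :
    ∃ α : ℝ → Z, α 0 = z ∧ (∀ t ∈ Icc 0 T, HasDerivWithinAt α (X (α t)) (Icc 0 T) t) ∧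
      ∀ t, α t ∈ Metric.closedBall z a := by
  lift a to NNReal using ha
  lift M to NNReal using hM
  have hf : IsPicardLindelof (fun _ => X) (⟨0, le_rfl, hT⟩ : Icc (0 : ℝ) T) z a 0 M C :=
    { lipschitzOnWith := fun _ _ => hX
      continuousOn := fun _ _ => continuousOn_const
      norm_le := fun _ _ p hp => hXM p hp
      mul_max_le := by simpa [hT] using hMT }
  have hz : z ∈ Metric.closedBall z ((0 : NNReal) : ℝ) := by simp
  -- The fixed point of the Picard iteration is kept, since as an element of the function space it
  -- carries the bound on its range at all real times.
  obtain ⟨α, hα⟩ := ODE.FunSpace.exists_isFixedPt_next hf hz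
  refine ⟨α.compProj, ?_, fun t ht => ?_, fun t => α.compProj_mem_closedBall hf.mul_max_le⟩
  · have := α.compProj_val (t := ⟨0, le_rfl, hT⟩)
    rw [this, ← hα, ODE.FunSpace.next_apply₀]
  · have h1 := ODE.hasDerivWithinAt_picard_Icc (f := fun _ => X) (x₀ := z)
      (u := Metric.closedBall z a) (⟨le_rfl, hT⟩ : (0 : ℝ) ∈ Icc 0 T) hf.continuousOn_uncurry
      α.continuous_compProj.continuousOn
      (fun _ _ => α.compProj_mem_closedBall hf.mul_max_le) ht
    refine h1.congr_of_mem (fun t' ht' => ?_) ht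
    nth_rw 1 [← hα]
    rw [ODE.FunSpace.compProj_of_mem ht', ODE.FunSpace.next_apply]

variable {E : Type*} [NormedAddCommGroup E] [NormedSpace ℝ E] [FiniteDimensional ℝ E]

theorem antitoneOn_Icc_of_hasDerivWithinAt {f f' : ℝ → ℝ} {T : ℝ}
    (hf : ∀ t ∈ Icc 0 T, HasDerivWithinAt f (f' t) (Icc 0 T) t)
    (hf' : ∀ t ∈ Icc 0 T, f' t ≤ 0) : AntitoneOn f (Icc 0 T) := by
  refine antitoneOn_of_hasDerivWithinAt_nonpos (f' := f') (convex_Icc 0 T)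
    (fun t ht => (hf t ht).continuousWithinAt)
    (fun t ht => (hf t (interior_subset ht)).mono interior_subset)
    (fun t ht => hf' t (interior_subset ht))

omit [NormedSpace ℝ E] [FiniteDimensional ℝ E] in
theorem isCompact_annulus [ProperSpace E] : IsCompact {v : E | 1 / 2 ≤ ‖v‖ ∧ ‖v‖ ≤ 2} := by
  refine (isCompact_closedBall (0 : E) 2).of_isClosed_subset ?_ fun v hv => by simpa using hv.2
  exact (isClosed_le continuous_const continuous_norm).inter
    (isClosed_le continuous_norm continuous_const)

/-- A half-space together with a nonexpansive retraction onto it. -/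
structure IsHalfSpace (R : Set E) (ℓ : E →L[ℝ] ℝ) (ρ : E → E) : Prop where
  mem_iff : ∀ y, y ∈ R ↔ 0 ≤ ℓ y
  lipschitz : LipschitzWith 1 ρ
  maps : ∀ y, ρ y ∈ R
  eq_self : ∀ y ∈ R, ρ y = y

omit [FiniteDimensional ℝ E] in
theorem IsHalfSpace.isClosed {R : Set E} {ℓ : E →L[ℝ] ℝ} {ρ : E → E} (hR : IsHalfSpace R ℓ ρ) :
    IsClosed R := by
  have : R = {y | 0 ≤ ℓ y} := by ext y; exact hR.mem_iff y
  rw [this]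
  exact isClosed_le continuous_const ℓ.continuous

omit [FiniteDimensional ℝ E] in
theorem IsHalfSpace.convex {R : Set E} {ℓ : E →L[ℝ] ℝ} {ρ : E → E} (hR : IsHalfSpace R ℓ ρ) :
    Convex ℝ R := by
  have : R = {y | 0 ≤ ℓ y} := by ext y; exact hR.mem_iff y
  rw [this]
  exact convex_halfSpace_ge ℓ.isLinear 0

omit [FiniteDimensional ℝ E] in
theorem IsHalfSpace.retract_mem {R : Set E} {ℓ : E →L[ℝ] ℝ} {ρ : E → E}
    (hR : IsHalfSpace R ℓ ρ) {y₀ : E} (hy₀ : y₀ ∈ R) {r : ℝ} {y : E}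
    (hy : y ∈ Metric.closedBall y₀ r) : ρ y ∈ Metric.closedBall y₀ r ∩ R := by
  refine ⟨?_, hR.maps y⟩
  have h1 := hR.lipschitz.dist_le_mul y y₀
  rw [hR.eq_self y₀ hy₀, NNReal.coe_one, one_mul] at h1
  exact h1.trans hy

/-- Strict convexity of the boundary at one point persists uniformly nearby. -/
theorem IsCoordFinsler.exists_spray_le {R D : Set E} {L : E → E → ℝ} {ℓ : E →L[ℝ] ℝ}
    (h : IsCoordFinsler R D L) {y₀ : E}
    (hconv : ∀ w, w ≠ 0 → ℓ w = 0 → ℓ (spray D L (y₀, w)) < 0)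
    {r : ℝ} (hr : 0 < r) (hRc : IsClosed R) (hy₀ : y₀ ∈ R)
    (hrD : Metric.closedBall y₀ r ∩ R ⊆ D) :
    ∃ r₁ δ c : ℝ, 0 < r₁ ∧ r₁ ≤ r ∧ 0 < δ ∧ 0 < c ∧ ∀ y ∈ Metric.closedBall y₀ r₁ ∩ R, ∀ w,
      1 / 2 ≤ ‖w‖ → ‖w‖ ≤ 2 → |ℓ w| ≤ δ → ℓ (spray D L (y, w)) ≤ -c := by
  have := FiniteDimensional.proper_real E
  set A : Set E := {v : E | 1 / 2 ≤ ‖v‖ ∧ ‖v‖ ≤ 2} with hA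
  have hAc : IsCompact A := isCompact_annulus
  have hA0 : ∀ v ∈ A, v ≠ 0 := fun v hv h0 => by
    have := hv.1
    rw [h0, norm_zero] at this
    norm_num at this
  set K : Set E := Metric.closedBall y₀ r ∩ R
  have hK : IsCompact K := (isCompact_closedBall y₀ r).inter_right hRc
  have hsub : K ×ˢ A ⊆ D ×ˢ {0}ᶜ := prod_mono hrD hA0
  have hcont : ContinuousOn (fun q => ℓ (spray D L q)) (K ×ˢ A) :=
    ℓ.continuous.comp_continuousOn (h.contDiffOn_spray.continuousOn.mono hsub)
  have hy₀K : y₀ ∈ K := ⟨Metric.mem_closedBall_self hr.le, hy₀⟩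
  -- a negative upper bound over `y₀`
  obtain ⟨c, hc, hcle⟩ : ∃ c : ℝ, 0 < c ∧ ∀ w ∈ A, ℓ w = 0 → ℓ (spray D L (y₀, w)) < -c := by
    have hAz : IsCompact (A ∩ {w | ℓ w = 0}) :=
      hAc.inter_right (isClosed_eq ℓ.continuous continuous_const)
    have hc1 : ContinuousOn (fun w => ℓ (spray D L (y₀, w))) (A ∩ {w | ℓ w = 0}) :=
      hcont.comp (by fun_prop) (fun w hw => ⟨hy₀K, hw.1⟩)
    rcases eq_empty_or_nonempty (A ∩ {w | ℓ w = 0}) with he | hne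
    · refine ⟨1, one_pos, fun w hw hw0 => ?_⟩
      have : w ∈ A ∩ {w | ℓ w = 0} := ⟨hw, hw0⟩
      rw [he] at this
      exact this.elim
    · obtain ⟨w₀, hw₀, hmax⟩ := hAz.exists_isMaxOn hne hc1
      have hneg := hconv w₀ (hA0 _ hw₀.1) hw₀.2
      refine ⟨-ℓ (spray D L (y₀, w₀)) / 2, by linarith, fun w hw hw0 => ?_⟩
      have : ℓ (spray D L (y₀, w)) ≤ ℓ (spray D L (y₀, w₀)) := hmax ⟨hw, hw0⟩
      linarith
  -- the set where the bound fails is compact and stays away from `{y₀} × ker ℓ`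
  set B : Set (E × E) := (K ×ˢ A) ∩ (fun q => ℓ (spray D L q)) ⁻¹' Ici (-c) with hB
  have hBc : IsCompact B := by
    exact (hK.prod hAc).of_isClosed_subset (hcont.preimage_isClosed_of_isClosed
      (hK.prod hAc).isClosed isClosed_Ici) inter_subset_left
  have hBcont : ContinuousOn (fun q : E × E => dist q.1 y₀ + |ℓ q.2|) B := by fun_prop
  obtain ⟨δ, hδ, hδle⟩ : ∃ δ : ℝ, 0 < δ ∧ ∀ q ∈ B, δ ≤ dist q.1 y₀ + |ℓ q.2| := by
    rcases B.eq_empty_or_nonempty with he | hne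
    · exact ⟨1, one_pos, by simp [he]⟩
    · obtain ⟨q, hq, hmin⟩ := hBc.exists_isMinOn hne hBcont
      refine ⟨_, ?_, fun p hp => hmin hp⟩
      by_contra hle
      have h1 : dist q.1 y₀ = 0 := by
        linarith [dist_nonneg (x := q.1) (y := y₀), abs_nonneg (ℓ q.2)]
      have h2 : |ℓ q.2| = 0 := by linarith [dist_nonneg (x := q.1) (y := y₀), abs_nonneg (ℓ q.2)]
      have h3 := hcle q.2 hq.1.2 (abs_eq_zero.1 h2)
      have h4 : -c ≤ ℓ (spray D L q) := hq.2
      rw [← dist_eq_zero.1 h1] at h3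
      exact absurd h3 (not_lt.2 h4)
  -- A point of `B` has dist + |ℓ| ≥ δ, which two summands of size at most δ/3 contradict.
  refine ⟨min r (δ / 3), δ / 3, c, lt_min hr (by linarith), min_le_left _ _, by linarith, hc,
    fun y hy w hw1 hw2 hw => ?_⟩
  by_contra hlt
  push Not at hlt
  have hyd : dist y y₀ ≤ min r (δ / 3) := hy.1
  have hmem : (y, w) ∈ B := ⟨⟨⟨hyd.trans (min_le_left _ _), hy.2⟩, hw1, hw2⟩, hlt.le⟩
  have h1 := hδle _ hmem
  have h2 := hyd.trans (min_le_right _ _)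
  simp only at h1
  linarith

/-- The geodesic field, extended beyond the half-space by means of the retraction `ρ`. -/
def extendedField (D : Set E) (L : E → E → ℝ) (ρ : E → E) (q : E × E) : E × E :=
  (q.2, spray D L (ρ q.1, q.2))

/-- The retraction preserves the ball about `y₀` and does not increase distances, so the bounds of
the smooth spray over a compact set carry over. Balls of radius 1/2 about unit vectors are convex
and lie in a compact annulus away from 0, which makes the constants independent of `w`. -/
theorem IsCoordFinsler.exists_lipschitzOnWith_extendedField {R D : Set E} {L : E → E → ℝ}
    {ℓ : E →L[ℝ] ℝ} {ρ : E → E} (h : IsCoordFinsler R D L) (hR : IsHalfSpace R ℓ ρ)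
    {y₀ : E} (hy₀ : y₀ ∈ R) {r : ℝ} (hrD : Metric.closedBall y₀ r ∩ R ⊆ D) :
    ∃ (C : NNReal) (M : ℝ), 0 < M ∧
      (∀ w : E, ‖w‖ = 1 → LipschitzOnWith C (extendedField D L ρ)
        (Metric.closedBall y₀ r ×ˢ Metric.closedBall w (1 / 2))) ∧
      ∀ w : E, ‖w‖ = 1 → ∀ q ∈ Metric.closedBall y₀ r ×ˢ Metric.closedBall w (1 / 2),
        ‖extendedField D L ρ q‖ ≤ M := by
  have := FiniteDimensional.proper_real E
  set A : Set E := {v : E | 1 / 2 ≤ ‖v‖ ∧ ‖v‖ ≤ 2} with hA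
  have hAc : IsCompact A := isCompact_annulus
  have hA0 : ∀ v ∈ A, v ≠ 0 := fun v hv h0 => by
    have := hv.1
    rw [h0, norm_zero] at this
    norm_num at this
  set K : Set E := Metric.closedBall y₀ r ∩ R
  have hK : IsCompact K := (isCompact_closedBall y₀ r).inter_right hR.isClosed
  have hKc : Convex ℝ K := (convex_closedBall y₀ r).inter hR.convex
  have hsub : K ×ˢ A ⊆ D ×ˢ {0}ᶜ := prod_mono hrD hA0
  have hball : ∀ w : E, ‖w‖ = 1 → Metric.closedBall w (1 / 2) ⊆ A := fun w hw v hv => by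
    have h1 : ‖v - w‖ ≤ 1 / 2 := by simpa [dist_eq_norm] using hv
    have h2 := norm_sub_norm_le w v
    have h3 := norm_sub_norm_le v w
    rw [norm_sub_rev] at h2
    exact ⟨by linarith, by linarith⟩
  obtain ⟨C, hC, hlip⟩ := exists_bound_of_isCompact h.contDiffOn_spray h.uniqueDiffOn_prod
    (hK.prod hAc) hsub
  obtain ⟨M, hM⟩ := (hK.prod hAc).exists_bound_of_continuousOn
    (h.contDiffOn_spray.continuousOn.mono hsub)
  have hret : ∀ w : E, ‖w‖ = 1 → ∀ q ∈ Metric.closedBall y₀ r ×ˢ Metric.closedBall w (1 / 2),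
      (ρ q.1, q.2) ∈ K ×ˢ Metric.closedBall w (1 / 2) := fun w hw q hq =>
    ⟨hR.retract_mem hy₀ hq.1, hq.2⟩
  refine ⟨max 1 C.toNNReal, max M 2, by positivity, fun w hw => ?_, fun w hw q hq => ?_⟩
  · refine LipschitzOnWith.of_dist_le_mul fun p hp q hq => ?_
    have h1 := hlip _ (prod_mono le_rfl (hball w hw)) (hKc.prod (convex_closedBall w _))
      _ (hret w hw q hq) _ (hret w hw p hp)
    have h2 : ‖((ρ p.1, p.2) : E × E) - (ρ q.1, q.2)‖ ≤ dist p q := by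
      rw [← dist_eq_norm, Prod.dist_eq, Prod.dist_eq]
      have := hR.lipschitz.dist_le_mul p.1 q.1
      rw [NNReal.coe_one, one_mul] at this
      exact max_le_max this le_rfl
    rw [Prod.dist_eq, NNReal.coe_max, Real.coe_toNNReal _ hC, NNReal.coe_one]
    refine max_le ?_ ?_
    · calc dist p.2 q.2 ≤ 1 * dist p q := by rw [one_mul]; exact le_max_right _ _
        _ ≤ _ := by gcongr; exact le_max_left _ _
    · calc dist (spray D L (ρ p.1, p.2)) (spray D L (ρ q.1, q.2)) ≤ C * dist p q := by
            rw [dist_eq_norm]; exact h1.trans (by gcongr)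
        _ ≤ _ := by gcongr; exact le_max_right _ _
  · have h1 := hM _ (prod_mono le_rfl (hball w hw) (hret w hw q hq))
    have h2 := (hball w hw hq.2).2
    exact max_le (h2.trans (le_max_right _ _)) (h1.trans (le_max_left _ _))

/-- Geodesics that start near a strictly convex boundary point and do not point inwards leave the
half-space within a short time. -/
theorem IsCoordFinsler.exists_exit {R D : Set E} {L : E → E → ℝ}
    {ℓ : E →L[ℝ] ℝ} {ρ : E → E} (h : IsCoordFinsler R D L) (hR : IsHalfSpace R ℓ ρ)
    {y₀ : E} (hy₀ : ℓ y₀ = 0) (hconv : ∀ w, w ≠ 0 → ℓ w = 0 → ℓ (spray D L (y₀, w)) < 0)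
    {r : ℝ} (hr : 0 < r) (hrD : Metric.closedBall y₀ r ∩ R ⊆ D) {T₁ : ℝ} (hT₁ : 0 < T₁) :
    ∃ r' : ℝ, 0 < r' ∧ ∀ y ∈ Metric.closedBall y₀ r' ∩ R, ∀ w, ‖w‖ = 1 → ℓ w ≤ 0 →
      ∃ (T₀ T : ℝ) (z : ℝ → E × E), 0 ≤ T ∧ T < T₀ ∧ T₀ ≤ T₁ ∧ z 0 = (y, w) ∧
        (∀ t ∈ Icc 0 T₀, HasDerivWithinAt z (extendedField D L ρ (z t)) (Icc 0 T₀) t) ∧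
        (∀ t, z t ∈ Metric.ball y₀ r ×ˢ Metric.ball w (1 / 2)) ∧
        ℓ (z T).1 = 0 ∧ (∀ t ∈ Icc 0 T, 0 ≤ ℓ (z t).1) ∧ ∀ t ∈ Ioc T T₀, ℓ (z t).1 < 0 := by
  have := FiniteDimensional.complete ℝ E
  have hy₀R : y₀ ∈ R := (hR.mem_iff y₀).2 hy₀.ge
  obtain ⟨r₁, δ, c₀, hr₁, hr₁r, hδ, hc₀, hspray⟩ :=
    h.exists_spray_le hconv hr hR.isClosed hy₀R hrD
  have hr₁D : Metric.closedBall y₀ r₁ ∩ R ⊆ D :=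
    (inter_subset_inter_left _ (Metric.closedBall_subset_closedBall hr₁r)).trans hrD
  obtain ⟨C, M, hM, hlip, hbd⟩ := h.exists_lipschitzOnWith_extendedField hR hy₀R hr₁D
  -- The permitted deviation from the initial data: position and velocity stay where the estimates
  -- hold, and ℓ of the velocity changes by at most δ/4.
  obtain ⟨a, ha, ha1, ha2, ha3⟩ : ∃ a : ℝ, 0 < a ∧ a ≤ r₁ / 4 ∧ a ≤ 1 / 4 ∧ ‖ℓ‖ * a ≤ δ / 4 := by
    refine ⟨min (min (r₁ / 4) (1 / 4)) (δ / (4 * (‖ℓ‖ + 1))), by positivity,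
      (min_le_left _ _).trans (min_le_left _ _), (min_le_left _ _).trans (min_le_right _ _), ?_⟩
    calc ‖ℓ‖ * _ ≤ (‖ℓ‖ + 1) * (δ / (4 * (‖ℓ‖ + 1))) := by
          gcongr
          · linarith
          · exact min_le_right _ _
      _ = δ / 4 := by field_simp
  set T₀ : ℝ := min T₁ (a / M) with hT₀
  have hT₀pos : 0 < T₀ := lt_min hT₁ (div_pos ha hM)
  have hMT : M * T₀ ≤ a := by
    calc M * T₀ ≤ M * (a / M) := by gcongr; exact min_le_right _ _
      _ = a := by field_simp
  set c : ℝ := min c₀ (δ / (4 * T₀)) with hc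
  have hcpos : 0 < c := lt_min hc₀ (by positivity)
  -- The initial height ℓ(y) must be less than cT₀²/2, the drop forced up to time T₀ by ℓ ≤ -ct on
  -- the velocity.
  obtain ⟨r', hr', hr'1, hr'2⟩ : ∃ r' : ℝ, 0 < r' ∧ r' ≤ r₁ / 4 ∧ ‖ℓ‖ * r' < c * T₀ ^ 2 / 2 := by
    refine ⟨min (r₁ / 4) (c * T₀ ^ 2 / 4 / (‖ℓ‖ + 1)), by positivity, min_le_left _ _, ?_⟩
    calc ‖ℓ‖ * _ ≤ (‖ℓ‖ + 1) * (c * T₀ ^ 2 / 4 / (‖ℓ‖ + 1)) := by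
          gcongr
          · linarith
          · exact min_le_right _ _
      _ = c * T₀ ^ 2 / 4 := by field_simp
      _ < _ := by
        have : 0 < c * T₀ ^ 2 := by positivity
        linarith
  refine ⟨r', hr', fun y hy w hw hℓw => ?_⟩
  have hbox : Metric.closedBall (y, w) a
      ⊆ Metric.closedBall y₀ r₁ ×ˢ Metric.closedBall w (1 / 2) := by
    rw [← closedBall_prod_same]
    refine prod_mono (Metric.closedBall_subset_closedBall' ?_)
      (Metric.closedBall_subset_closedBall (by linarith))
    have : dist y y₀ ≤ r' := hy.1
    linarith
  obtain ⟨z, hz0, hzd, hzm⟩ := exists_solution_mem_closedBall ha.le hM.le hT₀pos.le hMT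
    ((hlip w hw).mono hbox) (fun p hp => hbd w hw p (hbox hp))
  have hz1 : ∀ t, dist (z t).1 y ≤ a := fun t => (le_max_left _ _).trans (hzm t)
  have hz2 : ∀ t, ‖(z t).2 - w‖ ≤ a := fun t => by
    rw [← dist_eq_norm]; exact (le_max_right _ _).trans (hzm t)
  have hd1 : ∀ t ∈ Icc 0 T₀, HasDerivWithinAt (fun t => ℓ (z t).1) (ℓ (z t).2) (Icc 0 T₀) t :=
    fun t ht => ((ℓ.comp (fst ℝ E E)).hasFDerivAt.comp_hasDerivWithinAt t (hzd t ht))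
  have hd2 : ∀ t ∈ Icc 0 T₀, HasDerivWithinAt (fun t => ℓ (z t).2)
      (ℓ (spray D L (ρ (z t).1, (z t).2))) (Icc 0 T₀) t :=
    fun t ht => ((ℓ.comp (snd ℝ E E)).hasFDerivAt.comp_hasDerivWithinAt t (hzd t ht))
  have hℓ2 : ∀ t, |ℓ (z t).2 - ℓ w| ≤ δ / 4 := fun t => by
    rw [← map_sub, ← Real.norm_eq_abs]
    calc _ ≤ ‖ℓ‖ * ‖(z t).2 - w‖ := ℓ.le_opNorm _
      _ ≤ ‖ℓ‖ * a := by gcongr; exact hz2 t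
      _ ≤ _ := ha3
  have hneg : ∀ t ∈ Icc 0 T₀, ℓ (z t).2 ≤ -(c * t) := by
    intro t ht
    -- A clearly outward velocity stays below -δ/4, and ct ≤ δ/4 by the choice of c. Otherwise the
    -- velocity remains nearly tangent, |ℓ| ≤ 3δ/4, and strict convexity bounds the acceleration.
    rcases le_or_gt (ℓ w) (-(δ / 2)) with hcase | hcase
    · have h1 := (abs_le.1 (hℓ2 t)).2
      have h2 : c * t ≤ δ / 4 := by
        calc c * t ≤ δ / (4 * T₀) * T₀ :=
              mul_le_mul (min_le_right _ _) ht.2 ht.1 (by positivity)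
          _ = δ / 4 := by field_simp
      linarith
    · have hanti := antitoneOn_Icc_of_hasDerivWithinAt (f := fun t => ℓ (z t).2 + c * t)
        (f' := fun t => ℓ (spray D L (ρ (z t).1, (z t).2)) + c * 1)
        (fun t ht => (hd2 t ht).add ((hasDerivWithinAt_id t _).const_mul c)) (fun s hs => ?_)
      · have h1 := hanti ⟨le_rfl, hT₀pos.le⟩ ht ht.1
        simp only [hz0] at h1
        linarith
      · have hmem := hR.retract_mem hy₀R (hbox (hzm s)).1
        have h2 := norm_sub_norm_le w (z s).2
        have h3 := norm_sub_norm_le (z s).2 w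
        rw [norm_sub_rev] at h2
        have h4 := hz2 s
        have h5 := abs_le.1 (hℓ2 s)
        have := hspray _ hmem (z s).2 (by linarith) (by linarith)
          (abs_le.2 ⟨by linarith [h5.1], by linarith [h5.2]⟩)
        have h6 : c ≤ c₀ := min_le_left _ _
        linarith
  have hdec : ℓ (z T₀).1 < 0 := by
    have hanti := antitoneOn_Icc_of_hasDerivWithinAt (f := fun t => ℓ (z t).1 + c / 2 * t ^ 2)
      (f' := fun t => ℓ (z t).2 + c / 2 * (((2 : ℕ) : ℝ) * t ^ (2 - 1)))
      (fun t ht => (hd1 t ht).add ((hasDerivAt_pow 2 t).hasDerivWithinAt.const_mul _))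
      (fun t ht => by have := hneg t ht; simp; linarith)
    have h1 := hanti ⟨le_rfl, hT₀pos.le⟩ ⟨hT₀pos.le, le_rfl⟩ hT₀pos.le
    simp only [hz0] at h1
    have h2 : ℓ y ≤ ‖ℓ‖ * r' := by
      have h3 : ℓ y = ℓ (y - y₀) := by rw [map_sub, hy₀, sub_zero]
      rw [h3]
      calc ℓ (y - y₀) ≤ ‖ℓ (y - y₀)‖ := le_abs_self _
        _ ≤ ‖ℓ‖ * ‖y - y₀‖ := ℓ.le_opNorm _
        _ ≤ _ := by gcongr; rw [← dist_eq_norm]; exact hy.1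
    simp at h1
    linarith
  have hcont : ContinuousOn (fun t => ℓ (z t).1) (Icc 0 T₀) := fun t ht =>
    (hd1 t ht).continuousWithinAt
  have hstrict : StrictAntiOn (fun t => ℓ (z t).1) (Icc 0 T₀) := by
    refine strictAntiOn_of_hasDerivWithinAt_neg (f' := fun t => ℓ (z t).2) (convex_Icc 0 T₀) hcont
      (fun t ht => (hd1 t (interior_subset ht)).mono interior_subset) (fun t ht => ?_)
    have h1 := hneg t (interior_subset ht)
    rw [interior_Icc] at ht
    have := mul_pos hcpos ht.1
    linarith
  obtain ⟨T, hT, hTz⟩ : ∃ T ∈ Icc 0 T₀, ℓ (z T).1 = 0 :=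
    intermediate_value_Icc' hT₀pos.le hcont ⟨hdec.le, by
      simp only [hz0]
      exact (hR.mem_iff y).1 hy.2⟩
  have hTlt : T < T₀ := lt_of_le_of_ne hT.2 fun he => by rw [← he, hTz] at hdec; exact hdec.ne rfl
  refine ⟨T₀, T, z, hT.1, hTlt, min_le_left _ _, hz0, hzd, fun t => ⟨?_, ?_⟩, hTz,
    fun t ht => ?_, fun t ht => ?_⟩
  · have h1 := dist_triangle (z t).1 y y₀
    have h2 : dist y y₀ ≤ r' := hy.1
    have h3 := hz1 t
    rw [Metric.mem_ball]
    linarith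
  · rw [Metric.mem_ball, dist_eq_norm]
    have := hz2 t
    linarith
  · rw [← hTz]
    exact hstrict.antitoneOn ⟨ht.1, ht.2.trans hT.2⟩ hT ht.2
  · rw [← hTz]
    exact hstrict hT ⟨hT.1.trans ht.1.le, ht.2⟩ ht.1

end Flow

/-! ### Derivatives of curves under change of chart. -/

section CurvesInCharts

variable {E : Type*} [NormedAddCommGroup E] [NormedSpace ℝ E]
  {H : Type*} [TopologicalSpace H] {J : ModelWithCorners ℝ E H}
  {N : Type*} [TopologicalSpace N] [ChartedSpace H N] [IsManifold J 1 N]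

omit [IsManifold J 1 N] in
theorem hasMFDerivWithinAt_curve_iff {c : ℝ → N} {s : Set ℝ} {t : ℝ} {A : ℝ →L[ℝ] E} :
    HasMFDerivWithinAt 𝓘(ℝ, ℝ) J c s t A ↔ ContinuousWithinAt c s t ∧
      HasDerivWithinAt (extChartAt J (c t) ∘ c) (A 1) s t := by
  have h1 : HasDerivWithinAt (extChartAt J (c t) ∘ c) (A 1) s t
      ↔ HasFDerivWithinAt (extChartAt J (c t) ∘ c) A s t := by
    rw [hasDerivWithinAt_iff_hasFDerivWithinAt]
    have : ContinuousLinearMap.toSpanSingleton ℝ (A 1) = A := by ext; simp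
    rw [this]
  have h2 : (extChartAt 𝓘(ℝ, ℝ) t).symm ⁻¹' s ∩ range 𝓘(ℝ, ℝ) = s := by
    rw [extChartAt_model_space_eq_id]
    simp
  have h3 : HasMFDerivWithinAt 𝓘(ℝ, ℝ) J c s t A ↔ ContinuousWithinAt c s t ∧
      HasFDerivWithinAt (extChartAt J (c t) ∘ c) A
        ((extChartAt 𝓘(ℝ, ℝ) t).symm ⁻¹' s ∩ range 𝓘(ℝ, ℝ)) t := Iff.rfl
  rw [h3, h2, h1]

theorem hasDerivWithinAt_changeChart {c : ℝ → N} {s : Set ℝ} {t : ℝ} {p q : N} {d : E}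
    (hc : ContinuousWithinAt c s t) (hp : c t ∈ (extChartAt J p).source)
    (hq : c t ∈ (extChartAt J q).source) (hd : HasDerivWithinAt (extChartAt J p ∘ c) d s t) :
    HasDerivWithinAt (extChartAt J q ∘ c) (tangentCoordChange J p q (c t) d) s t := by
  have h1 := hasFDerivWithinAt_tangentCoordChange (I := J) (x := p) (y := q) (z := c t) ⟨hp, hq⟩
  have hev : ∀ᶠ t' in 𝓝[s] t, c t' ∈ (extChartAt J p).source :=
    hc (extChartAt_source_mem_nhds' hp)
  have h2 : HasDerivWithinAt ((extChartAt J q ∘ (extChartAt J p).symm) ∘ (extChartAt J p ∘ c))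
      (tangentCoordChange J p q (c t) d) s t :=
    HasFDerivWithinAt.comp_hasDerivWithinAt (t := range J) t h1 hd fun t' _ => by
      simp only [Function.comp_apply, extChartAt_coe]
      exact mem_range_self _
  refine h2.congr_of_eventuallyEq ?_ ?_
  · filter_upwards [hev] with t' ht'
    simp only [Function.comp_apply]
    rw [(extChartAt J p).left_inv ht']
  · simp only [Function.comp_apply]
    rw [(extChartAt J p).left_inv hp]

theorem hasDerivWithinAt_of_hasMFDerivWithinAt {c : ℝ → N} {s : Set ℝ} {t : ℝ} {q : N}
    {A : ℝ →L[ℝ] E} (hc : HasMFDerivWithinAt 𝓘(ℝ, ℝ) J c s t A)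
    (hq : c t ∈ (extChartAt J q).source) :
    HasDerivWithinAt (extChartAt J q ∘ c) (tangentCoordChange J (c t) q (c t) (A 1)) s t :=
  hasDerivWithinAt_changeChart (hasMFDerivWithinAt_curve_iff.1 hc).1 (mem_extChartAt_source (c t))
    hq (hasMFDerivWithinAt_curve_iff.1 hc).2

theorem hasMFDerivWithinAt_of_hasDerivWithinAt {c : ℝ → N} {s : Set ℝ} {t : ℝ} {q : N} {d : E}
    (hc : ContinuousWithinAt c s t) (hq : c t ∈ (extChartAt J q).source)
    (hd : HasDerivWithinAt (extChartAt J q ∘ c) d s t) :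
    HasMFDerivWithinAt 𝓘(ℝ, ℝ) J c s t
      ((1 : ℝ →L[ℝ] ℝ).smulRight (tangentCoordChange J q (c t) (c t) d) : ℝ →L[ℝ] E) :=
  hasMFDerivWithinAt_curve_iff.2 ⟨hc, by
    simpa using hasDerivWithinAt_changeChart hc hq (mem_extChartAt_source (c t)) hd⟩

end CurvesInCharts

/-! ### Charts of the tangent bundle, and the energy read in them. -/

section TangentCharts

variable {E : Type*} [NormedAddCommGroup E] [NormedSpace ℝ E]
  {H : Type*} [TopologicalSpace H] {I : ModelWithCorners ℝ E H}
  {M : Type*} [TopologicalSpace M] [ChartedSpace H M] [IsManifold I ∞ M]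

/-- The chart of the tangent bundle induced by the chart of `M` at `p`. -/
abbrev tangentChart (I : ModelWithCorners ℝ E H) {M : Type*} [TopologicalSpace M]
    [ChartedSpace H M] [IsManifold I ∞ M] (p : M) : PartialEquiv (TangentBundle I M) (E × E) :=
  extChartAt I.tangent (⟨p, 0⟩ : TangentBundle I M)

theorem mem_tangentChart_source {p : M} {ξ : TangentBundle I M} :
    ξ ∈ (tangentChart I p).source ↔ ξ.1 ∈ (extChartAt I p).source := by
  simp [tangentChart]

theorem tangentChart_target (p : M) :
    (tangentChart I p).target = (extChartAt I p).target ×ˢ univ := by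
  rw [tangentChart, FiberBundle.extChartAt_target]
  congr 1
  simp only [TangentBundle.trivializationAt_baseSet]
  refine inter_eq_left.2 fun y hy => ?_
  have := (extChartAt I p).map_target hy
  rwa [extChartAt_source] at this

theorem tangentChart_apply (p : M) (ξ : TangentBundle I M) :
    tangentChart I p ξ = (extChartAt I p ξ.1, tangentCoordChange I ξ.1 p ξ.1 ξ.2) := rfl

theorem tangentChart_self (ξ : TangentBundle I M) :
    tangentChart I ξ.1 ξ = (extChartAt I ξ.1 ξ.1, ξ.2) :=
  Prod.ext rfl (tangentCoordChange_self (E := E) (I := I) (x := ξ.1) (z := ξ.1) (mem_extChartAt_source _))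

theorem tangentChart_symm_apply {p : M} {y w : E} (hy : y ∈ (extChartAt I p).target) :
    (tangentChart I p).symm (y, w) = ⟨(extChartAt I p).symm y,
      tangentCoordChange I p ((extChartAt I p).symm y) ((extChartAt I p).symm y) w⟩ := by
  set x := (extChartAt I p).symm y with hx
  have hxs : x ∈ (extChartAt I p).source := (extChartAt I p).map_target hy
  set ξ : TangentBundle I M := ⟨x, tangentCoordChange I p x x w⟩ with hξ
  have h1 : tangentChart I p ξ = (y, w) := by
    rw [tangentChart_apply, hξ]
    ext1
    · exact (extChartAt I p).right_inv hy
    · simp only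
      rw [tangentCoordChange_comp ⟨⟨hxs, mem_extChartAt_source x⟩, hxs⟩, tangentCoordChange_self hxs]
  rw [← h1, (tangentChart I p).left_inv (mem_tangentChart_source.2 hxs)]

theorem tangentCoordChange_ne_zero {p q x : M} (hp : x ∈ (extChartAt I p).source)
    (hq : x ∈ (extChartAt I q).source) {v : E} (hv : v ≠ 0) :
    tangentCoordChange I p q x v ≠ 0 := by
  intro h0
  apply hv
  rw [← tangentCoordChange_self (I := I) hp (v := v),
    ← tangentCoordChange_comp ⟨⟨hp, hq⟩, hp⟩, h0, map_zero]

theorem chartEnergy_tangentChart (F : TangentBundle I M → ℝ) {p : M} {ξ : TangentBundle I M}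
    (hξ : ξ.1 ∈ (extChartAt I p).source) :
    chartEnergy F p (tangentChart I p ξ).1 (tangentChart I p ξ).2 = F ξ ^ 2 / 2 := by
  rw [chartEnergy, Prod.mk.eta, (tangentChart I p).left_inv (mem_tangentChart_source.2 hξ)]

theorem chartEnergy_eq (F : TangentBundle I M → ℝ) {p : M} {y w : E}
    (hy : y ∈ (extChartAt I p).target) :
    chartEnergy F p y w = F ⟨(extChartAt I p).symm y,
      tangentCoordChange I p ((extChartAt I p).symm y) ((extChartAt I p).symm y) w⟩ ^ 2 / 2 := by
  have h1 := tangentChart_symm_apply (I := I) (w := w) hy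
  rw [← h1]
  rfl

theorem chartEnergy_self (F : TangentBundle I M → ℝ) (x : M) (w : E) :
    chartEnergy F x (extChartAt I x x) w = F ⟨x, w⟩ ^ 2 / 2 := by
  have := chartEnergy_tangentChart F (p := x) (ξ := ⟨x, w⟩) (mem_extChartAt_source x)
  rwa [tangentChart_self (⟨x, w⟩ : TangentBundle I M)] at this

/-- Over the centre of a chart the chart energy is F²/2 on the fibre itself, so the fundamental
tensor is the vertical Hessian. -/
theorem isGeodesicAcceleration_iff (F : TangentBundle I M → ℝ) (ξ : TangentBundle I M) (a : E) :
    IsGeodesicAcceleration F ξ a ↔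
      EulerLagrange (range I) (chartEnergy F ξ.1) (extChartAt I ξ.1 ξ.1) ξ.2 a := by
  unfold IsGeodesicAcceleration EulerLagrange fundamentalTensor
  simp only [chartEnergy_self]

theorem isCoordEnergy_chartEnergy {F : TangentBundle I M → ℝ} (hF : IsFinslerMetric F) (p : M) :
    IsCoordEnergy (range I) (extChartAt I p).target (chartEnergy F p) where
  uniqueDiffOn := I.uniqueDiffOn
  subset := extChartAt_target_subset_range p
  mem_nhdsWithin y hy := extChartAt_target_mem_nhdsWithin_of_mem hy
  smooth := by
    have h1 : ContMDiffOn 𝓘(ℝ, E × E) I.tangent ∞ (tangentChart I p).symm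
        (tangentChart I p).target := contMDiffOn_extChartAt_symm _
    have h2 : ContMDiffOn 𝓘(ℝ, E × E) 𝓘(ℝ, ℝ) ∞ (F ∘ (tangentChart I p).symm)
        ((extChartAt I p).target ×ˢ {0}ᶜ) := by
      refine hF.smooth.comp (h1.mono ?_) ?_
      · rw [tangentChart_target]
        exact prod_mono le_rfl (subset_univ _)
      · rintro ⟨y, w⟩ ⟨hy, hw⟩
        have hy' : y ∈ (extChartAt I p).target := hy
        rw [mem_preimage, tangentChart_symm_apply hy']
        exact tangentCoordChange_ne_zero ((extChartAt I p).map_target hy')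
          (mem_extChartAt_source _) hw
    exact ((contMDiffOn_iff_contDiffOn.1 h2).pow 2).div_const 2
  homogeneous y hy c w hc := by
    rw [chartEnergy_eq F hy, chartEnergy_eq F hy, map_smul]
    exact (congrArg (fun s : ℝ => s ^ 2 / 2) (hF.homogeneous ((extChartAt I p).symm y)
      (tangentCoordChange I p ((extChartAt I p).symm y) ((extChartAt I p).symm y) w) c hc)).trans
      (by ring)
  nonneg y hy w := by unfold chartEnergy; positivity

/-- On the fibre over x the chart at p differs from the chart at x by an injective linear map B, so
the Hessian at w is the pullback by B of the fundamental tensor at Bw. -/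
theorem isCoordFinsler_chartEnergy {F : TangentBundle I M → ℝ} (hF : IsFinslerMetric F) (p : M) :
    IsCoordFinsler (range I) (extChartAt I p).target (chartEnergy F p) where
  toIsCoordEnergy := isCoordEnergy_chartEnergy hF p
  posDef y hy w u hw hu := by
    set x := (extChartAt I p).symm y with hx
    have hxs : x ∈ (extChartAt I p).source := (extChartAt I p).map_target hy
    set B : E →L[ℝ] E := tangentCoordChange I p x x with hB
    set G : E → ℝ := fun w => F ⟨x, w⟩ ^ 2 / 2 with hG
    have hB0 : ∀ w : E, w ≠ 0 → B w ≠ 0 := fun w hw =>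
      tangentCoordChange_ne_zero hxs (mem_extChartAt_source x) hw
    have hE := isCoordEnergy_chartEnergy hF x
    have hGe : chartEnergy F x (extChartAt I x x) = G := funext fun w => chartEnergy_self F x w
    have hxt : extChartAt I x x ∈ (extChartAt I x).target := mem_extChartAt_target x
    have hGd : ∀ w : E, w ≠ 0 → HasFDerivAt G (fderiv ℝ G w) w := fun w hw => by
      have := hE.hasFDerivAt_momentum (q := (extChartAt I x x, w)) ⟨hxt, hw⟩
      rw [hGe] at this
      exact this.differentiableAt.hasFDerivAt
    have hGd2 : ∀ w : E, w ≠ 0 → DifferentiableAt ℝ (fderiv ℝ G) w := fun w hw => by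
      have := (hE.hasFDerivAt_momentum_right (q := (extChartAt I x x, w))
        ⟨hxt, hw⟩).differentiableAt
      simpa only [momentum, hGe] using this
    have hL : (fun w => chartEnergy F p y w) = fun w => G (B w) :=
      funext fun w => chartEnergy_eq F hy
    have h1 : ∀ w : E, w ≠ 0 → fderiv ℝ (fun w => G (B w)) w u = fderiv ℝ G (B w) (B u) :=
      fun w hw => by
        have h0 : HasFDerivAt (fun w => G (B w)) ((fderiv ℝ G (B w)).comp B) w :=
          (hGd _ (hB0 w hw)).comp w B.hasFDerivAt
        rw [h0.fderiv]
        rfl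
    rw [hL]
    have h2 : (fun w' => fderiv ℝ (fun w => G (B w)) w' u)
        =ᶠ[𝓝 w] fun w' => fderiv ℝ G (B w') (B u) := by
      filter_upwards [isOpen_compl_singleton.mem_nhds hw] with w' hw' using h1 w' hw'
    have h3 : HasFDerivAt (fun w' => fderiv ℝ G w' (B u))
        (fderiv ℝ (fun w' => fderiv ℝ G w' (B u)) (B w)) (B w) :=
      ((hGd2 _ (hB0 w hw)).clm_apply (differentiableAt_const _)).hasFDerivAt
    have h4 : HasFDerivAt (fun w' => fderiv ℝ G (B w') (B u))
        ((fderiv ℝ (fun w' => fderiv ℝ G w' (B u)) (B w)).comp B) w := h3.comp w B.hasFDerivAt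
    rw [h2.fderiv_eq, h4.fderiv]
    exact hF.strongly_convex ⟨x, B w⟩ (B u) (hB0 w hw) (hB0 u hu)

theorem fderivWithin_transition {p q : M} {y : E} (hy : y ∈ (extChartAt I p).target) :
    fderivWithin ℝ (extChartAt I q ∘ (extChartAt I p).symm) (range I) y
      = tangentCoordChange I p q ((extChartAt I p).symm y) := by
  rw [tangentCoordChange_def, (extChartAt I p).right_inv hy]

theorem contDiffOn_transition (p q : M) :
    ContDiffOn ℝ ∞ (extChartAt I q ∘ (extChartAt I p).symm)
      ((extChartAt I p).target ∩ (extChartAt I p).symm ⁻¹' (extChartAt I q).source) := by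
  have := contDiffOn_ext_coord_change (n := ∞) (I := I) q p
  rwa [PartialEquiv.trans_source, PartialEquiv.symm_source] at this

omit [IsManifold I ∞ M] in
theorem transition_domain_mem_nhdsWithin {p q : M} {y : E}
    (hy : y ∈ (extChartAt I p).target ∩ (extChartAt I p).symm ⁻¹' (extChartAt I q).source) :
    (extChartAt I p).target ∩ (extChartAt I p).symm ⁻¹' (extChartAt I q).source
      ∈ 𝓝[range I] y :=
  Filter.inter_mem (extChartAt_target_mem_nhdsWithin_of_mem hy.1)
    (nhdsWithin_le_nhds ((continuousAt_extChartAt_symm'' hy.1).preimage_mem_nhds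
      ((isOpen_extChartAt_source q).mem_nhds hy.2)))

/-- The coordinate change of `T(TM)`, in terms of the coordinate change of `M`. -/
theorem tangentCoordChange_tangent {p q : M} {ζ : TangentBundle I M}
    (hp : ζ.1 ∈ (extChartAt I p).source) (hq : ζ.1 ∈ (extChartAt I q).source) (u b : E) :
    tangentCoordChange I.tangent (⟨p, 0⟩ : TangentBundle I M) ⟨q, 0⟩ ζ (u, b)
      = (fderivWithin ℝ (extChartAt I q ∘ (extChartAt I p).symm) (range I) (extChartAt I p ζ.1) u,
        fderivWithin ℝ (fderivWithin ℝ (extChartAt I q ∘ (extChartAt I p).symm) (range I))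
          (range I) (extChartAt I p ζ.1) u (tangentChart I p ζ).2
        + fderivWithin ℝ (extChartAt I q ∘ (extChartAt I p).symm) (range I)
          (extChartAt I p ζ.1) b) := by
  set φ := extChartAt I q ∘ (extChartAt I p).symm with hφ
  set O := (extChartAt I p).target ∩ (extChartAt I p).symm ⁻¹' (extChartAt I q).source with hO
  set y := extChartAt I p ζ.1 with hy
  set w := (tangentChart I p ζ).2 with hw
  have hζ : tangentChart I p ζ = (y, w) := rfl
  have hyO : y ∈ O := ⟨(extChartAt I p).map_source hp, by
    rw [mem_preimage, (extChartAt I p).left_inv hp]; exact hq⟩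
  have hR : UniqueDiffOn ℝ (range I) := I.uniqueDiffOn
  have hyR : y ∈ range I := extChartAt_target_subset_range p hyO.1
  have hφy : ContDiffWithinAt ℝ ∞ φ (range I) y :=
    (contDiffOn_transition p q y hyO).mono_of_mem_nhdsWithin
      (transition_domain_mem_nhdsWithin hyO)
  have d1 : HasFDerivWithinAt φ (fderivWithin ℝ φ (range I) y) (range I) y :=
    (hφy.differentiableWithinAt (by simp)).hasFDerivWithinAt
  have d2 : HasFDerivWithinAt (fderivWithin ℝ φ (range I))
      (fderivWithin ℝ (fderivWithin ℝ φ (range I)) (range I) y) (range I) y :=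
    ((hφy.fderivWithin_right (m := ∞) hR (by simp) hyR).differentiableWithinAt
      (by simp)).hasFDerivWithinAt
  have e1 : HasFDerivWithinAt (fun z : E × E => φ z.1) _ (range I ×ˢ univ) (y, w) :=
    HasFDerivWithinAt.comp (g := φ) (t := range I) (y, w) d1 hasFDerivWithinAt_fst
      (fun _ hz => hz.1)
  have e2 : HasFDerivWithinAt (fun z : E × E => fderivWithin ℝ φ (range I) z.1) _
      (range I ×ˢ univ) (y, w) :=
    HasFDerivWithinAt.comp (g := fderivWithin ℝ φ (range I)) (t := range I) (y, w) d2
      hasFDerivWithinAt_fst (fun _ hz => hz.1)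
  have e3 : HasFDerivWithinAt (fun z : E × E => (φ z.1, fderivWithin ℝ φ (range I) z.1 z.2)) _
      (range I ×ˢ univ) (y, w) := e1.prodMk (e2.clm_apply hasFDerivWithinAt_snd)
  have hnhds : O ×ˢ univ ∈ 𝓝[range I ×ˢ univ] ((y, w) : E × E) := by
    rw [nhdsWithin_prod_eq]
    exact Filter.prod_mem_prod (transition_domain_mem_nhdsWithin hyO) self_mem_nhdsWithin
  -- Near the point the transition map of TM is the tangent map (φ, Dφ) of the transition φ of M.
  -- Differentiating it produces the term with D²φ.
  have heq : ∀ z ∈ O ×ˢ (univ : Set E), (tangentChart I q ∘ (tangentChart I p).symm) z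
      = (φ z.1, fderivWithin ℝ φ (range I) z.1 z.2) := by
    rintro ⟨y', w'⟩ ⟨hy', -⟩
    have hy1 : y' ∈ (extChartAt I p).target := hy'.1
    have hx := (extChartAt I p).map_target hy1
    rw [Function.comp_apply, tangentChart_symm_apply hy1, tangentChart_apply, hφ,
      fderivWithin_transition hy1]
    refine Prod.ext rfl ?_
    exact tangentCoordChange_comp ⟨⟨hx, mem_extChartAt_source _⟩, hy'.2⟩
  have e4 := e3.congr_of_eventuallyEq
    (f₁ := tangentChart I q ∘ (tangentChart I p).symm)
    (Filter.eventually_of_mem hnhds heq) (heq _ ⟨hyO, mem_univ _⟩)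
  have hrange : range I.tangent = range I ×ˢ (univ : Set E) := by
    rw [ModelWithCorners.range_prod, modelWithCornersSelf_coe, range_id]
  have e5 : tangentCoordChange I.tangent (⟨p, 0⟩ : TangentBundle I M) ⟨q, 0⟩ ζ
      = fderivWithin ℝ (tangentChart I q ∘ (tangentChart I p).symm) (range I ×ˢ univ) (y, w) := by
    rw [tangentCoordChange_def, hrange]
    rfl
  rw [e5, e4.fderivWithin ((hR.prod uniqueDiffOn_univ) _ ⟨hyR, mem_univ _⟩)]
  simp [add_comm]

end TangentCharts

/-! ### Geodesics as solutions of an ODE in one fixed chart. -/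

section GeodesicsInCharts

variable {E : Type*} [NormedAddCommGroup E] [NormedSpace ℝ E]
  {H : Type*} [TopologicalSpace H] {I : ModelWithCorners ℝ E H}
  {M : Type*} [TopologicalSpace M] [ChartedSpace H M] [IsManifold I ∞ M]
  {F : TangentBundle I M → ℝ}

theorem tangentChart_snd {p q : M} {ζ : TangentBundle I M}
    (hp : ζ.1 ∈ (extChartAt I p).source) (hq : ζ.1 ∈ (extChartAt I q).source) :
    (tangentChart I q ζ).2 = tangentCoordChange I p q ζ.1 (tangentChart I p ζ).2 :=
  (tangentCoordChange_comp (E := E) (I := I) (w := ζ.1) (x := p) (y := q) (z := ζ.1)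
    ⟨⟨mem_extChartAt_source _, hp⟩, hq⟩).symm

theorem tangentChart_snd_ne_zero {p : M} {ζ : TangentBundle I M}
    (hp : ζ.1 ∈ (extChartAt I p).source) (hζ : ζ.2 ≠ 0) : (tangentChart I p ζ).2 ≠ 0 :=
  tangentCoordChange_ne_zero (E := E) (mem_extChartAt_source _) hp hζ

theorem tangentChart_fst_mem {p : M} {ζ : TangentBundle I M}
    (hp : ζ.1 ∈ (extChartAt I p).source) : (tangentChart I p ζ).1 ∈ (extChartAt I p).target :=
  (extChartAt I p).map_source hp

/-- The Euler-Lagrange equation of the energy does not depend on the chart. -/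
theorem eulerLagrange_changeChart (hF : IsFinslerMetric F) {p q : M} {ζ : TangentBundle I M}
    (hp : ζ.1 ∈ (extChartAt I p).source) (hq : ζ.1 ∈ (extChartAt I q).source) (hζ : ζ.2 ≠ 0)
    {a a' : E}
    (h : tangentCoordChange I.tangent (⟨p, 0⟩ : TangentBundle I M) ⟨q, 0⟩ ζ
      ((tangentChart I p ζ).2, a) = ((tangentChart I q ζ).2, a'))
    (hEL : EulerLagrange (range I) (chartEnergy F q) (tangentChart I q ζ).1
      (tangentChart I q ζ).2 a') :
    EulerLagrange (range I) (chartEnergy F p) (tangentChart I p ζ).1 (tangentChart I p ζ).2 a := by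
  rw [tangentCoordChange_tangent hp hq, Prod.mk.injEq] at h
  have h1 := isCoordEnergy_chartEnergy hF p
  have h2 := isCoordEnergy_chartEnergy hF q
  have hy : (tangentChart I p ζ).1 ∈ (extChartAt I p).target ∩
      (extChartAt I p).symm ⁻¹' (extChartAt I q).source :=
    ⟨tangentChart_fst_mem hp, by
      have := (extChartAt I p).left_inv hp
      rw [mem_preimage, tangentChart_apply, this]; exact hq⟩
  refine EulerLagrange.of_coordChange h1 h2 I.range_subset_closure_interior inter_subset_left
    (fun y hy => transition_domain_mem_nhdsWithin hy) (contDiffOn_transition p q)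
    (fun y hy => (extChartAt I q).map_source hy.2) (fun y hy w hw => ?_) (fun y hy w => ?_) hy
    (tangentChart_snd_ne_zero hp hζ) ?_
  · rw [fderivWithin_transition hy.1]
    exact tangentCoordChange_ne_zero ((extChartAt I p).map_target hy.1) hy.2 hw
  · have hx := (extChartAt I p).map_target hy.1
    have e1 : tangentChart I q ((tangentChart I p).symm (y, w))
        = (extChartAt I q ((extChartAt I p).symm y),
          tangentCoordChange I p q ((extChartAt I p).symm y) w) := by
      rw [tangentChart_symm_apply hy.1, tangentChart_apply]
      exact Prod.ext rfl (tangentCoordChange_comp ⟨⟨hx, mem_extChartAt_source _⟩, hy.2⟩)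
    have e2 := chartEnergy_tangentChart F (p := q) (ξ := (tangentChart I p).symm (y, w)) (by
      rw [tangentChart_symm_apply hy.1]; exact hy.2)
    rw [e1] at e2
    rw [fderivWithin_transition hy.1]
    exact e2.symm
  · have e1 : (extChartAt I q ∘ (extChartAt I p).symm) (tangentChart I p ζ).1
        = (tangentChart I q ζ).1 := by
      rw [Function.comp_apply, tangentChart_apply, tangentChart_apply,
        (extChartAt I p).left_inv hp]
    rw [e1]
    have e3 : (tangentChart I p ζ).1 = extChartAt I p ζ.1 := rfl
    rw [e3, h.1, h.2]
    exact hEL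

variable [FiniteDimensional ℝ E]

/-- The geodesic spray in the chart at `p`. -/
abbrev chartSpray (F : TangentBundle I M → ℝ) (p : M) : E × E → E :=
  spray (extChartAt I p).target (chartEnergy F p)

/-- The definition of a geodesic uses a different chart at each time, the one at η t. Invariance of
the Euler-Lagrange equation turns it into the spray equation in any chart containing the point. -/
theorem IsGeodesicOn.hasDerivWithinAt_tangentChart (hF : IsFinslerMetric F)
    {η : ℝ → TangentBundle I M} {s : Set ℝ} (hη : IsGeodesicOn F η s) {t : ℝ} (ht : t ∈ s) {q : M}
    (hq : (η t).1 ∈ (extChartAt I q).source) :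
    HasDerivWithinAt (tangentChart I q ∘ η)
      ((tangentChart I q (η t)).2, chartSpray F q (tangentChart I q (η t))) s t := by
  obtain ⟨hv, a, ha, hd⟩ := hη t ht
  have hp := mem_extChartAt_source (I := I) (η t).1
  have hd' := hasDerivWithinAt_of_hasMFDerivWithinAt hd (mem_tangentChart_source.2 hq)
  set p := (η t).1 with hp_def
  set A' := tangentCoordChange I.tangent (⟨p, 0⟩ : TangentBundle I M) ⟨q, 0⟩ (η t)
    ((tangentChart I p (η t)).2, a) with hA'
  have hself : (tangentChart I p (η t)).2 = (η t).2 := by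
    rw [hp_def, tangentChart_self]
  have h1 : HasDerivWithinAt (tangentChart I q ∘ η) A' s t := by
    rw [hA', hself]
    have e0 : ((1 : ℝ →L[ℝ] ℝ).smulRight (((η t).2, a) : E × E) : ℝ →L[ℝ] E × E) 1
      = ((η t).2, a) := one_smul ℝ (((η t).2, a) : E × E)
    have e1 : HasDerivWithinAt (tangentChart I q ∘ η)
      (tangentCoordChange I.tangent (⟨p, 0⟩ : TangentBundle I M) ⟨q, 0⟩ (η t)
        (((1 : ℝ →L[ℝ] ℝ).smulRight (((η t).2, a) : E × E) : ℝ →L[ℝ] E × E) 1)) s t := hd'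
    rwa [e0] at e1
  -- The position part of the coordinate change of T(TM) transforms velocities like TM does, so only
  -- the acceleration is left to identify.
  have h2 : A' = ((tangentChart I q (η t)).2, A'.2) := by
    refine Prod.ext ?_ rfl
    rw [hA', tangentCoordChange_tangent hp hq, tangentChart_snd hp hq]
    rfl
  rw [h2] at h1
  have h3 : tangentCoordChange I.tangent (⟨q, 0⟩ : TangentBundle I M) ⟨p, 0⟩ (η t)
      ((tangentChart I q (η t)).2, A'.2) = ((tangentChart I p (η t)).2, a) := by
    rw [← h2, hA', tangentCoordChange_comp ⟨⟨mem_tangentChart_source.2 hp,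
      mem_tangentChart_source.2 hq⟩, mem_tangentChart_source.2 hp⟩,
      tangentCoordChange_self (mem_tangentChart_source.2 hp)]
  have h4 : EulerLagrange (range I) (chartEnergy F p) (tangentChart I p (η t)).1
      (tangentChart I p (η t)).2 a := by
    rw [hself]
    exact (isGeodesicAcceleration_iff F (η t) a).1 ha
  have h5 := eulerLagrange_changeChart hF hq hp hv h3 h4
  rw [(isCoordFinsler_chartEnergy hF q).eulerLagrange_iff_eq_spray (tangentChart_fst_mem hq)
    (tangentChart_snd_ne_zero hq hv)] at h5
  rw [h5] at h1
  exact h1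

theorem isGeodesicOn_of_hasDerivWithinAt_tangentChart (hF : IsFinslerMetric F)
    {η : ℝ → TangentBundle I M} {s : Set ℝ} (hη : ContinuousOn η s)
    (hv : ∀ t ∈ s, (η t).2 ≠ 0) {q : M} (hq : ∀ t ∈ s, (η t).1 ∈ (extChartAt I q).source)
    (hd : ∀ t ∈ s, HasDerivWithinAt (tangentChart I q ∘ η)
      ((tangentChart I q (η t)).2, chartSpray F q (tangentChart I q (η t))) s t) :
    IsGeodesicOn F η s := by
  intro t ht
  have hp := mem_extChartAt_source (I := I) (η t).1
  replace hq := hq t ht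
  have hd' := hasMFDerivWithinAt_of_hasDerivWithinAt (hη t ht) (mem_tangentChart_source.2 hq)
    (hd t ht)
  set p := (η t).1 with hp_def
  set A' := tangentCoordChange I.tangent (⟨q, 0⟩ : TangentBundle I M) ⟨p, 0⟩ (η t)
    ((tangentChart I q (η t)).2, chartSpray F q (tangentChart I q (η t))) with hA'
  have hself : (tangentChart I p (η t)).2 = (η t).2 := by
    rw [hp_def, tangentChart_self]
  have h2 : A' = ((tangentChart I p (η t)).2, A'.2) := by
    refine Prod.ext ?_ rfl
    rw [hA', tangentCoordChange_tangent hq hp, tangentChart_snd hq hp]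
    rfl
  have h3 : tangentCoordChange I.tangent (⟨p, 0⟩ : TangentBundle I M) ⟨q, 0⟩ (η t)
      ((tangentChart I p (η t)).2, A'.2)
      = ((tangentChart I q (η t)).2, chartSpray F q (tangentChart I q (η t))) := by
    rw [← h2, hA', tangentCoordChange_comp ⟨⟨mem_tangentChart_source.2 hq,
      mem_tangentChart_source.2 hp⟩, mem_tangentChart_source.2 hq⟩,
      tangentCoordChange_self (mem_tangentChart_source.2 hq)]
  have h4 := eulerLagrange_changeChart hF hp hq (hv t ht) h3
    ((isCoordFinsler_chartEnergy hF q).eulerLagrange_spray (tangentChart_fst_mem hq)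
      (tangentChart_snd_ne_zero hq (hv t ht)))
  refine ⟨hv t ht, A'.2, (isGeodesicAcceleration_iff F (η t) _).2 ?_, ?_⟩
  · rw [hself] at h4
    exact h4
  · have h5 : (((η t).2, A'.2) : E × E) = A' := by rw [h2, hself]
    have h6 : ((1 : ℝ →L[ℝ] ℝ).smulRight (((η t).2, A'.2) : E × E) : ℝ →L[ℝ] E × E)
      = (1 : ℝ →L[ℝ] ℝ).smulRight A' := by rw [h5]
    exact h6 ▸ hd'

end GeodesicsInCharts

/-! ### Functions vanishing on the boundary of a half-space. -/

section HalfSpaceCalculus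

variable {E : Type*} [NormedAddCommGroup E] [NormedSpace ℝ E] {R : Set E} {ℓ : E →L[ℝ] ℝ}
  {ρ : E → E}

theorem IsHalfSpace.interior_eq [CompleteSpace E] (hR : IsHalfSpace R ℓ ρ) (hℓ : ℓ ≠ 0) :
    interior R = {y | 0 < ℓ y} := by
  have hsurj : Function.Surjective ℓ := (ℓ : E →ₗ[ℝ] ℝ).surjective fun h0 =>
    hℓ (ContinuousLinearMap.coe_injective h0)
  have h1 : R = ℓ ⁻¹' Ici 0 := by ext y; exact hR.mem_iff y
  rw [h1, ← (ℓ.isOpenMap hsurj).preimage_interior_eq_interior_preimage ℓ.continuous, interior_Ici]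
  rfl

/-- The line y₀ + sw stays in the boundary hyperplane for s of both signs, and g vanishes along it
near s = 0. -/
theorem IsHalfSpace.fderivWithin_apply_eq_zero (hR : IsHalfSpace R ℓ ρ)
    {g : E → ℝ} {y₀ : E} (hy₀ : ℓ y₀ = 0) (hg : DifferentiableWithinAt ℝ g R y₀)
    (hg0 : ∀ᶠ y in 𝓝[R] y₀, ℓ y = 0 → g y = 0) {w : E} (hw : ℓ w = 0) :
    fderivWithin ℝ g R y₀ w = 0 := by
  have hline : ∀ s : ℝ, y₀ + s • w ∈ R := fun s => (hR.mem_iff _).2 (by simp [hy₀, hw])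
  have hlim : Filter.Tendsto (fun s : ℝ => y₀ + s • w) (𝓝 0) (𝓝[R] y₀) :=
    tendsto_nhdsWithin_iff.2 ⟨by
      have : Continuous fun s : ℝ => y₀ + s • w := by fun_prop
      simpa using this.tendsto 0, Filter.Eventually.of_forall hline⟩
  have hlined : HasDerivAt (fun s : ℝ => y₀ + s • w) w 0 := by
    simpa using ((hasDerivAt_id (0 : ℝ)).smul_const w).const_add y₀
  have e1 : ∀ᶠ s in 𝓝 (0 : ℝ), g (y₀ + s • w) = 0 := by
    filter_upwards [hlim.eventually hg0] with s hs using hs (by simp [hy₀, hw])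
  have hd : HasFDerivWithinAt g (fderivWithin ℝ g R y₀) R (y₀ + (0 : ℝ) • w) := by
    simpa using hg.hasFDerivWithinAt
  have e2 : HasDerivAt (fun s : ℝ => g (y₀ + s • w)) (fderivWithin ℝ g R y₀ w) 0 :=
    hasDerivWithinAt_univ.1 (hd.comp_hasDerivWithinAt (0 : ℝ) hlined.hasDerivWithinAt
      fun s' _ => hline s')
  exact e2.unique ((hasDerivAt_const (0 : ℝ) (0 : ℝ)).congr_of_eventuallyEq e1)

/-- A function vanishing on the boundary of a half space and nonnegative inside: if its second
derivative along a curve tangent to the boundary is negative, then the curve accelerates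
outwards. -/
theorem IsHalfSpace.apply_neg_of_secondDeriv_neg (hR : IsHalfSpace R ℓ ρ) (hℓ : ℓ ≠ 0)
    (hRd : UniqueDiffOn ℝ R) {g : E → ℝ} {y₀ : E} (hy₀ : ℓ y₀ = 0)
    (hg : ∀ᶠ y in 𝓝[R] y₀, ContDiffWithinAt ℝ 2 g R y)
    (hg0 : ∀ᶠ y in 𝓝[R] y₀, ℓ y = 0 → g y = 0) (hg1 : ∀ᶠ y in 𝓝[R] y₀, 0 ≤ g y)
    {w a : E} (hw : ℓ w = 0)
    (h : iteratedFDerivWithin ℝ 2 g R y₀ ![w, w] + fderivWithin ℝ g R y₀ a < 0) : ℓ a < 0 := by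
  have hy₀R : y₀ ∈ R := (hR.mem_iff _).2 hy₀.ge
  have hd : ∀ᶠ y in 𝓝[R] y₀, HasFDerivWithinAt g (fderivWithin ℝ g R y) R y := by
    filter_upwards [hg] with y hy
    exact (hy.differentiableWithinAt (by simp)).hasFDerivWithinAt
  have hd0 := hd.self_of_nhdsWithin hy₀R
  have h0 : g y₀ = 0 := hg0.self_of_nhdsWithin hy₀R hy₀
  have hd2 : HasFDerivWithinAt (fderivWithin ℝ g R) (fderivWithin ℝ (fderivWithin ℝ g R) R y₀)
      R y₀ :=
    (((hg.self_of_nhdsWithin hy₀R).fderivWithin_right (m := 1) hRd (by norm_num)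
      hy₀R).differentiableWithinAt (by simp)).hasFDerivWithinAt
  have hline : ∀ {u : E}, ℓ u = 0 → ∀ s : ℝ, y₀ + s • u ∈ R := fun hu s =>
    (hR.mem_iff _).2 (by simp [hy₀, hu])
  have hlim : ∀ {u : E}, ℓ u = 0 → Filter.Tendsto (fun s : ℝ => y₀ + s • u) (𝓝 0) (𝓝[R] y₀) :=
    fun {u} hu => tendsto_nhdsWithin_iff.2 ⟨by
      have : Continuous fun s : ℝ => y₀ + s • u := by fun_prop
      simpa using this.tendsto 0, Filter.Eventually.of_forall (hline hu)⟩
  have hlined : ∀ (u : E) (s : ℝ), HasDerivAt (fun s : ℝ => y₀ + s • u) u s := fun u s => by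
    simpa using ((hasDerivAt_id s).smul_const u).const_add y₀
  have hDg : ∀ {u : E}, ℓ u = 0 → ∀ᶠ s in 𝓝 (0 : ℝ), fderivWithin ℝ g R (y₀ + s • u) u = 0 := by
    intro u hu
    filter_upwards [(hlim hu).eventually (eventually_eventually_nhdsWithin.2 hg0),
      (hlim hu).eventually hd] with s hs hds
    exact hR.fderivWithin_apply_eq_zero (by simp [hy₀, hu]) hds.differentiableWithinAt hs hu
  have hker : ∀ u, ℓ u = 0 → fderivWithin ℝ g R y₀ u = 0 := fun u hu => by
    simpa using (hDg hu).self_of_nhds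
  -- By `hDg`, Dg(y₀ + sw) w = 0 for all small s; differentiate at s = 0.
  have hsecond : iteratedFDerivWithin ℝ 2 g R y₀ ![w, w] = 0 := by
    rw [iteratedFDerivWithin_two_apply g hRd hy₀R]
    have hd2' : HasFDerivWithinAt (fderivWithin ℝ g R) (fderivWithin ℝ (fderivWithin ℝ g R) R y₀)
      R (y₀ + (0 : ℝ) • w) := by simpa using hd2
    have e1 : HasDerivAt (fun s : ℝ => fderivWithin ℝ g R (y₀ + s • w))
        (fderivWithin ℝ (fderivWithin ℝ g R) R y₀ w) 0 :=
      hasDerivWithinAt_univ.1 (hd2'.comp_hasDerivWithinAt (0 : ℝ) (hlined w 0).hasDerivWithinAt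
        fun s' _ => hline hw s')
    have e2 := e1.clm_apply (hasDerivAt_const (0 : ℝ) w)
    have e3 := e2.unique ((hasDerivAt_const (0 : ℝ) (0 : ℝ)).congr_of_eventuallyEq (hDg hw))
    simpa using e3
  rw [hsecond, zero_add] at h
  obtain ⟨e, he⟩ : ∃ e, ℓ e = 1 := by
    obtain ⟨u, hu⟩ := ContinuousLinearMap.exists_ne_zero hℓ
    exact ⟨(ℓ u)⁻¹ • u, by simp [hu]⟩
  -- Since Dg vanishes on ker ℓ, it equals λℓ with λ = Dg(e), and λ ≥ 0 because g has a local
  -- minimum over R at y₀ and e points inwards.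
  have he0 : 0 ≤ fderivWithin ℝ g R y₀ e := by
    have hmin : IsLocalMinOn g R y₀ := by
      filter_upwards [hg1] with y hy
      rwa [h0]
    refine hmin.hasFDerivWithinAt_nonneg hd0 (mem_posTangentConeAt_of_frequently_mem ?_)
    have hev : ∀ᶠ t : ℝ in 𝓝[>] 0, y₀ + t • e ∈ R := by
      filter_upwards [self_mem_nhdsWithin] with t ht
      exact (hR.mem_iff _).2 (by simpa [hy₀, he] using le_of_lt ht)
    exact hev.frequently
  have h1 : fderivWithin ℝ g R y₀ a = ℓ a * fderivWithin ℝ g R y₀ e := by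
    have := hker (a - ℓ a • e) (by simp [he])
    rw [map_sub, map_smul, smul_eq_mul, sub_eq_zero] at this
    exact this
  rw [h1] at h
  by_contra hcon
  exact absurd h (not_lt.2 (mul_nonneg (not_lt.1 hcon) he0))

end HalfSpaceCalculus

/-! ### The boundary and its strict convexity in a chart. -/

section Boundary

variable {E : Type*} [NormedAddCommGroup E] [NormedSpace ℝ E]
  {H : Type*} [TopologicalSpace H] {I : ModelWithCorners ℝ E H}
  {M : Type*} [TopologicalSpace M] [ChartedSpace H M] [IsManifold I ∞ M] [FiniteDimensional ℝ E]
  {ℓ : E →L[ℝ] ℝ} {ρ : E → E}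

/-- Being an interior point can be tested in any chart, not only in the preferred one at x. The
target is relatively open in the range, so its interior and that of the half-space agree at the
point. -/
theorem mem_boundary_iff_of_mem_source (hR : IsHalfSpace (range I) ℓ ρ) (hℓ : ℓ ≠ 0) {p x : M}
    (hx : x ∈ (extChartAt I p).source) : x ∈ I.boundary M ↔ ℓ (extChartAt I p x) = 0 := by
  have := FiniteDimensional.complete ℝ E
  have hxt := (extChartAt I p).map_source hx
  have h0 : 0 ≤ ℓ (extChartAt I p x) := (hR.mem_iff _).1 (extChartAt_target_subset_range p hxt)
  have h1 : I.IsInteriorPoint x ↔ extChartAt I p x ∈ interior (extChartAt I p).target :=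
    ModelWithCorners.isInteriorPoint_iff_of_mem_atlas (n := ∞) (by simp) (chart_mem_atlas H p)
      (by rwa [extChartAt_source] at hx)
  have h2 : extChartAt I p x ∈ interior (extChartAt I p).target
      ↔ extChartAt I p x ∈ interior (range I) := by
    refine ⟨fun h => interior_mono (extChartAt_target_subset_range p) h, fun h => ?_⟩
    rw [mem_interior_iff_mem_nhds] at h ⊢
    rw [← nhdsWithin_eq_nhds.2 h]
    exact extChartAt_target_mem_nhdsWithin_of_mem hxt
  rw [hR.interior_eq hℓ] at h2
  change I.IsBoundaryPoint x ↔ _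
  rw [I.isBoundaryPoint_iff_not_isInteriorPoint, h1, h2]
  simp only [mem_ofPred_eq, not_lt]
  exact ⟨fun h => le_antisymm h h0, fun h => h.le⟩

/-- Strict convexity freed from f: the half-space lemma is applied to f read in the chart, and the
spray is an acceleration allowed by the geodesic equation. -/
theorem HasStrictlyConvexBoundary.apply_chartSpray_neg {F : TangentBundle I M → ℝ}
    (hF : IsFinslerMetric F) (hc : HasStrictlyConvexBoundary F) (hR : IsHalfSpace (range I) ℓ ρ)
    (hℓ : ℓ ≠ 0) {p : M} (hp : p ∈ I.boundary M) {w : E} (hw0 : w ≠ 0) (hw : ℓ w = 0) :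
    ℓ (chartSpray F p (extChartAt I p p, w)) < 0 := by
  obtain ⟨N, f, hN, hbN, hf, hf0, hf1, hconv⟩ := hc
  have hps := mem_extChartAt_source (I := I) p
  have hpt := mem_extChartAt_target (I := I) p
  have hyR := extChartAt_target_subset_range p hpt
  have hy₀ : ℓ (extChartAt I p p) = 0 := (mem_boundary_iff_of_mem_source hR hℓ hps).1 hp
  set g : E → ℝ := f ∘ (extChartAt I p).symm with hgdef
  set V := (extChartAt I p).target ∩ (extChartAt I p).symm ⁻¹' N with hV
  have hVn : ∀ y ∈ V, V ∈ 𝓝[range I] y := fun y hy =>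
    Filter.inter_mem (extChartAt_target_mem_nhdsWithin_of_mem hy.1)
      (nhdsWithin_le_nhds ((continuousAt_extChartAt_symm'' hy.1).preimage_mem_nhds
        (hN.mem_nhds hy.2)))
  have hpV : extChartAt I p p ∈ V := ⟨hpt, by
    rw [mem_preimage, (extChartAt I p).left_inv hps]; exact hbN hp⟩
  have hgV : ContDiffOn ℝ ∞ g V := by
    have h1 : ContMDiffOn 𝓘(ℝ, E) 𝓘(ℝ, ℝ) ∞ g V :=
      hf.comp ((contMDiffOn_extChartAt_symm p).mono inter_subset_left) fun y hy => hy.2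
    exact contMDiffOn_iff_contDiffOn.1 h1
  have hg : ∀ y ∈ V, ContDiffWithinAt ℝ 2 g (range I) y := fun y hy =>
    (contDiffWithinAt_infty.1 (hgV y hy) 2).mono_of_mem_nhdsWithin (hVn y hy)
  have hgd : DifferentiableWithinAt ℝ g (range I) (extChartAt I p p) :=
    (hg _ hpV).differentiableWithinAt (by simp)
  have hbd : ∀ y ∈ V, (extChartAt I p).symm y ∈ I.boundary M ↔ ℓ y = 0 := fun y hy => by
    rw [mem_boundary_iff_of_mem_source hR hℓ ((extChartAt I p).map_target hy.1),
      (extChartAt I p).right_inv hy.1]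
  have hg0 : ∀ y ∈ V, ℓ y = 0 → g y = 0 := fun y hy h => (hf0 _ ((hbd y hy).2 h)).1
  have hg1 : ∀ y ∈ V, 0 ≤ g y := fun y hy => by
    by_cases hb : (extChartAt I p).symm y ∈ I.boundary M
    · exact (hf0 _ hb).1.ge
    · exact (hf1 _ ⟨hy.2, hb⟩).le
  have hmd : MDifferentiableAt I 𝓘(ℝ, ℝ) f p :=
    (hf.contMDiffAt (hN.mem_nhds (hbN hp))).mdifferentiableAt (by simp)
  have hmf : ∀ v : E, mfderiv I 𝓘(ℝ, ℝ) f p v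
      = fderivWithin ℝ g (range I) (extChartAt I p p) v := fun v => by
    rw [hmd.mfderiv]
    rfl
  have key := fun (a : E) => hR.apply_neg_of_secondDeriv_neg hℓ I.uniqueDiffOn (g := g) hy₀
    (Filter.eventually_of_mem (hVn _ hpV) hg) (Filter.eventually_of_mem (hVn _ hpV) hg0)
    (Filter.eventually_of_mem (hVn _ hpV) hg1) (w := w) (a := a) hw
  refine key _ (hconv p hp w hw0 ?_ _ ?_)
  · rw [hmf]
    exact hR.fderivWithin_apply_eq_zero hy₀ hgd
      (Filter.eventually_of_mem (hVn _ hpV) hg0) hw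
  · exact (isGeodesicAcceleration_iff F ⟨p, w⟩ _).2
      ((isCoordFinsler_chartEnergy hF p).eulerLagrange_spray hpt hw0)

end Boundary

/-! ### Exit trajectories are minimizing. -/

section ExitTrajectories

open ContinuousLinearMap (inl inr)

variable {E : Type*} [NormedAddCommGroup E] [NormedSpace ℝ E] [FiniteDimensional ℝ E]
  {R D : Set E} {L : E → E → ℝ} {ℓ : E →L[ℝ] ℝ} {ρ : E → E} {y₀ : E} {r : ℝ}

/-- A solution of the extended geodesic equation with initial position `y` and initial velocity
`w`, which leaves the half space `{0 ≤ ℓ}` at time `T`, and remains close to `(y₀, w)` until the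
later time `T₀`. -/
structure IsExitTrajectory (D : Set E) (L : E → E → ℝ) (ℓ : E →L[ℝ] ℝ) (ρ : E → E) (y₀ : E) (r : ℝ)
    (y w : E) (z : ℝ → E × E) (T T₀ : ℝ) : Prop where
  norm_eq : ‖w‖ = 1
  nonneg : 0 ≤ T
  lt : T < T₀
  zero : z 0 = (y, w)
  deriv : ∀ t ∈ Icc 0 T₀, HasDerivWithinAt z (extendedField D L ρ (z t)) (Icc 0 T₀) t
  mem : ∀ t, z t ∈ Metric.ball y₀ r ×ˢ Metric.ball w (1 / 2)
  exit : ℓ (z T).1 = 0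
  inside : ∀ t ∈ Icc 0 T, 0 ≤ ℓ (z t).1
  outside : ∀ t ∈ Ioc T T₀, ℓ (z t).1 < 0

namespace IsExitTrajectory

variable {y w : E} {z : ℝ → E × E} {T T₀ : ℝ} (tr : IsExitTrajectory D L ℓ ρ y₀ r y w z T T₀)
include tr

omit [FiniteDimensional ℝ E] in
theorem fst_mem (hR : IsHalfSpace R ℓ ρ) {t : ℝ} (ht : t ∈ Icc 0 T) :
    (z t).1 ∈ Metric.closedBall y₀ r ∩ R :=
  ⟨Metric.ball_subset_closedBall (tr.mem t).1, (hR.mem_iff _).2 (tr.inside t ht)⟩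

omit [FiniteDimensional ℝ E] in
theorem half_le_norm_snd (t : ℝ) : 1 / 2 ≤ ‖(z t).2‖ := by
  have h1 : ‖(z t).2 - w‖ < 1 / 2 := mem_ball_iff_norm.1 (tr.mem t).2
  have h2 := norm_sub_norm_le w (z t).2
  rw [norm_sub_rev, tr.norm_eq] at h2
  linarith

omit [FiniteDimensional ℝ E] in
theorem norm_snd_le_two (t : ℝ) : ‖(z t).2‖ ≤ 2 := by
  have h1 : ‖(z t).2 - w‖ < 1 / 2 := mem_ball_iff_norm.1 (tr.mem t).2
  have h2 := norm_sub_norm_le (z t).2 w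
  rw [tr.norm_eq] at h2
  linarith

omit [FiniteDimensional ℝ E] in
theorem snd_ne_zero (t : ℝ) : (z t).2 ≠ 0 := fun h0 => by
  have := tr.half_le_norm_snd t
  rw [h0, norm_zero] at this
  norm_num at this

omit [FiniteDimensional ℝ E] in
theorem hasDerivWithinAt (hR : IsHalfSpace R ℓ ρ) {t : ℝ} (ht : t ∈ Icc 0 T) :
    HasDerivWithinAt z ((z t).2, spray D L (z t)) (Icc 0 T) t := by
  have h1 := (tr.deriv t ⟨ht.1, ht.2.trans tr.lt.le⟩).mono (Icc_subset_Icc_right tr.lt.le)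
  rwa [extendedField, hR.eq_self _ (tr.fst_mem hR ht).2] at h1

/-- Conservation of energy. -/
theorem energy_eq (h : IsCoordFinsler R D L) (hR : IsHalfSpace R ℓ ρ)
    (hrD : Metric.closedBall y₀ r ∩ R ⊆ D) {t : ℝ} (ht : t ∈ Icc 0 T) :
    L (z t).1 (z t).2 = L y w := by
  have hmaps : MapsTo z (Icc 0 T) (D ×ˢ ({0}ᶜ : Set E)) := fun s hs =>
    ⟨hrD (tr.fst_mem hR hs), tr.snd_ne_zero s⟩
  have hd : ∀ s ∈ Icc 0 T, HasDerivWithinAt (Function.uncurry L ∘ z) 0 (Icc 0 T) s := fun s hs => by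
    have h1 := (h.hasFDerivWithinAt_uncurry (hmaps hs)).comp_hasDerivWithinAt s
      (tr.hasDerivWithinAt hR hs) hmaps
    rwa [h.fderivWithin_eq_zero_of_eulerLagrange (hmaps hs).1 (hmaps hs).2
      (h.eulerLagrange_spray (hmaps hs).1 (hmaps hs).2)] at h1
  have h2 := constant_of_derivWithin_zero (fun s hs => (hd s hs).differentiableWithinAt)
    (fun s hs => (hd s (Ico_subset_Icc_self hs)).derivWithin
      (uniqueDiffOn_Icc (hs.1.trans_lt hs.2) s (Ico_subset_Icc_self hs))) t ht
  simpa [Function.uncurry, tr.zero] using h2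

theorem hasDerivWithinAt_momentum (h : IsCoordFinsler R D L) (hR : IsHalfSpace R ℓ ρ)
    (hrD : Metric.closedBall y₀ r ∩ R ⊆ D) {t : ℝ} (ht : t ∈ Icc 0 T) :
    HasDerivWithinAt (fun t => momentum L ((z t).1, (z t).2))
      ((fderivWithin ℝ (Function.uncurry L) (D ×ˢ {0}ᶜ) ((z t).1, (z t).2)).comp (inl ℝ E E))
      (Icc 0 T) t := by
  have hmaps : MapsTo z (Icc 0 T) (D ×ˢ ({0}ᶜ : Set E)) := fun s hs =>
    ⟨hrD (tr.fst_mem hR hs), tr.snd_ne_zero s⟩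
  have h1 := (h.hasFDerivWithinAt_momentum (hmaps ht)).comp_hasDerivWithinAt t
    (tr.hasDerivWithinAt hR ht) hmaps
  have h2 := (h.eulerLagrange_iff (hmaps ht).1 (hmaps ht).2).1
    (h.eulerLagrange_spray (hmaps ht).1 (hmaps ht).2)
  rw [← h2]
  exact h1

end IsExitTrajectory

/-- By Euler's identity 2L(y, w) is the Hessian at w applied to (w, w), hence at least m‖w‖². So
length dominates √m times coordinate distance, which makes curves reaching the edge of the ball
long. -/
theorem IsCoordFinsler.exists_norm_sub_le_integral (h : IsCoordFinsler R D L) {K : Set E}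
    (hK : IsCompact K) (hKD : K ⊆ D) : ∃ m : ℝ, 0 < m ∧ ∀ (c c' : ℝ → E) (σ : ℝ → ℝ) (t₁ : ℝ),
      0 ≤ t₁ → (∀ t ∈ Icc 0 t₁, HasDerivWithinAt c (c' t) (Icc 0 t₁) t) →
      ContinuousOn c' (Icc 0 t₁) → (∀ t ∈ Icc 0 t₁, c t ∈ K) → ContinuousOn σ (Icc 0 t₁) →
      (∀ t ∈ Icc 0 t₁, 0 ≤ σ t) → (∀ t ∈ Icc 0 t₁, σ t ^ 2 = 2 * L (c t) (c' t)) →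
      m * ‖c t₁ - c 0‖ ≤ ∫ t in (0 : ℝ)..t₁, σ t := by
  have := FiniteDimensional.complete ℝ E
  obtain ⟨m, hm, hH⟩ := h.exists_verticalHessian_ge hK hKD
  have hL : ∀ y ∈ K, ∀ w, m * ‖w‖ ^ 2 ≤ 2 * L y w := fun y hy w => by
    by_cases hw : w = 0
    · subst hw; simp [h.energy_zero (hKD hy)]
    · rw [← h.verticalHessian_self (hKD hy) hw]; exact hH y hy w hw w
  refine ⟨√m, Real.sqrt_pos.2 hm, fun c c' σ t₁ ht₁ hc hc' hcK hσ hσ0 hσL => ?_⟩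
  have h1 : ∫ t in (0 : ℝ)..t₁, c' t = c t₁ - c 0 := by
    refine intervalIntegral.integral_eq_sub_of_hasDeriv_right_of_le ht₁
      (fun t ht => (hc t ht).continuousWithinAt) (fun t ht => ?_)
      (hc'.intervalIntegrable_of_Icc ht₁)
    exact ((hc t (Ioo_subset_Icc_self ht)).hasDerivAt
      (Icc_mem_nhds ht.1 ht.2)).hasDerivWithinAt
  have h2 : ‖c t₁ - c 0‖ ≤ ∫ t in (0 : ℝ)..t₁, ‖c' t‖ := by
    rw [← h1]; exact intervalIntegral.norm_integral_le_integral_norm ht₁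
  calc √m * ‖c t₁ - c 0‖ ≤ √m * ∫ t in (0 : ℝ)..t₁, ‖c' t‖ := by gcongr
    _ = ∫ t in (0 : ℝ)..t₁, √m * ‖c' t‖ := (intervalIntegral.integral_const_mul _ _).symm
    _ ≤ ∫ t in (0 : ℝ)..t₁, σ t := by
      refine intervalIntegral.integral_mono_on ht₁
        ((hc'.norm.const_smul (√m)).intervalIntegrable_of_Icc ht₁)
        (hσ.intervalIntegrable_of_Icc ht₁) fun t ht => ?_
      refine abs_le_of_sq_le_sq' ?_ (hσ0 t ht) |>.2
      rw [mul_pow, Real.sq_sqrt hm.le, hσL t ht]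
      exact hL _ (hcK t ht) _

/-- Near a strictly convex boundary point, the geodesics which do not point inwards leave the half
space, and before they do they are shorter than every curve in the given ball with the same
endpoints, and than every curve from their initial point to the boundary of this ball. -/
theorem IsCoordFinsler.exists_minimizing_exit (h : IsCoordFinsler R D L) (hR : IsHalfSpace R ℓ ρ)
    (hy₀ : ℓ y₀ = 0) (hconv : ∀ w, w ≠ 0 → ℓ w = 0 → ℓ (spray D L (y₀, w)) < 0) (hr : 0 < r)
    (hrD : Metric.closedBall y₀ r ∩ R ⊆ D) :
    ∃ r' > 0, r' < r ∧ ∀ y ∈ Metric.closedBall y₀ r' ∩ R, ∀ w, ‖w‖ = 1 → ℓ w ≤ 0 →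
      ∃ z T T₀, IsExitTrajectory D L ℓ ρ y₀ r y w z T T₀ ∧
        (∀ (c c' : ℝ → E) (σ : ℝ → ℝ),
          (∀ t ∈ Icc (0 : ℝ) 1, HasDerivWithinAt c (c' t) (Icc 0 1) t) →
          ContinuousOn c' (Icc 0 1) → (∀ t ∈ Icc (0 : ℝ) 1, c t ∈ Metric.closedBall y₀ r ∩ R) →
          c 0 = y → c 1 = (z T).1 → ContinuousOn σ (Icc 0 1) → (∀ t ∈ Icc (0 : ℝ) 1, 0 ≤ σ t) →
          (∀ t ∈ Icc (0 : ℝ) 1, σ t ^ 2 = 2 * L (c t) (c' t)) →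
          T * √(2 * L y w) ≤ ∫ t in (0 : ℝ)..1, σ t) ∧
        (∀ (c c' : ℝ → E) (σ : ℝ → ℝ) (t₁ : ℝ), 0 ≤ t₁ →
          (∀ t ∈ Icc 0 t₁, HasDerivWithinAt c (c' t) (Icc 0 t₁) t) →
          ContinuousOn c' (Icc 0 t₁) → (∀ t ∈ Icc 0 t₁, c t ∈ Metric.closedBall y₀ r ∩ R) →
          c 0 = y → ‖c t₁ - y₀‖ = r → ContinuousOn σ (Icc 0 t₁) → (∀ t ∈ Icc 0 t₁, 0 ≤ σ t) →
          (∀ t ∈ Icc 0 t₁, σ t ^ 2 = 2 * L (c t) (c' t)) →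
          T * √(2 * L y w) ≤ ∫ t in (0 : ℝ)..t₁, σ t) := by
  have := FiniteDimensional.complete ℝ E
  have := FiniteDimensional.proper_real E
  set K := Metric.closedBall y₀ r ∩ R with hK
  have hKc : IsCompact K := (isCompact_closedBall y₀ r).inter_right hR.isClosed
  have hKconv : Convex ℝ K := (convex_closedBall y₀ r).inter hR.convex
  obtain ⟨κ, C, hκ, hC, hW⟩ := h.exists_energy_ge hKc hKconv hrD
  obtain ⟨m, hm, hlen⟩ := h.exists_norm_sub_le_integral hKc hrD
  obtain ⟨B, hB⟩ := (hKc.prod (isCompact_sphere (0 : E) 1)).exists_bound_of_continuousOn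
    (f := fun q : E × E => √(2 * Function.uncurry L q))
    (((h.smooth.continuousOn.mono (prod_mono hrD fun w hw h0 => by simp_all)).const_smul
      (2 : ℝ)).sqrt)
  set B' := max B 1 with hB'
  have hB'0 : 0 < B' := lt_max_of_lt_right one_pos
  -- The first bound ensures CT² ≤ κ for minimality inside the ball. The second makes the geodesic,
  -- of speed at most B', no longer than m r/2, the least cost of travelling a distance r/2.
  set T₁ := min (√(κ / (C + 1))) (m * (r / 2) / B') with hT₁
  have hT₁0 : 0 < T₁ := lt_min (Real.sqrt_pos.2 (by positivity)) (by positivity)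
  have hT₁κ : C * T₁ ^ 2 ≤ κ := by
    have e1 : T₁ ^ 2 ≤ κ / (C + 1) := by
      rw [← Real.sq_sqrt (show 0 ≤ κ / (C + 1) by positivity)]
      exact pow_le_pow_left₀ hT₁0.le (min_le_left _ _) 2
    rw [le_div_iff₀ (by positivity)] at e1
    nlinarith [sq_nonneg T₁]
  have hT₁B : T₁ * B' ≤ m * (r / 2) := (le_div_iff₀ hB'0).1 (min_le_right _ _)
  obtain ⟨r', hr', hexit⟩ := h.exists_exit hR hy₀ hconv hr hrD hT₁0
  -- Starting within r/2 of the centre leaves a distance of at least r/2 to the sphere.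
  refine ⟨min r' (r / 2), lt_min hr' (by positivity), (min_le_right _ _).trans_lt (by linarith),
    fun y hy w hw hℓw => ?_⟩
  obtain ⟨T₀, T, z, hT, hTT₀, hT₀, hz0, hz, hzmem, hzT, hin, hout⟩ := hexit y
    ⟨Metric.closedBall_subset_closedBall (min_le_left _ _) hy.1, hy.2⟩ w hw hℓw
  have tr : IsExitTrajectory D L ℓ ρ y₀ r y w z T T₀ :=
    ⟨hw, hT, hTT₀, hz0, hz, hzmem, hzT, hin, hout⟩
  refine ⟨z, T, T₀, tr, fun c c' σ hc hc' hcK hc0 hc1 hσ hσ0 hσL => ?_,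
    fun c c' σ t₁ ht₁ hc hc' hcK hc0 hc1 hσ hσ0 hσL => ?_⟩
  · have hd := fun t ht => tr.hasDerivWithinAt (t := t) hR ht
    refine h.mul_sqrt_le_integral hrD hκ hC hW hT ?_ (γ := fun t => (z t).1)
      (v := fun t => (z t).2) (fun t ht => (hd t ht).fst) (fun t ht => tr.fst_mem hR ht)
      (fun t ht => (hd t ht).continuousWithinAt.snd) (fun t _ => tr.half_le_norm_snd t)
      (fun t _ => tr.norm_snd_le_two t) (fun t ht => tr.hasDerivWithinAt_momentum h hR hrD ht)
      (fun t ht => tr.energy_eq h hR hrD ht) hc hc' hcK (by simp [hc0, hz0]) hc1 hσ hσ0 hσL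
    refine le_trans ?_ hT₁κ
    gcongr
    exact hTT₀.le.trans hT₀
  · have e1 : √(2 * L y w) ≤ B' := by
      have := hB (y, w) ⟨⟨Metric.closedBall_subset_closedBall
        ((min_le_right _ _).trans (by linarith)) hy.1, hy.2⟩, by simpa using hw⟩
      rw [Real.norm_of_nonneg (Real.sqrt_nonneg _)] at this
      exact this.trans (le_max_left _ _)
    have e2 : r / 2 ≤ ‖c t₁ - c 0‖ := by
      have e3 : ‖c 0 - y₀‖ ≤ r / 2 := by
        rw [hc0]
        exact (mem_closedBall_iff_norm.1 hy.1).trans (min_le_right _ _)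
      have e4 := norm_sub_le_norm_sub_add_norm_sub (c t₁) (c 0) y₀
      linarith
    calc T * √(2 * L y w) ≤ T₁ * B' := by
          gcongr
          exact hTT₀.le.trans hT₀
      _ ≤ m * (r / 2) := hT₁B
      _ ≤ m * ‖c t₁ - c 0‖ := by gcongr
      _ ≤ _ := hlen c c' σ t₁ ht₁ hc hc' hcK hσ hσ0 hσL

end ExitTrajectories

/-! ### Exit trajectories as maximal geodesics of M. -/

section ExitGeodesics

variable {E : Type*} [NormedAddCommGroup E] [NormedSpace ℝ E]

theorem mul_mem_Icc_of_mem_Icc_div {T c t : ℝ} (hc : 0 < c) (ht : t ∈ Icc 0 (T / c)) :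
    c * t ∈ Icc 0 T :=
  ⟨mul_nonneg hc.le ht.1, by rw [mul_comm]; exact (le_div_iff₀ hc).1 ht.2⟩

/-- Multiplication of the velocity by a constant. -/
def velocityScale (c : ℝ) : E × E →L[ℝ] E × E :=
  (ContinuousLinearMap.id ℝ E).prodMap (c • ContinuousLinearMap.id ℝ E)

theorem velocityScale_apply (c : ℝ) (q : E × E) : velocityScale c q = (q.1, c • q.2) := rfl

theorem velocityScale_inv_velocityScale {c : ℝ} (hc : c ≠ 0) (q : E × E) :
    velocityScale c⁻¹ (velocityScale c q) = q :=
  Prod.ext rfl (inv_smul_smul₀ hc q.2)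

variable {R D : Set E} {L : E → E → ℝ} {ℓ : E →L[ℝ] ℝ} {ρ : E → E} {y₀ : E} {r : ℝ}
  [FiniteDimensional ℝ E]

/-- Solutions of the geodesic equation remain so under affine changes of the parameter. -/
theorem IsCoordFinsler.hasDerivWithinAt_velocityScale (h : IsCoordFinsler R D L) {z : ℝ → E × E}
    {s s' : Set ℝ} {t c : ℝ} (hc : 0 < c) (hs : MapsTo (fun t => c * t) s' s)
    (hz : HasDerivWithinAt z ((z (c * t)).2, spray D L (z (c * t))) s (c * t))
    (hD : (z (c * t)).1 ∈ D) (h0 : (z (c * t)).2 ≠ 0) :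
    HasDerivWithinAt (fun t => velocityScale c (z (c * t)))
      ((velocityScale c (z (c * t))).2, spray D L (velocityScale c (z (c * t)))) s' t := by
  have h1 : HasDerivWithinAt (fun t => c * t) c s' t := by
    simpa using (hasDerivWithinAt_id t s').const_mul c
  have h2 := (velocityScale (E := E) c).hasFDerivAt.comp_hasDerivWithinAt t (hz.scomp t h1 hs)
  have h3 : velocityScale c (c • ((z (c * t)).2, spray D L (z (c * t))))
      = ((velocityScale c (z (c * t))).2, spray D L (velocityScale c (z (c * t)))) := by
    rw [velocityScale_apply, velocityScale_apply, h.spray_smul hD h0 hc]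
    refine Prod.ext rfl ?_
    simp [smul_smul, sq]
  rw [h3] at h2
  exact h2

variable {H : Type*} [TopologicalSpace H] {I : ModelWithCorners ℝ E H}
  {M : Type*} [TopologicalSpace M] [ChartedSpace H M] [IsManifold I ∞ M]
  {F : TangentBundle I M → ℝ} {p : M}

/-- The curve in the tangent bundle given by a curve in the chart at `p`, run at speed `c`. -/
def liftCurve (I : ModelWithCorners ℝ E H) {M : Type*} [TopologicalSpace M]
    [ChartedSpace H M] [IsManifold I ∞ M] (p : M) (z : ℝ → E × E) (c t : ℝ) : TangentBundle I M :=
  (tangentChart I p).symm (velocityScale c (z (c * t)))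

omit [FiniteDimensional ℝ E] in
theorem tangentChart_liftCurve {z : ℝ → E × E} {c t : ℝ}
    (hz : (z (c * t)).1 ∈ (extChartAt I p).target) :
    tangentChart I p (liftCurve I p z c t) = velocityScale c (z (c * t)) :=
  (tangentChart I p).right_inv (by rw [tangentChart_target]; exact ⟨hz, mem_univ _⟩)

omit [FiniteDimensional ℝ E] in
theorem liftCurve_fst {z : ℝ → E × E} {c t : ℝ}
    (hz : (z (c * t)).1 ∈ (extChartAt I p).target) :
    (liftCurve I p z c t).1 = (extChartAt I p).symm (z (c * t)).1 := by
  rw [liftCurve, velocityScale_apply, tangentChart_symm_apply hz]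

omit [FiniteDimensional ℝ E] in
theorem liftCurve_fst_mem {z : ℝ → E × E} {c t : ℝ}
    (hz : (z (c * t)).1 ∈ (extChartAt I p).target) :
    (liftCurve I p z c t).1 ∈ (extChartAt I p).source := by
  rw [liftCurve_fst hz]
  exact (extChartAt I p).map_target hz

omit [FiniteDimensional ℝ E] in
theorem liftCurve_snd_ne_zero {z : ℝ → E × E} {c t : ℝ} (hc : c ≠ 0)
    (hz : (z (c * t)).1 ∈ (extChartAt I p).target) (h0 : (z (c * t)).2 ≠ 0) :
    (liftCurve I p z c t).2 ≠ 0 := by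
  rw [liftCurve, velocityScale_apply, tangentChart_symm_apply hz]
  exact tangentCoordChange_ne_zero ((extChartAt I p).map_target hz) (mem_extChartAt_source _)
    (smul_ne_zero hc h0)

namespace IsExitTrajectory

variable {y w : E} {z : ℝ → E × E} {T T₀ c : ℝ}
  (tr : IsExitTrajectory (extChartAt I p).target (chartEnergy F p) ℓ ρ y₀ r y w z T T₀)
include tr

theorem isGeodesicOn_liftCurve (hF : IsFinslerMetric F) (hR : IsHalfSpace (range I) ℓ ρ)
    (hrD : Metric.closedBall y₀ r ∩ range I ⊆ (extChartAt I p).target) (hc : 0 < c) :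
    IsGeodesicOn F (liftCurve I p z c) (Icc 0 (T / c)) := by
  have hmem : ∀ t ∈ Icc 0 (T / c), (z (c * t)).1 ∈ (extChartAt I p).target := fun t ht =>
    hrD (tr.fst_mem hR (mul_mem_Icc_of_mem_Icc_div hc ht))
  have hd : ∀ t ∈ Icc 0 (T / c), HasDerivWithinAt (fun t => velocityScale c (z (c * t)))
      ((velocityScale c (z (c * t))).2, chartSpray F p (velocityScale c (z (c * t))))
      (Icc 0 (T / c)) t := fun t ht =>
    (isCoordFinsler_chartEnergy hF p).hasDerivWithinAt_velocityScale hc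
      (fun s hs => mul_mem_Icc_of_mem_Icc_div hc hs) (tr.hasDerivWithinAt hR (mul_mem_Icc_of_mem_Icc_div hc ht)) (hmem t ht)
      (tr.snd_ne_zero _)
  refine isGeodesicOn_of_hasDerivWithinAt_tangentChart (q := p) hF ?_
    (fun t ht => liftCurve_snd_ne_zero hc.ne' (hmem t ht) (tr.snd_ne_zero _))
    (fun t ht => liftCurve_fst_mem (hmem t ht)) fun t ht => ?_
  · refine (continuousOn_extChartAt_symm (I := I.tangent) (⟨p, 0⟩ : TangentBundle I M)).comp
      (fun t ht => (hd t ht).continuousWithinAt) fun t ht => ?_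
    change _ ∈ (tangentChart I p).target
    rw [tangentChart_target]
    exact ⟨hmem t ht, mem_univ _⟩
  · rw [tangentChart_liftCurve (hmem t ht)]
    exact (hd t ht).congr (fun s hs => tangentChart_liftCurve (hmem s hs))
      (tangentChart_liftCurve (hmem t ht))

/-- The time at which an exit trajectory leaves the half space bounds the life time of the geodesics
with the same initial velocity. -/
theorem mul_le_of_isGeodesicOn [T2Space M] (hF : IsFinslerMetric F)
    (hR : IsHalfSpace (range I) ℓ ρ) (hy₀ : y₀ ∈ range I)
    (hrD : Metric.closedBall y₀ r ∩ range I ⊆ (extChartAt I p).target) (hc : 0 < c) {T' : ℝ}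
    {η : ℝ → TangentBundle I M} (hη : IsGeodesicOn F η (Icc 0 T'))
    (h0 : (η 0).1 ∈ (extChartAt I p).source)
    (h1 : tangentChart I p (η 0) = velocityScale c (y, w)) : c * T' ≤ T := by
  by_contra! hlt
  have hCF := isCoordFinsler_chartEnergy hF p
  have hc' : 0 < c⁻¹ := inv_pos.2 hc
  obtain ⟨C, -, -, hlip, -⟩ := hCF.exists_lipschitzOnWith_extendedField hR hy₀ hrD
  set b := min (c * T') T₀ with hb
  have hTb : T < b := lt_min hlt tr.lt
  have hb0 : 0 ≤ b := tr.nonneg.trans hTb.le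
  -- The given geodesic in the chart, slowed down so that it has the initial data (y, w) of `z`. It
  -- is compared with `z` up to `b`, beyond the exit time T.
  set θ : ℝ → E × E := fun s => velocityScale c⁻¹ (tangentChart I p (η (c⁻¹ * s))) with hθ
  have hmaps : MapsTo (fun s => c⁻¹ * s) (Icc 0 b) (Icc 0 T') := fun s hs =>
    ⟨mul_nonneg hc'.le hs.1, by
      have := hs.2.trans (min_le_left _ _)
      rwa [inv_mul_le_iff₀ hc]⟩
  have hηc : ContinuousOn (fun s => η (c⁻¹ * s)) (Icc 0 b) := by
    have h2 : ContinuousOn η (Icc 0 T') := fun t ht => by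
      obtain ⟨-, a, -, hd⟩ := hη t ht
      exact hd.1
    exact h2.comp (by fun_prop) hmaps
  have hγc : ContinuousOn (fun s => (η (c⁻¹ * s)).1) (Icc 0 b) :=
    (FiberBundle.continuous_proj E (TangentSpace I)).comp_continuousOn hηc
  have hzc : ContinuousOn z (Icc 0 b) := fun s hs =>
    ((tr.deriv s ⟨hs.1, hs.2.trans (min_le_right _ _)⟩).continuousWithinAt).mono
      (Icc_subset_Icc_right (min_le_right _ _))
  have hθfst : ∀ s, (η (c⁻¹ * s)).1 ∈ (extChartAt I p).source → (θ s).1 ∈ range I := fun s hs =>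
    extChartAt_target_subset_range p (tangentChart_fst_mem hs)
  have hθd : ∀ s ∈ Icc 0 b, (η (c⁻¹ * s)).1 ∈ (extChartAt I p).source →
      HasDerivWithinAt θ (extendedField (extChartAt I p).target (chartEnergy F p) ρ (θ s))
        (Icc 0 b) s := fun s hs hsrc => by
    have h2 := hη.hasDerivWithinAt_tangentChart hF (hmaps hs) hsrc
    have h3 := hCF.hasDerivWithinAt_velocityScale hc' hmaps h2 (tangentChart_fst_mem hsrc)
      (tangentChart_snd_ne_zero hsrc (hη _ (hmaps hs)).1)
    rw [extendedField, hR.eq_self _ (hθfst s hsrc)]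
    exact h3
  set S : Set ℝ := {s | (η (c⁻¹ * s)).1 ∈ (extChartAt I p).source ∧ θ s = z s} with hS
  -- Lying in the chart domain is not a closed condition. Where `z` is in the half-space, however,
  -- it stays in the target, so agreement of positions can be expressed through the inverse chart,
  -- and this is closed because M is Hausdorff.
  have hSclosed : IsClosed (S ∩ Icc 0 b) := by
    set A : Set ℝ := {s ∈ Icc 0 b | 0 ≤ ℓ (z s).1} with hA
    have hAc : IsClosed A :=
      (ℓ.continuous.comp_continuousOn hzc.fst).preimage_isClosed_of_isClosed isClosed_Icc
        isClosed_Ici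
    have hzA : ∀ s ∈ A, (z s).1 ∈ (extChartAt I p).target := fun s hs =>
      hrD ⟨Metric.ball_subset_closedBall (tr.mem s).1, (hR.mem_iff _).2 hs.2⟩
    set S₁ : Set ℝ := {s ∈ A | (η (c⁻¹ * s)).1 = (extChartAt I p).symm (z s).1} with hS₁
    have hS₁c : IsClosed S₁ := hAc.isClosed_eq (hγc.mono fun s hs => hs.1)
      ((continuousOn_extChartAt_symm p).comp (hzc.fst.mono fun s hs => hs.1) hzA)
    have hsrc : ∀ s ∈ S₁, (η (c⁻¹ * s)).1 ∈ (extChartAt I p).source := fun s hs => by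
      rw [hs.2]; exact (extChartAt I p).map_target (hzA s hs.1)
    have hS₂c : IsClosed {s ∈ S₁ | θ s = z s} := by
      refine hS₁c.isClosed_eq (fun s hs => ?_) (hzc.mono fun s hs => hs.1.1)
      exact (hθd s hs.1.1 (hsrc s hs)).continuousWithinAt.mono fun s hs => hs.1.1
    convert hS₂c using 1
    ext s
    refine ⟨fun hs => ⟨⟨⟨hs.2, ?_⟩, ?_⟩, hs.1.2⟩, fun hs => ⟨⟨hsrc s hs.1, hs.2⟩, hs.1.1.1⟩⟩
    · rw [← hs.1.2]
      exact (hR.mem_iff _).1 (hθfst s hs.1.1)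
    · rw [← hs.1.2]
      exact ((extChartAt I p).left_inv hs.1.1).symm
  have h0S : (0 : ℝ) ∈ S := by
    refine ⟨by simpa using h0, ?_⟩
    simp only [hθ, mul_zero]
    rw [h1, velocityScale_inv_velocityScale hc.ne', tr.zero]
  -- The agreement set is also open to the right: slightly after s both curves solve the extended
  -- equation in a region where it is Lipschitz.
  have hall := hSclosed.Icc_subset_of_forall_mem_nhdsWithin h0S fun s hs => by
    have hs' : s ∈ Icc 0 b := Ico_subset_Icc_self hs.2
    have hnhds : ∀ t ∈ Ico 0 b, Icc 0 b ∈ 𝓝[≥] t := fun t ht =>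
      Filter.mem_of_superset (Icc_mem_nhdsGE ht.2) (Icc_subset_Icc_left ht.1)
    have hev : ∀ᶠ t in 𝓝[≥] s, (η (c⁻¹ * t)).1 ∈ (extChartAt I p).source ∧
        θ t ∈ Metric.ball y₀ r ×ˢ Metric.ball w (1 / 2) := by
      refine Filter.Eventually.and ?_ ?_
      · exact ((hγc s hs').mono_of_mem_nhdsWithin (hnhds s hs.2))
          ((isOpen_extChartAt_source p).mem_nhds hs.1.1)
      · refine ((hθd s hs' hs.1.1).continuousWithinAt.mono_of_mem_nhdsWithin (hnhds s hs.2))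
          ((Metric.isOpen_ball.prod Metric.isOpen_ball).mem_nhds ?_)
        rw [hs.1.2]
        exact tr.mem s
    obtain ⟨u, hu, hsu⟩ := mem_nhdsGE_iff_exists_Icc_subset.1
      (Filter.inter_mem hev (hnhds s hs.2))
    have hIco : ∀ t ∈ Ico s u, t ∈ Ico 0 b := fun t ht =>
      ⟨hs.2.1.trans ht.1, ht.2.trans_le (hsu ⟨hu.le, le_rfl⟩).2.2⟩
    have heq : EqOn θ z (Icc s u) := by
      refine ODE_solution_unique_of_mem_Icc_right (K := C)
        (v := fun _ => extendedField (extChartAt I p).target (chartEnergy F p) ρ)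
        (s := fun _ => Metric.closedBall y₀ r ×ˢ Metric.closedBall w (1 / 2))
        (fun t _ => hlip w tr.norm_eq) (fun t ht => ?_) (fun t ht => ?_) (fun t ht => ?_)
        (hzc.mono fun t ht => (hsu ht).2) (fun t ht => ?_) (fun t _ => ?_) hs.1.2
      · exact (hθd t (hsu ht).2 (hsu ht).1.1).continuousWithinAt.mono fun t ht => (hsu ht).2
      · have ht' := hsu (Ico_subset_Icc_self ht)
        exact (hθd t ht'.2 ht'.1.1).mono_of_mem_nhdsWithin (hnhds t (hIco t ht))
      · have ht' := (hsu (Ico_subset_Icc_self ht)).1.2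
        exact ⟨Metric.ball_subset_closedBall ht'.1, Metric.ball_subset_closedBall ht'.2⟩
      · have ht' := hIco t ht
        exact ((tr.deriv t ⟨ht'.1, ht'.2.le.trans (min_le_right _ _)⟩).mono
          (Icc_subset_Icc_right (min_le_right _ _))).mono_of_mem_nhdsWithin (hnhds t ht')
      · exact ⟨Metric.ball_subset_closedBall (tr.mem t).1,
          Metric.ball_subset_closedBall (tr.mem t).2⟩
    exact Filter.mem_of_superset (Ioc_mem_nhdsGT hu) fun t ht =>
      ⟨(hsu (Ioc_subset_Icc_self ht)).1.1, heq (Ioc_subset_Icc_self ht)⟩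
  have hbS := hall ⟨hb0, le_rfl⟩
  -- A geodesic in M has chart values in the half-space, whereas `z` is outside it at time b > T.
  have h2 : 0 ≤ ℓ (z b).1 := by
    rw [← hbS.2]
    exact (hR.mem_iff _).1 (hθfst b hbS.1)
  exact absurd h2 (not_le.2 (tr.outside b ⟨hTb, min_le_right _ _⟩))

end IsExitTrajectory

end ExitGeodesics

/-! ### Lengths of geodesics and of competitors. -/

section Lengths

variable {E : Type*} [NormedAddCommGroup E] [NormedSpace ℝ E]
  {H : Type*} [TopologicalSpace H] {I : ModelWithCorners ℝ E H}
  {M : Type*} [TopologicalSpace M] [ChartedSpace H M] [IsManifold I ∞ M]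
  {F : TangentBundle I M → ℝ} {p : M}

/-- The tangent lift of a curve `[0, 1] → M`. -/
def velocityLift (I : ModelWithCorners ℝ E H) {M : Type*} [TopologicalSpace M]
    [ChartedSpace H M] (c : ℝ → M) (t : ℝ) : TangentBundle I M :=
  ⟨c t, mfderivWithin 𝓘(ℝ, ℝ) I c (Icc 0 1) t (1 : ℝ)⟩

theorem continuousOn_velocityLift {c : ℝ → M} (hc : ContMDiffOn 𝓘(ℝ, ℝ) I 1 c (Icc 0 1)) :
    ContinuousOn (velocityLift I c) (Icc 0 1) := by
  have h1 := hc.continuousOn_tangentMapWithin le_rfl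
    (uniqueMDiffOn_iff_uniqueDiffOn.2 (uniqueDiffOn_Icc (zero_lt_one' ℝ)))
  have h2 : Continuous fun t : ℝ => (⟨t, (1 : ℝ)⟩ : TangentBundle 𝓘(ℝ, ℝ) ℝ) :=
    (tangentBundleModelSpaceHomeomorph 𝓘(ℝ, ℝ)).symm.continuous.comp
      (continuous_id.prodMk continuous_const : Continuous fun t : ℝ => ((t, 1) : ℝ × ℝ))
  exact h1.comp h2.continuousOn fun t ht => ht

theorem hasDerivWithinAt_extChartAt_comp {c : ℝ → M}
    (hc : ContMDiffOn 𝓘(ℝ, ℝ) I 1 c (Icc 0 1)) {t : ℝ} (ht : t ∈ Icc (0 : ℝ) 1)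
    (hp : c t ∈ (extChartAt I p).source) :
    HasDerivWithinAt (extChartAt I p ∘ c) (tangentChart I p (velocityLift I c t)).2 (Icc 0 1) t :=
  hasDerivWithinAt_of_hasMFDerivWithinAt
    (((hc t ht).mdifferentiableWithinAt one_ne_zero).hasMFDerivWithinAt) hp

theorem IsFinslerMetric.nonneg (hF : IsFinslerMetric F) (ξ : TangentBundle I M) : 0 ≤ F ξ := by
  by_cases h : ξ.2 = 0
  · have h1 := hF.homogeneous ξ.1 0 2 two_pos
    rw [smul_zero] at h1
    have h2 : F ξ = F ⟨ξ.1, 0⟩ := by rw [← h]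
    rw [h2]
    linarith
  · exact (hF.pos ξ h).le

variable {ℓ : E →L[ℝ] ℝ} {ρ : E → E} {y₀ : E} {r : ℝ} [FiniteDimensional ℝ E]

/-- This identifies η with the velocity of its footpoint curve. Positive duration is essential, as
derivatives within a one-point interval are not unique. -/
theorem IsGeodesicOn.mfderivWithin_fst (hF : IsFinslerMetric F) {η : ℝ → TangentBundle I M}
    {b : ℝ} (hη : IsGeodesicOn F η (Icc 0 b)) (hb : 0 < b) {t : ℝ} (ht : t ∈ Icc 0 b) :
    mfderivWithin 𝓘(ℝ, ℝ) I (fun t => (η t).1) (Icc 0 b) t (1 : ℝ) = (η t).2 := by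
  have hsrc := mem_extChartAt_source (I := I) (η t).1
  have hcont : ContinuousWithinAt (fun t => (η t).1) (Icc 0 b) t := by
    obtain ⟨-, a, -, hd⟩ := hη t ht
    exact (FiberBundle.continuous_proj E (TangentSpace I)).continuousAt.comp_continuousWithinAt hd.1
  have h1 : HasDerivWithinAt (extChartAt I (η t).1 ∘ fun t => (η t).1)
      (tangentChart I (η t).1 (η t)).2 (Icc 0 b) t :=
    (ContinuousLinearMap.fst ℝ E E).hasFDerivAt.comp_hasDerivWithinAt t
      (hη.hasDerivWithinAt_tangentChart hF ht hsrc)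
  rw [tangentChart_self] at h1
  have h2 := (hasMFDerivWithinAt_of_hasDerivWithinAt hcont hsrc h1).mfderivWithin
    (uniqueMDiffWithinAt_iff_uniqueDiffWithinAt.2 (uniqueDiffOn_Icc hb t ht))
  have h3 : tangentCoordChange I (η t).1 (η t).1 (η t).1 (η t).2 = (η t).2 :=
    tangentCoordChange_self (E := E) hsrc
  have h4 := congrArg (fun A : ℝ →L[ℝ] E => A 1) h2
  exact h4.trans ((one_smul ℝ _).trans h3)

/-- By conservation of energy the speed F is the constant c√(2L(y, w)), over a time T/c. -/
theorem IsExitTrajectory.curveLength_liftCurve {y w : E} {z : ℝ → E × E} {T T₀ c : ℝ}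
    (tr : IsExitTrajectory (extChartAt I p).target (chartEnergy F p) ℓ ρ y₀ r y w z T T₀)
    (hF : IsFinslerMetric F) (hR : IsHalfSpace (range I) ℓ ρ)
    (hrD : Metric.closedBall y₀ r ∩ range I ⊆ (extChartAt I p).target) (hc : 0 < c) :
    curveLength F (fun t => (liftCurve I p z c t).1) 0 (T / c)
      = T * √(2 * chartEnergy F p y w) := by
  have hmem : ∀ t ∈ Icc 0 (T / c), (z (c * t)).1 ∈ (extChartAt I p).target := fun t ht =>
    hrD (tr.fst_mem hR (mul_mem_Icc_of_mem_Icc_div hc ht))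
  have hCF := isCoordFinsler_chartEnergy hF p
  have hTc : 0 ≤ T / c := div_nonneg tr.nonneg hc.le
  have hgeo := tr.isGeodesicOn_liftCurve hF hR hrD hc
  rcases hTc.eq_or_lt with h0 | h0
  · rw [curveLength, ← h0, intervalIntegral.integral_same]
    rw [(div_eq_zero_iff.1 h0.symm).resolve_right hc.ne', zero_mul]
  have hvel : ∀ t ∈ Icc 0 (T / c), (⟨(liftCurve I p z c t).1,
      mfderivWithin 𝓘(ℝ, ℝ) I (fun t => (liftCurve I p z c t).1) (Icc 0 (T / c)) t (1 : ℝ)⟩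
        : TangentBundle I M) = liftCurve I p z c t := fun t ht => by
    exact congrArg (fun v : E => (⟨(liftCurve I p z c t).1, v⟩ : TangentBundle I M))
      (hgeo.mfderivWithin_fst hF h0 ht)
  have hFval : ∀ t ∈ Icc 0 (T / c), F (liftCurve I p z c t)
      = c * √(2 * chartEnergy F p y w) := fun t ht => by
    have h1 := chartEnergy_tangentChart F (liftCurve_fst_mem (hmem t ht))
    rw [tangentChart_liftCurve (hmem t ht), velocityScale_apply,
      hCF.homogeneous _ (hmem t ht) _ _ hc,
      tr.energy_eq hCF hR hrD (mul_mem_Icc_of_mem_Icc_div hc ht)] at h1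
    have h2 : F (liftCurve I p z c t) ^ 2 = c ^ 2 * (2 * chartEnergy F p y w) := by linarith
    rw [← Real.sqrt_sq (hF.nonneg (liftCurve I p z c t)), h2, Real.sqrt_mul (sq_nonneg c),
      Real.sqrt_sq hc.le]
  rw [curveLength, intervalIntegral.integral_congr (g := fun _ => c * √(2 * chartEnergy F p y w))]
  · rw [intervalIntegral.integral_const, smul_eq_mul]
    field_simp
    ring
  · intro t ht
    rw [uIcc_of_le hTc] at ht
    simp only
    rw [hvel t ht, hFval t ht]

/-- A curve that is shorter than all competitors in a chart, and than all curves leaving the chart,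
is shorter than all competitors. -/
theorem le_curveLength [T2Space M] (hF : IsFinslerMetric F) (hR : IsHalfSpace (range I) ℓ ρ)
    (hrD : Metric.closedBall y₀ r ∩ range I ⊆ (extChartAt I p).target) {x : M} {y y₁ : E} {Λ : ℝ}
    (hx : x ∈ (extChartAt I p).source) (hxy : extChartAt I p x = y) (hyr : y ∈ Metric.ball y₀ r)
    (hin : ∀ (c c' : ℝ → E) (σ : ℝ → ℝ),
          (∀ t ∈ Icc (0 : ℝ) 1, HasDerivWithinAt c (c' t) (Icc 0 1) t) →
          ContinuousOn c' (Icc 0 1) →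
          (∀ t ∈ Icc (0 : ℝ) 1, c t ∈ Metric.closedBall y₀ r ∩ range I) →
          c 0 = y → c 1 = y₁ → ContinuousOn σ (Icc 0 1) → (∀ t ∈ Icc (0 : ℝ) 1, 0 ≤ σ t) →
          (∀ t ∈ Icc (0 : ℝ) 1, σ t ^ 2 = 2 * chartEnergy F p (c t) (c' t)) →
          Λ ≤ ∫ t in (0 : ℝ)..1, σ t)
    (hout : ∀ (c c' : ℝ → E) (σ : ℝ → ℝ) (t₁ : ℝ), 0 ≤ t₁ →
          (∀ t ∈ Icc 0 t₁, HasDerivWithinAt c (c' t) (Icc 0 t₁) t) →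
          ContinuousOn c' (Icc 0 t₁) →
          (∀ t ∈ Icc 0 t₁, c t ∈ Metric.closedBall y₀ r ∩ range I) →
          c 0 = y → ‖c t₁ - y₀‖ = r → ContinuousOn σ (Icc 0 t₁) → (∀ t ∈ Icc 0 t₁, 0 ≤ σ t) →
          (∀ t ∈ Icc 0 t₁, σ t ^ 2 = 2 * chartEnergy F p (c t) (c' t)) →
          Λ ≤ ∫ t in (0 : ℝ)..t₁, σ t)
    {c : ℝ → M} (hc : ContMDiffOn 𝓘(ℝ, ℝ) I 1 c (Icc 0 1)) (hc0 : c 0 = x)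
    (hc1 : extChartAt I p (c 1) = y₁) : Λ ≤ curveLength F c 0 1 := by
  have := FiniteDimensional.proper_real E
  have hlift := continuousOn_velocityLift hc
  have hσ : ContinuousOn (fun t => F (velocityLift I c t)) (Icc 0 1) :=
    hF.continuous.comp_continuousOn hlift
  have hσ0 : ∀ t, 0 ≤ F (velocityLift I c t) := fun t => hF.nonneg _
  have hcurve : ∀ s ⊆ Icc (0 : ℝ) 1, (∀ t ∈ s, c t ∈ (extChartAt I p).source) →
      (∀ t ∈ s, HasDerivWithinAt (extChartAt I p ∘ c) (tangentChart I p (velocityLift I c t)).2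
        s t) ∧
      ContinuousOn (fun t => (tangentChart I p (velocityLift I c t)).2) s ∧
      ∀ t ∈ s, F (velocityLift I c t) ^ 2
        = 2 * chartEnergy F p ((extChartAt I p ∘ c) t)
          (tangentChart I p (velocityLift I c t)).2 := by
    intro s hs hsrc
    refine ⟨fun t ht => (hasDerivWithinAt_extChartAt_comp hc (hs ht) (hsrc t ht)).mono hs, ?_,
      fun t ht => ?_⟩
    · refine ContinuousOn.snd ((continuousOn_extChartAt (I := I.tangent)
        (⟨p, 0⟩ : TangentBundle I M)).comp (hlift.mono hs) fun t ht => ?_)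
      exact mem_tangentChart_source.2 (hsrc t ht)
    · have h1 := chartEnergy_tangentChart F (p := p) (ξ := velocityLift I c t) (hsrc t ht)
      have h2 : (tangentChart I p (velocityLift I c t)).1 = (extChartAt I p ∘ c) t := rfl
      rw [h2] at h1
      rw [h1]
      ring
  set V : Set M := (extChartAt I p).source ∩ extChartAt I p ⁻¹' Metric.ball y₀ r with hV
  have hVo : IsOpen V := (continuousOn_extChartAt p).isOpen_inter_preimage
    (isOpen_extChartAt_source p) Metric.isOpen_ball
  have hVK : ∀ x ∈ V, extChartAt I p x ∈ Metric.closedBall y₀ r ∩ range I := fun x hx =>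
    ⟨Metric.ball_subset_closedBall hx.2,
      extChartAt_target_subset_range p ((extChartAt I p).map_source hx.1)⟩
  have hlen : curveLength F c 0 1 = ∫ t in (0 : ℝ)..1, F (velocityLift I c t) := rfl
  rw [hlen]
  by_cases hall : ∀ t ∈ Icc (0 : ℝ) 1, c t ∈ V
  · obtain ⟨h1, h2, h3⟩ := hcurve _ le_rfl fun t ht => (hall t ht).1
    exact hin _ _ _ h1 h2 (fun t ht => hVK _ (hall t ht)) (by rw [Function.comp_apply, hc0, hxy]) hc1 hσ
      (fun t _ => hσ0 t) h3
  set B : Set ℝ := {t ∈ Icc (0 : ℝ) 1 | c t ∉ V} with hB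
  have hBne : B.Nonempty := by
    push Not at hall
    exact hall
  have hBc : IsClosed B := hc.continuousOn.preimage_isClosed_of_isClosed isClosed_Icc
    hVo.isClosed_compl
  have hBbdd : BddBelow B := ⟨0, fun t ht => ht.1.1⟩
  -- The first time at which the competitor is outside the open coordinate ball; only the part up to
  -- t₁ is measured.
  set t₁ := sInf B with ht₁
  have ht₁B : t₁ ∈ B := hBc.csInf_mem hBne hBbdd
  have hlt : ∀ t ∈ Ico 0 t₁, c t ∈ V := fun t ht => by
    by_contra hcon
    exact absurd (csInf_le hBbdd (show t ∈ B from ⟨⟨ht.1, ht.2.le.trans ht₁B.1.2⟩, hcon⟩))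
      (not_le.2 ht.2)
  have hpos : 0 < t₁ := by
    refine ht₁B.1.1.lt_of_ne fun h0 => ht₁B.2 ?_
    rw [← h0, hc0]
    exact ⟨hx, by rw [mem_preimage, hxy]; exact hyr⟩
  have hsub : Icc 0 t₁ ⊆ Icc (0 : ℝ) 1 := Icc_subset_Icc_right ht₁B.1.2
  -- A compact, hence closed, part of the chart domain. It contains the curve before t₁, hence also
  -- c(t₁), so the curve leaves through the coordinate sphere while still in the chart.
  set Q : Set M := (extChartAt I p).symm '' (Metric.closedBall y₀ r ∩ range I) with hQ
  have hQc : IsClosed Q := (((isCompact_closedBall y₀ r).inter_right hR.isClosed).image_of_continuousOn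
    ((continuousOn_extChartAt_symm p).mono hrD)).isClosed
  have hQ1 : c t₁ ∈ Q := by
    have h1 : ContinuousWithinAt c (Ico 0 t₁) t₁ :=
      (hc.continuousOn t₁ ht₁B.1).mono (Ico_subset_Icc_self.trans hsub)
    have h2 : t₁ ∈ closure (Ico 0 t₁) := by
      rw [closure_Ico hpos.ne]
      exact ⟨hpos.le, le_rfl⟩
    refine hQc.closure_subset_iff.2 ?_ (h1.mem_closure_image h2)
    rintro _ ⟨t, ht, rfl⟩
    exact ⟨_, hVK _ (hlt t ht), (extChartAt I p).left_inv (hlt t ht).1⟩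
  obtain ⟨y', hy', hcy'⟩ := hQ1
  have hsrc₁ : c t₁ ∈ (extChartAt I p).source := by
    rw [← hcy']; exact (extChartAt I p).map_target (hrD hy')
  have hcy : extChartAt I p (c t₁) = y' := by rw [← hcy', (extChartAt I p).right_inv (hrD hy')]
  have hall' : ∀ t ∈ Icc 0 t₁, c t ∈ (extChartAt I p).source ∧
      extChartAt I p (c t) ∈ Metric.closedBall y₀ r ∩ range I := fun t ht => by
    rcases ht.2.eq_or_lt with h | h
    · rw [h, hcy]; exact ⟨hsrc₁, hy'⟩
    · exact ⟨(hlt t ⟨ht.1, h⟩).1, hVK _ (hlt t ⟨ht.1, h⟩)⟩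
  obtain ⟨h1, h2, h3⟩ := hcurve (Icc 0 t₁) hsub fun t ht => (hall' t ht).1
  have hr : ‖(extChartAt I p ∘ c) t₁ - y₀‖ = r := by
    refine le_antisymm (mem_closedBall_iff_norm.1 (hall' t₁ ⟨hpos.le, le_rfl⟩).2.1) ?_
    by_contra! hcon
    exact ht₁B.2 ⟨hsrc₁, mem_ball_iff_norm.2 hcon⟩
  refine (hout _ _ _ t₁ hpos.le h1 h2 (fun t ht => (hall' t ht).2) (by rw [Function.comp_apply, hc0, hxy]) hr
    (hσ.mono hsub) (fun t _ => hσ0 t) h3).trans ?_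
  exact intervalIntegral.integral_mono_interval le_rfl hpos.le ht₁B.1.2
    (Filter.Eventually.of_forall hσ0) (hσ.intervalIntegrable_of_Icc zero_le_one)

end Lengths

/-! ### Good directions near the boundary. -/

section GoodDirections

variable {E : Type*} [NormedAddCommGroup E] [NormedSpace ℝ E] [FiniteDimensional ℝ E]
  {H : Type*} [TopologicalSpace H] {I : ModelWithCorners ℝ E H}
  {M : Type*} [TopologicalSpace M] [ChartedSpace H M] [IsManifold I ∞ M] [T2Space M]
  {F : TangentBundle I M → ℝ} {ℓ : E →L[ℝ] ℝ} {ρ : E → E}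

/-- Near a point of the strictly convex boundary, all directions which do not point inwards (in a
fixed chart) are good. -/
theorem HasStrictlyConvexBoundary.eventually_mem_goodDirections (hF : IsFinslerMetric F)
    (hconv : HasStrictlyConvexBoundary F) (hR : IsHalfSpace (range I) ℓ ρ) (hℓ : ℓ ≠ 0) {p : M}
    (hp : p ∈ I.boundary M) : ∀ᶠ x in 𝓝 p, ∀ v : TangentSpace I x, v ≠ 0 →
      ℓ (tangentChart I p ⟨x, v⟩).2 ≤ 0 → v ∈ goodDirections F x := by
  have hCF := isCoordFinsler_chartEnergy hF p
  have hps := mem_extChartAt_source (I := I) p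
  have hpt := mem_extChartAt_target (I := I) p
  have hy₀R := extChartAt_target_subset_range p hpt
  have hy₀ : ℓ (extChartAt I p p) = 0 := (mem_boundary_iff_of_mem_source hR hℓ hps).1 hp
  obtain ⟨r, hr, hrD⟩ : ∃ r > 0,
      Metric.closedBall (extChartAt I p p) r ∩ range I ⊆ (extChartAt I p).target :=
    (nhdsWithin_hasBasis Metric.nhds_basis_closedBall _).mem_iff.1 (extChartAt_target_mem_nhdsWithin p)
  obtain ⟨r', hr', hr'r, hexit⟩ := hCF.exists_minimizing_exit hR hy₀
    (fun w hw0 hw => hconv.apply_chartSpray_neg hF hR hℓ hp hw0 hw) hr hrD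
  filter_upwards [extChartAt_source_mem_nhds (I := I) p,
    (continuousAt_extChartAt (I := I) p).preimage_mem_nhds (Metric.closedBall_mem_nhds _ hr')]
    with x hx hxr v hv hℓv
  set u := (tangentChart I p ⟨x, v⟩).2 with hu
  have hu0 : u ≠ 0 := tangentChart_snd_ne_zero (ζ := ⟨x, v⟩) hx hv
  -- The exit trajectory starts with the unit vector u/c and is then run at speed c.
  set c := ‖u‖ with hc_def
  have hc : 0 < c := norm_pos_iff.2 hu0
  have hxt := (extChartAt I p).map_source hx
  obtain ⟨z, T, T₀, tr, hin, hout⟩ := hexit (extChartAt I p x)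
    ⟨hxr, extChartAt_target_subset_range p hxt⟩ (c⁻¹ • u) (norm_smul_inv_norm hu0) (by
      rw [map_smul, smul_eq_mul]
      exact mul_nonpos_of_nonneg_of_nonpos (inv_nonneg.2 hc.le) hℓv)
  have hTc : c * (T / c) = T := mul_div_cancel₀ T hc.ne'
  have hscale : velocityScale c (extChartAt I p x, c⁻¹ • u) = tangentChart I p ⟨x, v⟩ :=
    Prod.ext rfl (smul_inv_smul₀ hc.ne' u)
  have h0 : liftCurve I p z c 0 = ⟨x, v⟩ := by
    rw [liftCurve, mul_zero, tr.zero, hscale]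
    exact (tangentChart I p).left_inv (mem_tangentChart_source.2 hx)
  have hzT : (z (c * (T / c))).1 ∈ (extChartAt I p).target := by
    rw [hTc]
    exact hrD (tr.fst_mem hR ⟨tr.nonneg, le_rfl⟩)
  have hend : (liftCurve I p z c (T / c)).1 = (extChartAt I p).symm (z T).1 := by
    rw [liftCurve_fst hzT, hTc]
  rw [hTc] at hzT
  refine ⟨hv, T / c, liftCurve I p z c, ⟨div_nonneg tr.nonneg hc.le,
    tr.isGeodesicOn_liftCurve hF hR hrD hc, h0, fun T' η' _ hη' h0' => ?_⟩, ?_,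
    fun c' hc' hc'0 hc'1 => ?_⟩
  · rw [le_div_iff₀' hc]
    exact tr.mul_le_of_isGeodesicOn hF hR hy₀R hrD hc hη' (by rw [h0']; exact hx)
      (by rw [h0', hscale])
  · rw [hend, mem_boundary_iff_of_mem_source hR hℓ ((extChartAt I p).map_target hzT),
      (extChartAt I p).right_inv hzT]
    exact tr.exit
  · rw [tr.curveLength_liftCurve hF hR hrD hc]
    simp only [h0] at hc'0
    refine le_curveLength hF hR hrD hx rfl
      (Metric.closedBall_subset_ball hr'r hxr) hin hout hc' hc'0 ?_
    rw [hc'1]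
    simp only
    rw [hend, (extChartAt I p).right_inv hzT]

/-- For each x near p the fibre chart is linear, so ℓ takes opposite values at v and -v, and one of
them is nonpositive. -/
theorem HasStrictlyConvexBoundary.mem_nhdsSet_boundary (hF : IsFinslerMetric F)
    (hconv : HasStrictlyConvexBoundary F) (hR : IsHalfSpace (range I) ℓ ρ) (hℓ : ℓ ≠ 0) :
    {x : M | symmetrization (goodDirections F x) = {v | v ≠ 0}} ∈ 𝓝ˢ (I.boundary M) := by
  refine mem_nhdsSet_iff_forall.2 fun p hp => ?_
  filter_upwards [hconv.eventually_mem_goodDirections hF hR hℓ hp] with x hx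
  ext v
  constructor
  · rintro (h | h)
    · exact h.1
    · exact neg_ne_zero.1 h.1
  · intro hv
    rcases le_total (ℓ (tangentChart I p ⟨x, v⟩).2) 0 with h | h
    · exact Or.inl (hx v hv h)
    · refine Or.inr (hx (-v) (neg_ne_zero.2 hv) ?_)
      have h1 : (tangentChart I p ⟨x, -v⟩).2 = -(tangentChart I p ⟨x, v⟩).2 :=
        map_neg (tangentCoordChange I x p x) v
      rw [h1, map_neg]
      exact neg_nonpos.2 h

end GoodDirections

/-! ### The standard half-space. -/

section EuclideanHalfSpace

variable (n : ℕ) [NeZero n]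

/-- The retraction replaces the coordinate x₀ by max(x₀, 0) and keeps the others, so it is
nonexpansive coordinate by coordinate. -/
theorem isHalfSpace_range_modelWithCornersEuclideanHalfSpace :
    IsHalfSpace (range (𝓡∂ n)) (EuclideanSpace.proj 0 : EuclideanSpace ℝ (Fin n) →L[ℝ] ℝ)
      (fun y => (𝓡∂ n) ((𝓡∂ n).symm y)) where
  mem_iff y := by
    rw [range_modelWithCornersEuclideanHalfSpace]
    rfl
  lipschitz := by
    refine LipschitzWith.of_dist_le_mul fun x y => ?_
    rw [NNReal.coe_one, one_mul, EuclideanSpace.dist_eq, EuclideanSpace.dist_eq]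
    refine Real.sqrt_le_sqrt (Finset.sum_le_sum fun i _ => ?_)
    refine pow_le_pow_left₀ dist_nonneg ?_ 2
    by_cases hi : i = 0
    · subst hi
      simpa [modelWithCornersEuclideanHalfSpace_symm_apply, Real.dist_eq] using
        abs_max_sub_max_le_abs (x 0) (y 0) 0
    · simp [modelWithCornersEuclideanHalfSpace_symm_apply, hi]
  maps y := mem_range_self _
  eq_self y hy := (𝓡∂ n).right_inv hy

theorem euclideanSpace_proj_zero_ne_zero :
    (EuclideanSpace.proj 0 : EuclideanSpace ℝ (Fin n) →L[ℝ] ℝ) ≠ 0 := fun h => by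
  have := DFunLike.congr_fun h (EuclideanSpace.single 0 1)
  simp at this

end EuclideanHalfSpace

end Finsler

end

theorem lemma2p5 (n : ℕ) [NeZero n]
    (M : Type*) [TopologicalSpace M] [T2Space M] [ChartedSpace (EuclideanHalfSpace n) M]
    [IsManifold (𝓡∂ n) ∞ M]
    (F : TangentBundle (𝓡∂ n) M → ℝ) (hF : Finsler.IsFinslerMetric F)
    (hconv : Finsler.HasStrictlyConvexBoundary F) :
    {x : M | Finsler.symmetrization (Finsler.goodDirections F x) = {v | v ≠ 0}}
      ∈ 𝓝ˢ ((𝓡∂ n).boundary M) :=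
  hconv.mem_nhdsSet_boundary hF (Finsler.isHalfSpace_range_modelWithCornersEuclideanHalfSpace n)
    (Finsler.euclideanSpace_proj_zero_ne_zero n)
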